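/- Let $p$ be a prime and let $k, n \ge 0$ be integers. Let $W$ be the ring scheme of $p$-typical Witt vectors over $\mathbf{Z}/p^k$, with Witt vector Frobenius $F$ and Verschiebung $V$, let $W_n = W/V^n$ be the scheme of $n$-truncated Witt vectors, let $W^\times$ be the group scheme of units of $W$, and let $W^\times[F^n] := \ker(F^n \colon W^\times \to W^\times)$. Then the Cartier dual $\underline{\mathrm{Hom}}(W^\times[F^n], \mathbf{G}_m)$ of $W^\times[F^n]$ over $\mathbf{Z}/p^k$, i.e. the functor sending a $\mathbf{Z}/p^k$-algebra $R$ to the group of homomorphisms $W^\times[F^n]_R \to \mathbf{G}_{m,R}$ of group schemes over $R$, is isomorphic, as a commutative (formal) group scheme over $\mathbf{Z}/p^k$, to the completion of the additive group scheme $W_n$ at its $\mathbf{F}_p$-rational points, i.e. to the functor $R \mapsto \{x \in W_n(R) : x(I^m) = 0 \text{ for some } m\}$, where $I \subset \mathcal{O}(W_n) = (\mathbf{Z}/p^k)[x_0,\dots,x_{n-1}]$ is the ideal of functions vanishing at all $\mathbf{F}_p$-points of $W_n$ and $x \in W_n(R)$ is viewed as a homomorphism $\mathcal{O}(W_n) \to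 R$. Moreover $W_n(\mathbf{F}_p) \cong \mathbf{Z}/p^n$. -/

import Mathlib

open CategoryTheory

universe u v

noncomputable section

namespace WittCartier

/-! ### Commutative group functors and Cartier duality

A commutative group scheme (or formal group scheme) over `K` is described by its functor of points
on commutative `K`-algebras. -/

section Duality

variable {K : Type v} [CommRing K]

/-- The multiplicative group `S ↦ Sˣ`. -/
def gm (K : Type v) [CommRing K] : CommAlgCat.{u} K ⥤ CommGrpCat.{u} where
  obj S := CommGrpCat.of Sˣ
  map f := CommGrpCat.ofHom (Units.map (f.hom : _ →* _))

/-- A homomorphism of group functors over `R` from `G ×_K R` to `𝔾ₘ ×_K R`: a family of group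
homomorphisms `G(S) → Sˣ`, one for each `R`-algebra `S` (that is, for each morphism `s : R ⟶ S` of
`K`-algebras), natural in the `R`-algebra `S`. -/
structure Character (G : CommAlgCat.{u} K ⥤ CommGrpCat.{u}) (R : CommAlgCat.{u} K) where
  app : ∀ {S : CommAlgCat.{u} K}, (R ⟶ S) → (G.obj S →* (gm K).obj S)
  naturality : ∀ {S T : CommAlgCat.{u} K} (s : R ⟶ S) (g : S ⟶ T) (x : G.obj S),
    app (s ≫ g) (G.map g x) = (gm K).map g (app s x)

namespace Character

variable {G : CommAlgCat.{u} K ⥤ CommGrpCat.{u}} {R : CommAlgCat.{u} K}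

instance : One (Character G R) :=
  ⟨{ app := fun _ => 1
     naturality := fun s g x => by simp }⟩

instance : Mul (Character G R) :=
  ⟨fun a b =>
    { app := fun s => a.app s * b.app s
      naturality := fun s g x => by simp [a.naturality, b.naturality] }⟩

instance : Inv (Character G R) :=
  ⟨fun a =>
    { app := fun s => (a.app s)⁻¹
      naturality := fun s g x => by simp [a.naturality] }⟩

@[simp] lemma one_app {S : CommAlgCat.{u} K} (s : R ⟶ S) : (1 : Character G R).app s = 1 := rfl

@[simp] lemma mul_app (a b : Character G R) {S : CommAlgCat.{u} K} (s : R ⟶ S) :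
    (a * b).app s = a.app s * b.app s := rfl

@[simp] lemma inv_app (a : Character G R) {S : CommAlgCat.{u} K} (s : R ⟶ S) :
    (a⁻¹).app s = (a.app s)⁻¹ := rfl

lemma ext' {a b : Character G R}
    (h : ∀ (S : CommAlgCat.{u} K) (s : R ⟶ S), a.app s = b.app s) : a = b := by
  have key : @app _ _ _ _ a = @app _ _ _ _ b := by
    funext S s
    exact h S s
  cases a
  cases b
  cases key
  rfl

/-- Characters form a group under pointwise multiplication. -/
instance : CommGroup (Character G R) where
  mul_assoc a b c := ext' fun S s => by simp [mul_assoc]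
  one_mul a := ext' fun S s => by simp
  mul_one a := ext' fun S s => by simp
  inv_mul_cancel a := ext' fun S s => by simp
  mul_comm a b := ext' fun S s => by simp [mul_comm]

/-- Base change of characters along `f : R ⟶ R'`: restriction to `R'`-algebras. -/
def baseChange {R' : CommAlgCat.{u} K} (f : R ⟶ R') : Character G R →* Character G R' where
  toFun a :=
    { app := fun s => a.app (f ≫ s)
      naturality := fun s g x => by rw [← Category.assoc, a.naturality] }
  map_one' := rfl
  map_mul' _ _ := rfl

end Character

/-- The Cartier dual `Hom(G, 𝔾ₘ)` of a commutative group functor `G`: its `R`-points are the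
homomorphisms `G ×_K R → 𝔾ₘ ×_K R` of group functors over `R`. -/
def cartierDual (G : CommAlgCat.{u} K ⥤ CommGrpCat.{u}) :
    CommAlgCat.{u} K ⥤ CommGrpCat.{max v (u + 1)} where
  obj R := CommGrpCat.of (Character G R)
  map f := CommGrpCat.ofHom (Character.baseChange f)
  map_id R := by
    apply CommGrpCat.hom_ext
    apply MonoidHom.ext
    intro a
    exact Character.ext' fun S s => congrArg a.app (Category.id_comp s)
  map_comp f g := by
    apply CommGrpCat.hom_ext
    apply MonoidHom.ext
    intro a
    exact Character.ext' fun S s => congrArg a.app (Category.assoc f g s)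

end Duality

/-! ### The group scheme `W^×[F^n]` -/

section WittUnits

variable (p : ℕ) [Fact p.Prime]

/-- The endomorphism `F^n` of the group of units of `W(S)`. -/
def unitsFrobeniusPow (n : ℕ) (S : Type u) [CommRing S] :
    (WittVector p S)ˣ →* (WittVector p S)ˣ :=
  Units.map ((WittVector.frobenius ^ n : WittVector p S →+* WittVector p S) : _ →* _)

lemma map_frobenius_pow {S T : Type u} [CommRing S] [CommRing T] (f : S →+* T) (n : ℕ)
    (x : WittVector p S) :
    WittVector.map f ((WittVector.frobenius ^ n : WittVector p S →+* WittVector p S) x) =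
      (WittVector.frobenius ^ n : WittVector p T →+* WittVector p T) (WittVector.map f x) := by
  induction n generalizing x with
  | zero => simp
  | succ n ih =>
    rw [pow_succ, pow_succ, RingHom.mul_def, RingHom.mul_def, RingHom.comp_apply,
      RingHom.comp_apply, ih]
    congr 1
    exact (WittVector.frobenius_isPoly p).map f x

/-- `W^×[F^n] = ker(F^n : W^× → W^×)`, as a group functor on `K`-algebras. -/
def wittUnitsFrobeniusKer (n : ℕ) (K : Type v) [CommRing K] :
    CommAlgCat.{u} K ⥤ CommGrpCat.{u} where
  obj S := CommGrpCat.of (unitsFrobeniusPow p n S).ker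
  map {S T} f := CommGrpCat.ofHom
    (((Units.map ((WittVector.map (f.hom : S →+* T) : WittVector p S →+* WittVector p T) :
        _ →* _)).comp (unitsFrobeniusPow p n S).ker.subtype).codRestrict
      (unitsFrobeniusPow p n T).ker (by
        rintro ⟨x, hx⟩
        rw [MonoidHom.mem_ker] at hx ⊢
        have h : (WittVector.frobenius ^ n : WittVector p S →+* WittVector p S) (x : WittVector p S) = 1 :=
          congrArg Units.val hx
        apply Units.ext
        change (WittVector.frobenius ^ n : WittVector p T →+* WittVector p T)
          (WittVector.map (f.hom : S →+* T) (x : WittVector p S)) = 1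
        rw [← map_frobenius_pow, h, map_one]))
  map_id S := by
    apply CommGrpCat.hom_ext
    apply MonoidHom.ext
    intro x
    apply Subtype.ext
    apply Units.ext
    apply WittVector.ext
    intro i
    rfl
  map_comp f g := by
    apply CommGrpCat.hom_ext
    apply MonoidHom.ext
    intro x
    apply Subtype.ext
    apply Units.ext
    apply WittVector.ext
    intro i
    rfl

end WittUnits

/-! ### The completion of `W_n` at its `𝔽_p`-points -/

section Completion

variable (p : ℕ) [Fact p.Prime] (k n : ℕ)

/-- The map `W_n(S) → W_n(T)` induced by a ring homomorphism `S → T`. -/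
def truncMap {S T : Type*} [CommRing S] [CommRing T] (f : S →+* T) :
    TruncatedWittVector p n S →+ TruncatedWittVector p n T where
  toFun x := TruncatedWittVector.mk p fun i => f (x.coeff i)
  map_zero' := by
    ext i
    simp
  map_add' x y := by
    obtain ⟨x, rfl⟩ := WittVector.truncate_surjective p n S x
    obtain ⟨y, rfl⟩ := WittVector.truncate_surjective p n S y
    have h : ∀ z : WittVector p S,
        (TruncatedWittVector.mk p fun i => f ((WittVector.truncate n z).coeff i)) =
          WittVector.truncate n (WittVector.map f z) := by
      intro z
      ext i
      simp [WittVector.map_coeff]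
    rw [← map_add, h, h, h, map_add, map_add]

@[simp] lemma coeff_truncMap {S T : Type*} [CommRing S] [CommRing T] (f : S →+* T)
    (x : TruncatedWittVector p n S) (i : Fin n) : (truncMap p n f x).coeff i = f (x.coeff i) :=
  TruncatedWittVector.coeff_mk _ _

/-- The coordinate ring `(ℤ/p^k)[x_0, …, x_{n-1}]` of the scheme `W_n` over `ℤ/p^k`. -/
abbrev coordRing : Type := MvPolynomial (Fin n) (ZMod (p ^ k))

/-- An `R`-point of `W_n`, as a homomorphism from the coordinate ring to `R`. -/
def pointHom {R : Type u} [CommRing R] [Algebra (ZMod (p ^ k)) R]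
    (x : TruncatedWittVector p n R) : coordRing p k n →ₐ[ZMod (p ^ k)] R :=
  MvPolynomial.aeval fun i => x.coeff i

/-- The ideal of functions on `W_n` vanishing at every `𝔽_p`-point
`Spec 𝔽_p → W_n` (that is, in the kernel of every ring homomorphism to `𝔽_p`). -/
def rationalPointsIdeal : Ideal (coordRing p k n) :=
  ⨅ y : coordRing p k n →+* ZMod p, RingHom.ker y

/-- The `R`-point `x` of `W_n` factors through some infinitesimal neighbourhood
`Spec (𝒪/I^m)` of the closed subscheme of `𝔽_p`-points. -/
def InCompletion {R : Type u} [CommRing R] [Algebra (ZMod (p ^ k)) R]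
    (x : TruncatedWittVector p n R) : Prop :=
  ∃ m : ℕ, ∀ f ∈ rationalPointsIdeal p k n ^ m, pointHom p k n x f = 0

instance : Finite (coordRing p k n →+* ZMod p) := by
  refine Finite.of_injective
    (fun (y : coordRing p k n →+* ZMod p) (i : Fin n) => y (MvPolynomial.X i)) ?_
  intro y z h
  apply MvPolynomial.ringHom_ext'
  · exact Subsingleton.elim _ _
  · exact fun i => congrFun h i

/-- A point lies in the completion if and only if over every residue domain of `R` it
comes from an `𝔽_p`-point. -/
lemma inCompletion_iff {R : Type u} [CommRing R] [Algebra (ZMod (p ^ k)) R]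
    (x : TruncatedWittVector p n R) :
    InCompletion p k n x ↔ ∀ P : Ideal R, P.IsPrime →
      ∃ (c : ZMod p →+* R ⧸ P) (y : TruncatedWittVector p n (ZMod p)),
        truncMap p n (Ideal.Quotient.mk P) x = truncMap p n c y := by
  constructor
  · rintro ⟨m, hm⟩ P hP
    have hle : rationalPointsIdeal p k n ≤ P.comap (pointHom p k n x) := by
      intro f hf
      have h : pointHom p k n x (f ^ m) = 0 := hm _ (Ideal.pow_mem_pow hf m)
      rw [map_pow] at h
      exact hP.mem_of_pow_mem m (h ▸ P.zero_mem)
    have hQ : (P.comap (pointHom p k n x)).IsPrime := Ideal.comap_isPrime _ _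
    have : Fintype (coordRing p k n →+* ZMod p) := Fintype.ofFinite _
    obtain ⟨y, hy⟩ : ∃ y : coordRing p k n →+* ZMod p,
        RingHom.ker y ≤ P.comap (pointHom p k n x) := by
      have h2 : (Finset.univ.inf fun y : coordRing p k n →+* ZMod p => RingHom.ker y) ≤
          P.comap (pointHom p k n x) := by
        rw [Finset.inf_univ_eq_iInf]
        exact hle
      obtain ⟨y, -, hy⟩ := (Ideal.IsPrime.inf_le' hQ).1 h2
      exact ⟨y, hy⟩
    have hsurj : Function.Surjective y := ZMod.ringHom_surjective y
    let g : coordRing p k n →+* R ⧸ P :=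
      (Ideal.Quotient.mk P).comp (pointHom p k n x : coordRing p k n →+* R)
    have hg : RingHom.ker y ≤ RingHom.ker g := by
      intro f hf
      have := hy hf
      rw [RingHom.mem_ker]
      exact Ideal.Quotient.eq_zero_iff_mem.2 this
    refine ⟨y.liftOfSurjective hsurj ⟨g, hg⟩,
      TruncatedWittVector.mk p fun i => y (MvPolynomial.X i), ?_⟩
    ext i
    rw [coeff_truncMap, coeff_truncMap, TruncatedWittVector.coeff_mk]
    have := RingHom.liftOfRightInverse_comp_apply y (Function.surjInv hsurj)
      (Function.rightInverse_surjInv hsurj) ⟨g, hg⟩ (MvPolynomial.X i)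
    refine Eq.trans ?_ this.symm
    simp [g, pointHom]
  · intro H
    have hrad : rationalPointsIdeal p k n ≤ (RingHom.ker (pointHom p k n x)).radical := by
      intro f hf
      have hnil : IsNilpotent (pointHom p k n x f) := by
        rw [← mem_nilradical, nilradical_eq_sInf, Ideal.mem_sInf]
        intro P hP
        obtain ⟨c, y, hcy⟩ := H P hP
        have hk : k ≠ 0 := by
          rintro rfl
          have h1 : (1 : ZMod (p ^ 0)) = 0 :=
            (ZMod.subsingleton_iff.2 (pow_zero p)).elim _ _
          have h2 : (1 : R) = 0 := by
            rw [← map_one (algebraMap (ZMod (p ^ 0)) R), h1, map_zero]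
          exact hP.ne_top ((Ideal.eq_top_iff_one P).2 (h2 ▸ P.zero_mem))
        let y' : coordRing p k n →+* ZMod p :=
          MvPolynomial.eval₂Hom (ZMod.castHom (dvd_pow_self p hk) (ZMod p)) fun i => y.coeff i
        have hy : y' f = 0 := (Ideal.mem_iInf.1 hf) y'
        have hcomp : (Ideal.Quotient.mk P).comp (pointHom p k n x : coordRing p k n →+* R) =
            c.comp y' := by
          apply MvPolynomial.ringHom_ext'
          · exact Subsingleton.elim _ _
          · intro i
            have := congrArg (TruncatedWittVector.coeff i) hcy
            simpa [y', pointHom] using this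
        have := RingHom.congr_fun hcomp f
        rw [RingHom.comp_apply, RingHom.comp_apply, hy, map_zero] at this
        exact Ideal.Quotient.eq_zero_iff_mem.1 this
      obtain ⟨m, hm⟩ := hnil
      exact ⟨m, by rw [RingHom.mem_ker, map_pow, hm]⟩
    obtain ⟨m, hm⟩ := Ideal.exists_pow_le_of_le_radical_of_fg hrad
      (IsNoetherian.noetherian _)
    exact ⟨m, fun f hf => hm hf⟩

lemma exists_hom_residue (R : Type u) [CommRing R] [Algebra (ZMod (p ^ k)) R] (P : Ideal R)
    (hP : P.IsPrime) : Nonempty (ZMod p →+* R ⧸ P) := by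
  have h : (p : R) ^ k = 0 := by
    have h1 : (p : ZMod (p ^ k)) ^ k = 0 := by
      rw [← Nat.cast_pow, ZMod.natCast_self]
    rw [← map_natCast (algebraMap (ZMod (p ^ k)) R), ← map_pow, h1, map_zero]
  have hp : (p : R) ∈ P := hP.mem_of_pow_mem k (h ▸ P.zero_mem)
  have h0 : ((p : ℕ) : R ⧸ P) = 0 := by
    rw [← map_natCast (Ideal.Quotient.mk P)]
    exact Ideal.Quotient.eq_zero_iff_mem.2 hp
  have := (CharP.charP_iff_prime_eq_zero (R := R ⧸ P) (Fact.out : p.Prime)).2 h0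
  exact ⟨ZMod.castHom dvd_rfl _⟩

/-- The points of the completion of `W_n` at its `𝔽_p`-points form a subgroup of `W_n(R)`. -/
def completionSubgroup (R : Type u) [CommRing R] [Algebra (ZMod (p ^ k)) R] :
    AddSubgroup (TruncatedWittVector p n R) where
  carrier := {x | InCompletion p k n x}
  zero_mem' := (inCompletion_iff p k n _).2 fun P hP => by
    obtain ⟨c⟩ := exists_hom_residue p k R P hP
    exact ⟨c, 0, by rw [map_zero, map_zero]⟩
  add_mem' {x x'} hx hx' := (inCompletion_iff p k n _).2 fun P hP => by
    obtain ⟨c, y, h⟩ := (inCompletion_iff p k n _).1 hx P hP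
    obtain ⟨c', y', h'⟩ := (inCompletion_iff p k n _).1 hx' P hP
    obtain rfl : c = c' := Subsingleton.elim _ _
    exact ⟨c, y + y', by rw [map_add, map_add, h, h']⟩
  neg_mem' {x} hx := (inCompletion_iff p k n _).2 fun P hP => by
    obtain ⟨c, y, h⟩ := (inCompletion_iff p k n _).1 hx P hP
    exact ⟨c, -y, by rw [map_neg, map_neg, h]⟩

lemma InCompletion.map {R S : Type u} [CommRing R] [Algebra (ZMod (p ^ k)) R] [CommRing S]
    [Algebra (ZMod (p ^ k)) S] (g : R →ₐ[ZMod (p ^ k)] S) {x : TruncatedWittVector p n R}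
    (hx : InCompletion p k n x) : InCompletion p k n (truncMap p n (g : R →+* S) x) := by
  obtain ⟨m, hm⟩ := hx
  refine ⟨m, fun f hf => ?_⟩
  have hcomp : pointHom p k n (truncMap p n (g : R →+* S) x) = g.comp (pointHom p k n x) := by
    apply MvPolynomial.algHom_ext
    intro i
    simp [pointHom]
  rw [hcomp, AlgHom.comp_apply, hm f hf, map_zero]

/-- The completion of the group scheme `W_n` over `ℤ/p^k` at its `𝔽_p`-points, as a
group functor: the filtered union over `m` of the functors represented by `𝒪/I^m`. -/
def wittCompletion : CommAlgCat.{u} (ZMod (p ^ k)) ⥤ AddCommGrpCat.{u} where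
  obj R := AddCommGrpCat.of (completionSubgroup p k n R)
  map {R S} f := AddCommGrpCat.ofHom
    (((truncMap p n (f.hom : R →+* S)).comp (completionSubgroup p k n R).subtype).codRestrict
      (completionSubgroup p k n S) fun x => InCompletion.map p k n f.hom x.2)
  map_id R := by
    apply AddCommGrpCat.hom_ext
    apply AddMonoidHom.ext
    intro x
    apply Subtype.ext
    apply TruncatedWittVector.ext
    intro i
    rfl
  map_comp f g := by
    apply AddCommGrpCat.hom_ext
    apply AddMonoidHom.ext
    intro x
    apply Subtype.ext
    apply TruncatedWittVector.ext
    intro i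
    rfl

end Completion

end WittCartier

end

noncomputable section

namespace WittCartier

/-! ### Witt vectors over rings without `p`-torsion -/

section Ghost

variable {p : ℕ} [hp : Fact p.Prime] {A B : Type*} [CommRing A] [CommRing B]

open WittVector

/-! The duality is an explicit pairing built from the Artin–Hasse exponential E(X) = exp(∑
X^(p^j)/p^j), which has coefficients in ℤ_p. The ring ℤ_p[[X]] carries the Frobenius lift X ↦ X^p,
hence a ring homomorphism s to its Witt vectors, and s(E) is a unit with F^n s(E) = s(E(X^(p^n))).
It therefore gives a point of W^×[F^n] over R[X]/X^(p^n) (`ahPoint`), and evaluating a character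
there produces its `value`, a truncated power series. On the other side, x ↦ ∏_{i<n} E(x_i X^(p^i))
modulo X^(p^n) is an injective homomorphism on W_n(R) (`truncExp`), because its logarithmic
derivative is the generating series of the ghost components. The theorem follows once values
determine characters and the values are exactly the series of those x with every x_i^p - x_i
nilpotent, the condition that cuts out the completion (`inCompletion_iff_isNilpotent`).

Both facts are proved by induction on n along 1 → W^×[F] → W^×[F^(n+1)] → W^×[F^n] → 1, whose last
map is F. Since p is nilpotent and F is X_i ↦ X_i^p modulo p, the algebra of Frobenius preimages of
a Witt vector is free on the monomials with exponents below p (`frobCoverBasis`). So F is a cover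
for which descent is elementary, and a character trivial on W^×[F] is pulled back along F
(`RingChar.exists_pullback_eq`). Pullback replaces X by X^p in the value, which is Verschiebung on
the Witt vector side.

For W^×[F] the test object is the Witt vector with ghost components (1 + X, 1, 1, …) over the
divided power polynomials; the coordinate ring embeds there by a computation of leading coefficients
(`exists_frobCover_one_embedding`). Translation by 1 + ε shows that the value c of a character
satisfies (1 + X) c' = t c, so c is (1 + X)^t, with divided power coordinates ∏_{j<i} (t - j). Thus
t determines the character, and finiteness of the expansion forces t^p - t to be nilpotent.

Conversely every such t occurs (`RingChar.exists_value_eq`). Up to a nilpotent z it is ∑ e_j j for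
orthogonal idempotents e_j, which gives the character ∑ e_j u_0^j. The nilpotent z is paired,
through E, with the integral logarithm (1/p) log(u^p / F u). Since E(X)^p = E(X^p) exp(pX), this
logarithm is the Teichmüller lift of X at the Artin–Hasse point, and the value is E(zX). -/

lemma ghostComponent_eq_sum (n : ℕ) (x : WittVector p A) :
    ghostComponent n x =
      ∑ i ∈ Finset.range (n + 1), (p : A) ^ i * x.coeff i ^ p ^ (n - i) := by
  rw [ghostComponent_apply, wittPolynomial_eq_sum_C_mul_X_pow, map_sum]
  simp

lemma ghostComponent_map (f : A →+* B) (n : ℕ) (x : WittVector p A) :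
    ghostComponent n (WittVector.map f x) = f (ghostComponent n x) := by
  simp [ghostComponent_eq_sum]

/-- The n-th ghost component is p^n x_n plus terms in the earlier coefficients, so cancelling p^n
recovers the coefficients one by one. -/
lemma eq_of_ghostComponent_eq (hA : IsLeftRegular (p : A)) {x y : WittVector p A}
    (h : ∀ n, ghostComponent n x = ghostComponent n y) : x = y := by
  apply WittVector.ext
  intro n
  induction n using Nat.strong_induction_on with
  | _ n ih =>
    have h1 := h n
    rw [ghostComponent_eq_sum, ghostComponent_eq_sum, Finset.sum_range_succ,
      Finset.sum_range_succ, Finset.sum_congr rfl (g := fun i => (p : A) ^ i *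
        y.coeff i ^ p ^ (n - i)) (fun i hi => by rw [ih i (Finset.mem_range.1 hi)])] at h1
    simpa using hA.pow n (by simpa using h1)

lemma isLeftRegular_wittVector (hA : IsLeftRegular (p : A)) :
    IsLeftRegular (p : WittVector p A) := by
  intro x y hxy
  refine eq_of_ghostComponent_eq hA fun n => hA ?_
  simpa using congrArg (ghostComponent n) hxy

/-- The coefficients of a Witt vector with prescribed ghost components, if there is one. -/
def coeffOfGhost (p : ℕ) (g : ℕ → A) : ℕ → A
  | n => by
    classical
    -- The bound `i.2` is introduced only for the termination check. The default `0` is never taken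
    -- when the congruences of Dwork's lemma hold.
    exact if h : ∃ a, g n = (∑ i : Fin n, (p : A) ^ (i : ℕ) *
      (have _ := i.2; coeffOfGhost p g i) ^ p ^ (n - i)) + p ^ n * a then h.choose else 0

/-- **Dwork's lemma**. -/
lemma exists_ghostComponent_eq (φ : A →+* A) (hφ : ∀ a, (p : A) ∣ φ a - a ^ p) (g : ℕ → A)
    (hg : ∀ i, (p : A) ^ (i + 1) ∣ g (i + 1) - φ (g i)) :
    ∃ x : WittVector p A, ∀ n, ghostComponent n x = g n := by
  set c := coeffOfGhost p g with hc
  have step : ∀ n, (∃ a, g n = (∑ i : Fin n, (p : A) ^ (i : ℕ) * c i ^ p ^ (n - i)) + p ^ n * a) →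
      g n = ∑ i ∈ Finset.range (n + 1), (p : A) ^ i * c i ^ p ^ (n - i) := by
    intro n h
    have h1 : c n = h.choose := by
      change coeffOfGhost p g n = _
      rw [coeffOfGhost]
      exact dif_pos h
    rw [Finset.sum_range_succ, ← Fin.sum_univ_eq_sum_range (fun i => (p : A) ^ i * c i ^ p ^ (n - i)),
      h1, Nat.sub_self, pow_zero, pow_one]
    exact h.choose_spec
  have key : ∀ n, g n = ∑ i ∈ Finset.range (n + 1), (p : A) ^ i * c i ^ p ^ (n - i) := by
    intro n
    induction n with
    | zero => exact step 0 ⟨g 0, by simp⟩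
    | succ n ih =>
      apply step
      -- Term by term: φ(c) ≡ c^p modulo p gives φ(c)^(p^j) ≡ c^(p^(j+1)) modulo p^(j+1), and the
      -- factor p^i supplies the remaining powers of p.
      have h1 : (p : A) ^ (n + 1) ∣
          φ (g n) - ∑ i ∈ Finset.range (n + 1), (p : A) ^ i * c i ^ p ^ (n + 1 - i) := by
        rw [ih, map_sum, ← Finset.sum_sub_distrib]
        refine Finset.dvd_sum fun i hi => ?_
        have hi' : i ≤ n := Nat.lt_succ_iff.1 (Finset.mem_range.1 hi)
        rw [map_mul, map_pow, map_pow, map_natCast, ← mul_sub,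
          show n + 1 - i = (n - i) + 1 by omega, pow_succ' p, pow_mul,
          show (p : A) ^ (n + 1) = p ^ i * p ^ (n - i + 1) by rw [← pow_add]; congr 1; omega]
        exact mul_dvd_mul_left _ (dvd_sub_pow_of_dvd_sub (hφ (c i)) (n - i))
      obtain ⟨a, ha⟩ := dvd_add (hg n) h1
      refine ⟨a, ?_⟩
      rw [Fin.sum_univ_eq_sum_range (fun i => (p : A) ^ i * c i ^ p ^ (n + 1 - i)), ← ha]
      ring
  refine ⟨WittVector.mk p c, fun n => ?_⟩
  rw [ghostComponent_eq_sum, key]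
  rfl

/-- A lift `φ` of Frobenius on a `p`-torsion free ring `A` induces a ring homomorphism
`A → W(A)` with ghost components `φ^n`. -/
def frobeniusLiftHom (hA : IsLeftRegular (p : A)) (φ : A →+* A)
    (hφ : ∀ a, (p : A) ∣ φ a - a ^ p) : A →+* WittVector p A :=
  have H (a : A) := exists_ghostComponent_eq φ hφ (fun n => (φ ^ n) a) fun i => by
    rw [pow_succ' φ, RingHom.mul_def, RingHom.comp_apply, sub_self]
    exact dvd_zero _
  { toFun := fun a => (H a).choose
    map_zero' := eq_of_ghostComponent_eq hA fun n => by
      rw [(H 0).choose_spec, map_zero, map_zero]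
    map_one' := eq_of_ghostComponent_eq hA fun n => by
      rw [(H 1).choose_spec, map_one, map_one]
    map_add' := fun a b => eq_of_ghostComponent_eq hA fun n => by
      rw [(H _).choose_spec, map_add, map_add, (H a).choose_spec, (H b).choose_spec]
    map_mul' := fun a b => eq_of_ghostComponent_eq hA fun n => by
      rw [(H _).choose_spec, map_mul, map_mul, (H a).choose_spec, (H b).choose_spec] }

variable (hA : IsLeftRegular (p : A)) (φ : A →+* A) (hφ : ∀ a, (p : A) ∣ φ a - a ^ p)

lemma ghostComponent_frobeniusLiftHom (n : ℕ) (a : A) :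
    ghostComponent n (frobeniusLiftHom hA φ hφ a) = (φ ^ n) a :=
  (exists_ghostComponent_eq φ hφ (fun n => (φ ^ n) a) fun i => by
    rw [pow_succ' φ, RingHom.mul_def, RingHom.comp_apply, sub_self]
    exact dvd_zero _).choose_spec n

lemma frobenius_frobeniusLiftHom (a : A) :
    frobenius (frobeniusLiftHom hA φ hφ a) = frobeniusLiftHom hA φ hφ (φ a) := by
  refine eq_of_ghostComponent_eq hA fun n => ?_
  rw [ghostComponent_frobenius, ghostComponent_frobeniusLiftHom, ghostComponent_frobeniusLiftHom,
    pow_succ]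
  rfl

lemma frobenius_map (f : A →+* B) (x : WittVector p A) :
    frobenius (WittVector.map f x) = WittVector.map f (frobenius x) := by
  ext n
  rw [coeff_frobenius, map_coeff, coeff_frobenius, MvPolynomial.aeval_def, MvPolynomial.aeval_def,
    ← MvPolynomial.coe_eval₂Hom, ← MvPolynomial.coe_eval₂Hom, ← RingHom.comp_apply f]
  refine RingHom.congr_fun (MvPolynomial.ringHom_ext' (Subsingleton.elim _ _) fun i => ?_) _
  simp

lemma ghostComponent_zero_eq (x : WittVector p A) : ghostComponent 0 x = x.coeff 0 := by
  simp [ghostComponent_eq_sum]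

/-- On the Witt vectors of any ring, `x ↦ F x - x^p` is divisible by `p`, by a universal
formula. -/
lemma exists_universal_frobenius_sub_pow : ∃ D : WittVector p (MvPolynomial ℕ ℤ),
    frobenius (WittVector.mk p MvPolynomial.X) - WittVector.mk p MvPolynomial.X ^ p = (p : WittVector p (MvPolynomial ℕ ℤ)) * D := by
  have hA : IsLeftRegular (p : MvPolynomial ℕ ℤ) :=
    IsLeftCancelMulZero.mul_left_cancel_of_ne_zero (Nat.cast_ne_zero.2 hp.out.ne_zero)
  -- The polynomial ring is the coordinate ring of W, and the Frobenius of W is a Frobenius lift on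
  -- it because its polynomials reduce to X_i^p modulo p.
  let φ : MvPolynomial ℕ ℤ →+* MvPolynomial ℕ ℤ := (MvPolynomial.bind₁ (frobeniusPoly p)).toRingHom
  have hφ : ∀ a, (p : MvPolynomial ℕ ℤ) ∣ φ a - a ^ p := by
    intro a
    have hmap : ∀ a, MvPolynomial.map (Int.castRingHom (ZMod p)) a = 0 →
        (p : MvPolynomial ℕ ℤ) ∣ a := by
      intro a h
      rw [← map_natCast (MvPolynomial.C : ℤ →+* MvPolynomial ℕ ℤ), MvPolynomial.C_dvd_iff_zmod]
      exact h
    apply hmap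
    rw [map_sub, sub_eq_zero, map_pow, ← frobenius_def]
    have h1 : (MvPolynomial.map (Int.castRingHom (ZMod p))).comp φ =
        (_root_.frobenius (MvPolynomial ℕ (ZMod p)) p).comp
          (MvPolynomial.map (Int.castRingHom (ZMod p))) := by
      apply MvPolynomial.ringHom_ext'
      · exact Subsingleton.elim _ _
      · intro i
        simp [φ, frobeniusPoly_zmod, frobenius_def]
    exact RingHom.congr_fun h1 a
  set s := frobeniusLiftHom hA φ hφ
  -- The generic Witt vector is the image of X_0, since φ^n(X_0) is the n-th Witt polynomial. The
  -- divisibility of φ(X_0) - X_0^p by p is then transported by the ring homomorphism s.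
  have hX : WittVector.mk p MvPolynomial.X = s (MvPolynomial.X 0) := by
    refine eq_of_ghostComponent_eq hA fun n => ?_
    rw [ghostComponent_frobeniusLiftHom]
    have h : ∀ n, (φ ^ n) (MvPolynomial.X 0) = wittPolynomial p ℤ n := by
      intro n
      induction n with
      | zero => simp
      | succ n ih =>
        rw [pow_succ', RingHom.mul_def, RingHom.comp_apply, ih]
        exact bind₁_frobeniusPoly_wittPolynomial p n
    rw [h, ghostComponent_apply]
    exact MvPolynomial.aeval_X_left_apply _
  obtain ⟨d, hd⟩ := hφ (MvPolynomial.X 0)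
  refine ⟨s d, ?_⟩
  rw [hX, frobenius_frobeniusLiftHom, ← map_pow, ← map_sub, hd, map_mul, map_natCast]

/-- Evaluation of polynomials at the coefficients of a Witt vector. -/
def coeffEval (x : WittVector p A) : MvPolynomial ℕ ℤ →+* A :=
  MvPolynomial.eval₂Hom (Int.castRingHom A) x.coeff

lemma map_universal (x : WittVector p A) :
    WittVector.map (coeffEval x) (WittVector.mk p MvPolynomial.X) = x := by
  ext n
  simp [WittVector.map_coeff, coeffEval]

lemma dvd_frobenius_sub_pow (x : WittVector p A) : (p : WittVector p A) ∣ frobenius x - x ^ p := by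
  obtain ⟨D, hD⟩ := exists_universal_frobenius_sub_pow (p := p)
  refine ⟨WittVector.map (coeffEval x) D, ?_⟩
  rw [← map_natCast (WittVector.map (coeffEval x)), ← map_mul, ← hD,
    map_sub, map_pow, ← frobenius_map, map_universal]

end Ghost

/-! ### Units of Witt vectors when p is nilpotent -/

section Units

variable {p : ℕ} [hp : Fact p.Prime] {A : Type*} [CommRing A]

open WittVector

/-- The zeroth coefficient of p^k vanishes, so p^k = V z. Multiplication by integers commutes with V
and V z · y = V(z F y), so each factor p^k contributes one more V. Hence p is nilpotent in every
W_n(A). -/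
lemma natCast_pow_mem_iterate_verschiebung {k : ℕ} (h : (p : A) ^ k = 0) (n : ℕ) :
    ∃ y : WittVector p A, (p : WittVector p A) ^ (k * n) = verschiebung^[n] y := by
  have hk : ∃ y : WittVector p A, (p : WittVector p A) ^ k = verschiebung y := by
    refine ⟨WittVector.mk p fun i => ((p : WittVector p A) ^ k).coeff (i + 1), ?_⟩
    ext i
    cases i with
    | zero =>
      rw [verschiebung_coeff_zero, ← ghostComponent_zero_eq, map_pow, map_natCast, h]
    | succ i => rw [verschiebung_coeff_succ, coeff_mk]
  have hcomm : ∀ (n m : ℕ) (y : WittVector p A),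
      (m : WittVector p A) * verschiebung^[n] y = verschiebung^[n] ((m : WittVector p A) * y) := by
    intro n m y
    rw [← nsmul_eq_mul, ← nsmul_eq_mul]
    induction n with
    | zero => rfl
    | succ n ih => rw [Function.iterate_succ_apply', Function.iterate_succ_apply', ← map_nsmul, ih]
  induction n with
  | zero => exact ⟨1, by simp⟩
  | succ n ih =>
    obtain ⟨y, hy⟩ := ih
    obtain ⟨z, hz⟩ := hk
    refine ⟨frobenius y * z, ?_⟩
    have h2 : ((p ^ k : ℕ) : WittVector p A) * y = verschiebung (frobenius y * z) := by
      rw [Nat.cast_pow, hz, mul_comm (frobenius y), verschiebung_mul_frobenius, mul_comm]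
    rw [mul_add, mul_one, pow_add, hy, mul_comm, ← Nat.cast_pow, hcomm, h2,
      Function.iterate_succ_apply]

lemma isNilpotent_natCast_truncated {k : ℕ} (h : (p : A) ^ k = 0) (n : ℕ) :
    IsNilpotent (p : TruncatedWittVector p n A) := by
  obtain ⟨y, hy⟩ := natCast_pow_mem_iterate_verschiebung h n
  refine ⟨k * n, ?_⟩
  rw [← map_natCast (WittVector.truncate n : WittVector p A →+* _), ← map_pow, hy,
    ← RingHom.mem_ker, mem_ker_truncate]
  exact fun i hi => iterate_verschiebung_coeff_eq_zero y hi

/-- Inverses at finite levels are unique, hence compatible, and they glue because W is the limit of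
the W_n. The k-th coefficient is read off at level k + 1, the first level where it exists. -/
lemma isUnit_of_isUnit_truncate {x : WittVector p A}
    (h : ∀ n, IsUnit (WittVector.truncate n x)) : IsUnit x := by
  choose y hy using fun n => (h n).exists_right_inv
  have hcompat : ∀ (m n : ℕ) (hmn : m ≤ n), TruncatedWittVector.truncate hmn (y n) = y m := by
    intro m n hmn
    apply (h m).mul_left_cancel
    rw [hy, ← TruncatedWittVector.truncate_wittVector_truncate hmn, ← map_mul, hy, map_one]
  refine IsUnit.of_mul_eq_one
    (WittVector.mk p fun k => (y (k + 1)).coeff (Fin.last k)) ?_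
  set z := WittVector.mk p fun k => (y (k + 1)).coeff (Fin.last k) with hz
  have hz' : ∀ n, WittVector.truncate n z = y n := by
    intro n
    ext i
    rw [WittVector.coeff_truncate, hz, coeff_mk, ← hcompat (i + 1) n i.2,
      TruncatedWittVector.coeff_truncate]
    congr 1
  rw [← sub_eq_zero, ← Ideal.mem_bot, ← TruncatedWittVector.iInf_ker_truncate, Ideal.mem_iInf]
  intro n
  rw [RingHom.mem_ker, map_sub, map_mul, hz', hy, map_one, sub_self]

/-- In each W_n the element x^p is F x minus a multiple of p, that is, a unit minus a nilpotent. -/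
lemma isUnit_of_isUnit_frobenius {k : ℕ} (h : (p : A) ^ k = 0) {x : WittVector p A}
    (hx : IsUnit (frobenius x)) : IsUnit x := by
  apply isUnit_of_isUnit_truncate
  intro n
  obtain ⟨d, hd⟩ := dvd_frobenius_sub_pow x
  have h1 : x ^ p = frobenius x - p * d := by rw [← hd]; ring
  refine (isUnit_pow_iff hp.out.ne_zero).1 (?_ : IsUnit (WittVector.truncate n x ^ p))
  rw [← map_pow, h1, map_sub, map_mul, map_natCast]
  have hnil : IsNilpotent ((p : TruncatedWittVector p n A) * WittVector.truncate n d) :=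
    (Commute.all _ _).isNilpotent_mul_right (isNilpotent_natCast_truncated h n)
  rw [sub_eq_add_neg]
  exact hnil.neg.isUnit_add_left_of_commute (hx.map _) (Commute.all _ _)

end Units

/-! ### The Artin–Hasse exponential -/

section PowerSeriesAux

open PowerSeries

variable {A B : Type*} [CommRing A] [CommRing B]

lemma coeff_X_mul_derivative (f : A⟦X⟧) (m : ℕ) :
    coeff m (X * d⁄dX A f) = m * coeff m f := by
  cases m with
  | zero => simp
  | succ m => rw [coeff_succ_X_mul, coeff_derivative]; push_cast; ring

lemma X_mul_derivative_expand (q : ℕ) (hq : q ≠ 0) (f : A⟦X⟧) :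
    X * d⁄dX A (expand q hq f) = (q : A⟦X⟧) * expand q hq (X * d⁄dX A f) := by
  ext m
  rw [coeff_X_mul_derivative, ← map_natCast (C (R := A)), coeff_C_mul, coeff_expand, coeff_expand]
  split_ifs with h
  · obtain ⟨l, rfl⟩ := h
    rw [Nat.mul_div_cancel_left _ (Nat.pos_of_ne_zero hq), coeff_X_mul_derivative]
    push_cast
    ring
  · simp

lemma X_mul_derivative_rescale (c : A) (f : A⟦X⟧) :
    X * d⁄dX A (rescale c f) = rescale c (X * d⁄dX A f) := by
  ext m
  rw [coeff_X_mul_derivative, coeff_rescale, coeff_rescale, coeff_X_mul_derivative]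
  ring

lemma X_mul_derivative_prod {ι : Type*} (s : Finset ι) (f L : ι → A⟦X⟧)
    (h : ∀ i ∈ s, X * d⁄dX A (f i) = f i * L i) :
    X * d⁄dX A (∏ i ∈ s, f i) = (∏ i ∈ s, f i) * ∑ i ∈ s, L i := by
  classical
  induction s using Finset.induction_on with
  | empty => simp
  | insert a s ha ih =>
    rw [Finset.prod_insert ha, Finset.sum_insert ha, Derivation.leibniz, smul_eq_mul, smul_eq_mul]
    have h1 := h a (Finset.mem_insert_self _ _)
    have h2 := ih fun i hi => h i (Finset.mem_insert_of_mem hi)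
    linear_combination (∏ i ∈ s, f i) * h1 + f a * h2

/-- A power series is determined, modulo `X ^ N`, by its constant coefficient and its
logarithmic derivative. -/
lemma coeff_eq_of_logDeriv_eq [IsAddTorsionFree A] {f g L M : A⟦X⟧} {N : ℕ}
    (hf : X * d⁄dX A f = f * L) (hg : X * d⁄dX A g = g * M)
    (h0 : constantCoeff f = constantCoeff g) (hL : constantCoeff L = 0)
    (hLM : ∀ m < N, coeff m L = coeff m M) : ∀ m < N, coeff m f = coeff m g := by
  intro m
  induction m using Nat.strong_induction_on with
  | _ m ih =>
    intro hm
    rcases Nat.eq_zero_or_pos m with rfl | hpos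
    · simpa using h0
    -- In degree m of the equation X f' = f L only the coefficients of f below m enter, because L
    -- has no constant term.
    have h1 : (m : A) * coeff m f = m * coeff m g := by
      rw [← coeff_X_mul_derivative, ← coeff_X_mul_derivative, hf, hg, coeff_mul, coeff_mul]
      refine Finset.sum_congr rfl fun ij hij => ?_
      have hij' : ij.1 + ij.2 = m := Finset.HasAntidiagonal.mem_antidiagonal.1 hij
      rw [← hLM ij.2 (by omega)]
      rcases Nat.eq_zero_or_pos ij.2 with h | h
      · rw [h, coeff_zero_eq_constantCoeff_apply, hL, mul_zero, mul_zero]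
      · rw [ih ij.1 (by omega) (by omega)]
    rw [← nsmul_eq_mul, ← nsmul_eq_mul] at h1
    exact nsmul_right_injective hpos.ne' h1

lemma eq_of_logDeriv_eq [IsAddTorsionFree A] {f g L : A⟦X⟧}
    (hf : X * d⁄dX A f = f * L) (hg : X * d⁄dX A g = g * L)
    (h0 : constantCoeff f = constantCoeff g) (hL : constantCoeff L = 0) : f = g := by
  ext m
  exact coeff_eq_of_logDeriv_eq (N := m + 1) hf hg h0 hL (fun _ _ => rfl) m (Nat.lt_succ_self m)

lemma map_rescale (f : A →+* B) (c : A) (g : A⟦X⟧) :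
    PowerSeries.map f (rescale c g) = rescale (f c) (PowerSeries.map f g) := by
  ext m
  simp [coeff_rescale]

end PowerSeriesAux

/-! ### The Artin–Hasse exponential over ℚ_p and its functional equation -/

section ArtinHasse

open PowerSeries

variable (p : ℕ) [hp : Fact p.Prime]

/-- The power series `∑ X^(p^j)`. -/
def sumPrimePow (A : Type*) [CommRing A] : A⟦X⟧ := by
  classical exact PowerSeries.mk fun m => if ∃ j, m = p ^ j then 1 else 0

variable {p} {A B : Type*} [CommRing A] [CommRing B]

omit hp in
lemma map_sumPrimePow (f : A →+* B) :
    PowerSeries.map f (sumPrimePow p A) = sumPrimePow p B := by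
  ext m
  simp only [sumPrimePow, coeff_map, coeff_mk]
  split_ifs <;> simp

lemma coeff_expand_sumPrimePow (i m : ℕ) (c : A) :
    coeff m (expand (p ^ i) (pow_ne_zero i hp.out.ne_zero)
        (rescale c (sumPrimePow p A))) =
      open Classical in if h : ∃ j, m = p ^ j ∧ i ≤ j then c ^ p ^ (h.choose - i) else 0 := by
  classical
  rw [coeff_expand]
  split_ifs with h1 h2 h2
  · obtain ⟨hm, hi⟩ := h2.choose_spec
    rw [coeff_rescale, sumPrimePow, coeff_mk]
    have : m / p ^ i = p ^ (h2.choose - i) := by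
      conv_lhs => rw [hm]
      exact Nat.pow_div hi hp.out.pos
    rw [if_pos ⟨_, this⟩, mul_one, ← this]
  · rw [coeff_rescale, sumPrimePow, coeff_mk, if_neg, mul_zero]
    rintro ⟨j, hj⟩
    refine h2 ⟨i + j, ?_, Nat.le_add_right _ _⟩
    rw [pow_add, ← hj, Nat.mul_div_cancel' h1]
  · obtain ⟨hm, hi⟩ := h2.choose_spec
    exact absurd (hm ▸ pow_dvd_pow p hi) h1
  · rfl

lemma coeff_expand_sumPrimePow_pow (i j : ℕ) (c : A) :
    coeff (p ^ j) (expand (p ^ i) (pow_ne_zero i hp.out.ne_zero)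
        (rescale c (sumPrimePow p A))) =
      if i ≤ j then c ^ p ^ (j - i) else 0 := by
  classical
  rw [coeff_expand_sumPrimePow]
  split_ifs with h1 h2 h2
  · rw [← Nat.pow_right_injective hp.out.two_le h1.choose_spec.1]
  · have := Nat.pow_right_injective hp.out.two_le h1.choose_spec.1
    exact absurd (this ▸ h1.choose_spec.2) h2
  · exact absurd ⟨j, rfl, h2⟩ h1
  · rfl

lemma constantCoeff_sumPrimePow : constantCoeff (sumPrimePow p A) = 0 := by
  rw [← coeff_zero_eq_constantCoeff_apply, sumPrimePow, coeff_mk, if_neg]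
  rintro ⟨j, hj⟩
  exact pow_ne_zero j hp.out.ne_zero hj.symm

lemma sumPrimePow_eq : sumPrimePow p A = X + expand p hp.out.ne_zero (sumPrimePow p A) := by
  classical
  ext m
  have h := coeff_expand_sumPrimePow (p := p) 1 m (1 : A)
  simp only [pow_one, rescale_one, RingHom.id_apply] at h
  rw [map_add, h, sumPrimePow, coeff_mk, coeff_X]
  by_cases h1 : m = 1
  · subst h1
    rw [if_pos ⟨0, (pow_zero p).symm⟩, if_pos rfl, dif_neg, add_zero]
    rintro ⟨j, hj, hj1⟩
    have := Nat.pow_right_injective hp.out.two_le ((pow_zero p).trans hj)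
    omega
  · rw [if_neg h1, zero_add]
    by_cases h2 : ∃ j, m = p ^ j
    · obtain ⟨j, hj⟩ := h2
      have hj1 : 1 ≤ j := by
        rcases Nat.eq_zero_or_pos j with rfl | h
        · exact absurd (by simpa using hj) h1
        · exact h
      rw [if_pos ⟨j, hj⟩, dif_pos ⟨j, hj, hj1⟩, one_pow]
    · rw [if_neg h2, dif_neg]
      rintro ⟨j, hj, -⟩
      exact h2 ⟨j, hj⟩

variable (p)

/-- The Artin–Hasse exponential with rational coefficients. -/
def artinHasseRat : ℚ_[p]⟦X⟧ :=
  (PowerSeries.exp ℚ_[p]).subst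
    (PowerSeries.mk fun m => (m : ℚ_[p])⁻¹ * coeff m (sumPrimePow p ℚ_[p]))

lemma artinHasseRat_hasSubst : HasSubst (PowerSeries.mk fun m =>
    (m : ℚ_[p])⁻¹ * coeff m (sumPrimePow p ℚ_[p])) :=
  HasSubst.of_constantCoeff_zero' (by
    rw [← coeff_zero_eq_constantCoeff_apply, coeff_mk, Nat.cast_zero, inv_zero, zero_mul])

lemma X_mul_derivative_artinHasseRat : X * d⁄dX ℚ_[p] (artinHasseRat p) =
    artinHasseRat p * sumPrimePow p ℚ_[p] := by
  rw [artinHasseRat, derivative_subst (artinHasseRat_hasSubst p), derivative_exp, mul_left_comm]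
  congr 1
  ext m
  rw [coeff_X_mul_derivative, coeff_mk]
  rcases Nat.eq_zero_or_pos m with rfl | h
  · rw [coeff_zero_eq_constantCoeff_apply, constantCoeff_sumPrimePow]
    simp
  · rw [mul_inv_cancel_left₀ (Nat.cast_ne_zero.2 h.ne')]

lemma constantCoeff_artinHasseRat : constantCoeff (artinHasseRat p) = 1 := by
  have h := artinHasseRat_hasSubst p
  have h0 : constantCoeff (PowerSeries.mk fun m =>
      (m : ℚ_[p])⁻¹ * coeff m (sumPrimePow p ℚ_[p])) = 0 := by
    rw [← coeff_zero_eq_constantCoeff_apply, coeff_mk, Nat.cast_zero, inv_zero, zero_mul]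
  refine (constantCoeff_subst h _).trans ?_
  rw [finsum_eq_single _ 0]
  · simp
  · intro d hd
    rw [map_pow]
    erw [h0]
    rw [zero_pow hd, smul_zero]

/-- With S = ∑ X^(p^j), both sides have constant term 1 and logarithmic derivative p S, because S(X)
= X + S(X^p). -/
lemma artinHasseRat_pow : artinHasseRat p ^ p =
    expand p hp.out.ne_zero (artinHasseRat p) * rescale (p : ℚ_[p]) (PowerSeries.exp ℚ_[p]) := by
  refine eq_of_logDeriv_eq (L := (p : ℚ_[p]⟦X⟧) * sumPrimePow p ℚ_[p]) ?_ ?_ ?_ ?_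
  · rw [derivative_pow]
    have h := X_mul_derivative_artinHasseRat p
    have h2 : artinHasseRat p ^ p = artinHasseRat p ^ (p - 1) * artinHasseRat p := by
      rw [← pow_succ, Nat.sub_add_cancel hp.out.one_le]
    rw [h2]
    linear_combination (p * artinHasseRat p ^ (p - 1)) * h
  · rw [Derivation.leibniz, smul_eq_mul, smul_eq_mul]
    have h1 := X_mul_derivative_expand p hp.out.ne_zero (artinHasseRat p)
    have h2 := X_mul_derivative_rescale (p : ℚ_[p]) (PowerSeries.exp ℚ_[p])
    have h3 := sumPrimePow_eq (p := p) (A := ℚ_[p])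
    have h4 : rescale (p : ℚ_[p]) X = (p : ℚ_[p]⟦X⟧) * X := by
      rw [rescale_X, map_natCast]
    rw [X_mul_derivative_artinHasseRat, map_mul] at h1
    rw [derivative_exp, map_mul, h4] at h2
    linear_combination (rescale (p : ℚ_[p]) (PowerSeries.exp ℚ_[p])) * h1 +
      (expand p hp.out.ne_zero (artinHasseRat p)) * h2 - p *
      (expand p hp.out.ne_zero (artinHasseRat p)) *
      (rescale (p : ℚ_[p]) (PowerSeries.exp ℚ_[p])) * h3
  · simp [constantCoeff_artinHasseRat, ← coeff_zero_eq_constantCoeff_apply (rescale _ _),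
      coeff_rescale]
  · rw [map_mul, constantCoeff_sumPrimePow, mul_zero]

end ArtinHasse

/-! ### Integrality of the Artin–Hasse exponential -/

section ArtinHasseIntegral

open PowerSeries

variable (p : ℕ) [hp : Fact p.Prime]

lemma dvd_powerSeries_of_map_toZMod_eq_zero {f : ℤ_[p]⟦X⟧}
    (h : PowerSeries.map PadicInt.toZMod f = 0) : (p : ℤ_[p]⟦X⟧) ∣ f := by
  have h1 : ∀ m, ∃ a, coeff m f = p * a := by
    intro m
    have h2 := congrArg (coeff m) h
    rw [coeff_map, map_zero, ← RingHom.mem_ker, PadicInt.ker_toZMod,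
      PadicInt.maximalIdeal_eq_span_p, Ideal.mem_span_singleton] at h2
    exact h2
  choose a ha using h1
  refine ⟨PowerSeries.mk a, ?_⟩
  ext m
  rw [← map_natCast (C (R := ℤ_[p])), coeff_C_mul, coeff_mk, ha]

/-- Modulo p the coefficients lie in 𝔽_p, where Frobenius is the identity. So X ↦ X^p is a Frobenius
lift on ℤ_p[[X]]. -/
lemma dvd_expand_sub_pow (f : ℤ_[p]⟦X⟧) :
    (p : ℤ_[p]⟦X⟧) ∣ expand p hp.out.ne_zero f - f ^ p := by
  apply dvd_powerSeries_of_map_toZMod_eq_zero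
  rw [map_sub, map_pow, map_expand, sub_eq_zero]
  have h := MvPowerSeries.map_frobenius_expand p hp.out.ne_zero
    (f := PowerSeries.map (PadicInt.toZMod (p := p)) f)
  rw [ZMod.frobenius_zmod, MvPowerSeries.map_id] at h
  exact h

/-- A power series with coefficients in `ℤ_p`, from a power series over `ℚ_p` whose coefficients
are integral. -/
lemma exists_map_eq {f : ℚ_[p]⟦X⟧} (h : ∀ m, ‖coeff m f‖ ≤ 1) :
    ∃ g : ℤ_[p]⟦X⟧, PowerSeries.map (PadicInt.Coe.ringHom (p := p)) g = f :=
  ⟨PowerSeries.mk fun m => (⟨coeff m f, h m⟩ : ℤ_[p]), by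
    ext m
    rw [coeff_map]
    exact congrArg (PadicInt.Coe.ringHom (p := p)) (coeff_mk m _)⟩

lemma map_coe_injective :
    Function.Injective (PowerSeries.map (PadicInt.Coe.ringHom (p := p))) :=
  PowerSeries.map_injective _ Subtype.coe_injective

/-- By Legendre's formula (m + 1)! has valuation at most m. The spare factor p is what makes exp(pX)
- 1 divisible by p. -/
lemma norm_pow_div_factorial_le (m : ℕ) :
    ‖(p : ℚ_[p]) ^ m / (Nat.factorial (m + 1) : ℚ_[p])‖ ≤ 1 := by
  have h0 : (Nat.factorial (m + 1) : ℚ_[p]) ≠ 0 := Nat.cast_ne_zero.2 (Nat.factorial_ne_zero _)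
  rw [Padic.norm_le_one_iff_val_nonneg, div_eq_mul_inv, Padic.valuation_mul (pow_ne_zero _
    (Nat.cast_ne_zero.2 hp.out.ne_zero)) (inv_ne_zero h0), Padic.valuation_inv, Padic.valuation_natCast, Padic.valuation_pow,
    Padic.valuation_p]
  have h1 : (p - 1) * padicValNat p (m + 1).factorial < m + 1 :=
    sub_one_mul_padicValNat_factorial_lt_of_ne_zero p (Nat.succ_ne_zero m)
  have h2 : padicValNat p (m + 1).factorial ≤ m := by
    have h3 : 1 * padicValNat p (m + 1).factorial ≤ (p - 1) * padicValNat p (m + 1).factorial :=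
      Nat.mul_le_mul_right _ (Nat.le_sub_one_of_lt hp.out.one_lt)
    omega
  have : (padicValNat p (m + 1).factorial : ℤ) ≤ m := by exact_mod_cast h2
  simpa using this

/-- The power series `exp (p * X)` has coefficients in `ℤ_p`. -/
lemma exists_map_eq_exp : ∃ K : ℤ_[p]⟦X⟧, PowerSeries.map (PadicInt.Coe.ringHom (p := p))
    (1 + (p : ℤ_[p]⟦X⟧) * K) = rescale (p : ℚ_[p]) (PowerSeries.exp ℚ_[p]) := by
  obtain ⟨K, hK⟩ := exists_map_eq p (f := PowerSeries.mk fun m =>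
    if m = 0 then 0 else (p : ℚ_[p]) ^ (m - 1) / (Nat.factorial m : ℚ_[p])) (by
      intro m
      rw [coeff_mk]
      cases m with
      | zero => simp
      | succ m => simpa using norm_pow_div_factorial_le p m)
  refine ⟨K, ?_⟩
  rw [map_add, map_mul, hK, map_one, map_natCast]
  ext m
  rw [map_add, ← map_natCast (C (R := ℚ_[p])), coeff_C_mul, coeff_mk, coeff_rescale, coeff_exp]
  cases m with
  | zero => simp
  | succ m =>
    rw [coeff_one, if_neg (Nat.succ_ne_zero m), if_neg (Nat.succ_ne_zero m)]
    simp
    ring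

/-- In the binomial expansion the terms of order at least two in X^m g start in degree 2m > m, so
only the linear term contributes. -/
lemma coeff_trunc_add_pow {A : Type*} [CommRing A] (f g : A⟦X⟧) (m : ℕ) (hm : m ≠ 0) (q : ℕ)
    (hf : constantCoeff f = 1) :
    coeff m ((f + X ^ m * g) ^ q) = coeff m (f ^ q) + (q : A) * constantCoeff g := by
  obtain ⟨k, hk⟩ := Polynomial.powAddExpansion f (X ^ m * g) q
  rw [hk, map_add, map_add]
  have h1 : coeff m (k * (X ^ m * g) ^ 2) = 0 := by
    have : k * (X ^ m * g) ^ 2 = X ^ (m + 1) * (X ^ (m - 1) * g ^ 2 * k) := by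
      obtain ⟨l, rfl⟩ := Nat.exists_eq_succ_of_ne_zero hm
      simp only [Nat.succ_eq_add_one, Nat.add_sub_cancel]
      ring
    rw [this, coeff_X_pow_mul', if_neg (by omega)]
  have h2 : coeff m ((q : A⟦X⟧) * f ^ (q - 1) * (X ^ m * g)) = (q : A) * constantCoeff g := by
    rw [show (q : A⟦X⟧) * f ^ (q - 1) * (X ^ m * g) = X ^ m * ((q : A⟦X⟧) * f ^ (q - 1) * g) by ring,
      coeff_X_pow_mul', if_pos le_rfl, Nat.sub_self, coeff_zero_eq_constantCoeff_apply]
    simp [hf]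
  rw [h1, h2, add_zero]

/-- The Dieudonné–Dwork argument, applied to E^p = E(X^p) exp(pX). In degree m the unknown
coefficient e_m enters the left side as p e_m and does not enter the right side. What remains is a
coefficient of f(X^p)(1 + pK) - f^p for the integral truncation f of E, which is divisible by p. -/
lemma norm_coeff_artinHasseRat (m : ℕ) : ‖coeff m (artinHasseRat p)‖ ≤ 1 := by
  induction m using Nat.strong_induction_on with
  | _ m ih =>
    rcases Nat.eq_zero_or_pos m with rfl | hpos
    · rw [coeff_zero_eq_constantCoeff_apply, constantCoeff_artinHasseRat, norm_one]
    set E := artinHasseRat p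
    obtain ⟨f, hf⟩ := exists_map_eq p (f := (trunc m E : ℚ_[p]⟦X⟧)) (by
      intro i
      rw [Polynomial.coeff_coe, coeff_trunc]
      split_ifs with h
      · exact ih i h
      · simp)
    obtain ⟨K, hK⟩ := exists_map_eq_exp p
    obtain ⟨d, hd⟩ := dvd_expand_sub_pow p f
    set c := PowerSeries.map (PadicInt.Coe.ringHom (p := p))
    obtain ⟨g, hg⟩ : ∃ g, E = c f + X ^ m * g := by
      obtain ⟨g, hg⟩ := X_pow_dvd_iff.2 (fun i (hi : i < m) => show coeff i (E - c f) = 0 by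
        rw [hf, map_sub, coeff_coe_trunc_of_lt hi, sub_self])
      exact ⟨g, by rw [← hg]; ring⟩
    have hgm : coeff m E = constantCoeff g := by
      rw [hg, map_add, hf, Polynomial.coeff_coe, coeff_trunc, if_neg (lt_irrefl m),
        coeff_X_pow_mul', if_pos le_rfl, Nat.sub_self, zero_add, coeff_zero_eq_constantCoeff_apply]
    have hf1 : constantCoeff (c f) = 1 := by
      have := congrArg constantCoeff hg
      rw [constantCoeff_artinHasseRat, map_add, map_mul, map_pow, constantCoeff_X,
        zero_pow hpos.ne', zero_mul, add_zero] at this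
      exact this.symm
    have h1 : coeff m (E ^ p) = coeff m (c f ^ p) + p * coeff m E := by
      rw [hgm, ← coeff_trunc_add_pow (c f) g m hpos.ne' p hf1, ← hg]
    have h2 : coeff m (E ^ p) = coeff m (expand p hp.out.ne_zero (c f) * c (1 + p * K)) := by
      have hX : expand p hp.out.ne_zero (c f + X ^ m * g) = expand p hp.out.ne_zero (c f) +
          X ^ (p * m) * expand p hp.out.ne_zero g := by
        rw [map_add, map_mul, map_pow, expand_X, ← pow_mul]
      rw [artinHasseRat_pow, hK, show artinHasseRat p = c f + X ^ m * g from hg, hX, add_mul,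
        map_add, mul_assoc, coeff_X_pow_mul', if_neg, add_zero]
      have := hp.out.two_le
      nlinarith
    have h3 : (p : ℚ_[p]) * coeff m E =
        p * (coeff m (d + expand p hp.out.ne_zero f * K) : ℤ_[p]) := by
      have h4 : (p : ℚ_[p]) * coeff m E = coeff m
          (expand p hp.out.ne_zero (c f) * c (1 + p * K) - c f ^ p) := by
        rw [map_sub, ← h2, h1]; ring
      have h5 : expand p hp.out.ne_zero f * (1 + p * K) - f ^ p =
          C (p : ℤ_[p]) * (d + expand p hp.out.ne_zero f * K) := by
        rw [map_natCast]
        linear_combination hd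
      rw [h4, ← map_expand, ← map_mul, ← map_pow, ← map_sub, h5, coeff_map, coeff_C_mul]
      exact PadicInt.coe_mul _ _
    rw [mul_left_cancel₀ (Nat.cast_ne_zero.2 hp.out.ne_zero) h3]
    exact PadicInt.norm_le_one _

/-- The Artin–Hasse exponential. -/
def artinHasse : ℤ_[p]⟦X⟧ :=
  (exists_map_eq p (norm_coeff_artinHasseRat p)).choose

lemma map_artinHasse :
    PowerSeries.map (PadicInt.Coe.ringHom (p := p)) (artinHasse p) = artinHasseRat p :=
  (exists_map_eq p (norm_coeff_artinHasseRat p)).choose_spec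

lemma map_derivative {A B : Type*} [CommRing A] [CommRing B] (f : A →+* B) (g : A⟦X⟧) :
    PowerSeries.map f (d⁄dX A g) = d⁄dX B (PowerSeries.map f g) := by
  ext m
  simp [coeff_derivative]

lemma X_mul_derivative_artinHasse : X * d⁄dX ℤ_[p] (artinHasse p) =
    artinHasse p * sumPrimePow p ℤ_[p] := by
  apply map_coe_injective
  rw [map_mul, map_mul, map_derivative, map_X, map_artinHasse, map_sumPrimePow,
    X_mul_derivative_artinHasseRat]

lemma constantCoeff_artinHasse : constantCoeff (artinHasse p) = 1 := by
  apply Subtype.coe_injective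
  have h := constantCoeff_artinHasseRat p
  rw [← map_artinHasse, ← coeff_zero_eq_constantCoeff_apply, coeff_map,
    coeff_zero_eq_constantCoeff_apply] at h
  exact h

lemma coeff_one_artinHasse : coeff 1 (artinHasse p) = 1 := by
  have h := congrArg (coeff 1) (X_mul_derivative_artinHasse p)
  rw [coeff_X_mul_derivative, coeff_mul, Finset.Nat.antidiagonal_succ] at h
  have h1 : coeff 1 (sumPrimePow p ℤ_[p]) = 1 := by
    rw [sumPrimePow, coeff_mk, if_pos ⟨0, (pow_zero p).symm⟩]
  simpa [h1, constantCoeff_artinHasse, constantCoeff_sumPrimePow] using h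

/-- If `K = exp(p X)` then `E^p = E(X^p) K`, and `K^(p^M) = exp(p^(M+1) X)` is
`1 + p^(M+1) (X + p^M H)`. -/
lemma exists_artinHasse_pow_eq (M : ℕ) : ∃ K H : ℤ_[p]⟦X⟧,
    artinHasse p ^ p = expand p hp.out.ne_zero (artinHasse p) * K ∧
      K ^ p ^ M = 1 + (p : ℤ_[p]⟦X⟧) ^ (M + 1) * (X + (p : ℤ_[p]⟦X⟧) ^ M * H) := by
  obtain ⟨K, hK⟩ := exists_map_eq_exp p
  -- The coefficient of X^m in exp(p^(M+1) X) is p^((M+1)m)/m!, and removing p^(M+1) · p^M leaves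
  -- p^(M(m-2)) · p^(m-1)/m!. The degrees 0 and 1 are the explicit terms 1 and p^(M+1) X.
  obtain ⟨H, hH⟩ := exists_map_eq p (f := PowerSeries.mk fun m =>
    if m ≤ 1 then 0 else (p : ℚ_[p]) ^ (M * (m - 2)) *
      ((p : ℚ_[p]) ^ (m - 1) / (Nat.factorial m : ℚ_[p]))) (by
      intro m
      rw [coeff_mk]
      split_ifs with h
      · simp
      · obtain ⟨l, rfl⟩ := Nat.exists_eq_add_of_lt (not_le.1 h)
        rw [norm_mul, norm_pow]
        refine mul_le_one₀ (pow_le_one₀ (norm_nonneg _) Padic.norm_p_lt_one.le) (norm_nonneg _) ?_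
        convert! norm_pow_div_factorial_le p (1 + l) using 2)
  refine ⟨1 + p * K, H, ?_, ?_⟩
  · apply map_coe_injective
    rw [map_mul, hK, map_pow, map_expand, map_artinHasse, artinHasseRat_pow]
  · apply map_coe_injective
    rw [map_pow, hK, ← map_pow, exp_pow_eq_rescale_exp]
    simp only [map_add, map_mul, map_pow, hH, map_one, map_natCast, map_X]
    ext m
    rw [← map_natCast (C (R := ℚ_[p])), ← map_pow, ← map_pow, map_add, coeff_C_mul, map_add,
      coeff_C_mul, coeff_mk, coeff_rescale, coeff_rescale, coeff_exp, coeff_one, coeff_X]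
    rcases m with _ | _ | m
    · simp
    · simp
      ring
    · rw [if_neg (by omega), if_neg (by omega), if_neg (by omega)]
      simp
      ring

end ArtinHasseIntegral

/-! ### Products of Artin–Hasse series and Witt vector addition -/

section ArtinHasseProd

open PowerSeries

variable {p : ℕ} [hp : Fact p.Prime] {A B : Type*} [CommRing A] [CommRing B]

/-- The power series `E(c X^(p^i))`, where `E` is the Artin–Hasse exponential. -/
def artinHasseTerm (ι : ℤ_[p] →+* A) (i : ℕ) (c : A) : A⟦X⟧ :=
  expand (p ^ i) (pow_ne_zero i hp.out.ne_zero) (rescale c (PowerSeries.map ι (artinHasse p)))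

lemma map_artinHasseTerm (f : A →+* B) (ι : ℤ_[p] →+* A) (i : ℕ) (c : A) :
    PowerSeries.map f (artinHasseTerm ι i c) = artinHasseTerm (f.comp ι) i (f c) := by
  rw [artinHasseTerm, map_expand, map_rescale, artinHasseTerm, PowerSeries.map_comp]
  rfl

lemma artinHasseTerm_logDeriv (ι : ℤ_[p] →+* A) (i : ℕ) (c : A) :
    X * d⁄dX A (artinHasseTerm ι i c) = artinHasseTerm ι i c * ((p : A⟦X⟧) ^ i *
      expand (p ^ i) (pow_ne_zero i hp.out.ne_zero) (rescale c (sumPrimePow p A))) := by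
  have h := congrArg (PowerSeries.map ι) (X_mul_derivative_artinHasse p)
  rw [map_mul, map_mul, map_derivative, map_X, map_sumPrimePow] at h
  rw [artinHasseTerm, X_mul_derivative_expand, X_mul_derivative_rescale, h, map_mul, map_mul]
  push_cast
  ring

lemma constantCoeff_artinHasseTerm (ι : ℤ_[p] →+* A) (i : ℕ) (c : A) :
    constantCoeff (artinHasseTerm ι i c) = 1 := by
  rw [artinHasseTerm, constantCoeff_expand, ← coeff_zero_eq_constantCoeff_apply, coeff_rescale,
    coeff_map, coeff_zero_eq_constantCoeff_apply, constantCoeff_artinHasse]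
  simp

lemma artinHasseTerm_zero_right (ι : ℤ_[p] →+* A) (i : ℕ) : artinHasseTerm ι i 0 = 1 := by
  rw [artinHasseTerm, rescale_zero_apply, ← coeff_zero_eq_constantCoeff_apply, coeff_map,
    coeff_zero_eq_constantCoeff_apply, constantCoeff_artinHasse, map_one, map_one, map_one]

lemma coeff_one_artinHasseTerm (ι : ℤ_[p] →+* A) (c : A) :
    coeff 1 (artinHasseTerm ι 0 c) = c := by
  rw [artinHasseTerm]
  simp only [pow_zero, expand_one_apply]
  rw [coeff_rescale, coeff_map, coeff_one_artinHasse]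
  simp

lemma artinHasseTerm_succ (ι : ℤ_[p] →+* A) (i : ℕ) (c : A) :
    artinHasseTerm ι (i + 1) c = expand p hp.out.ne_zero (artinHasseTerm ι i c) := by
  rw [artinHasseTerm, artinHasseTerm, ← expand_mul]
  congr 1
  simp only [pow_succ']

/-- The product `∏_{i < N} E(x_i X^(p^i))` attached to a sequence `x`. -/
def artinHasseProd (ι : ℤ_[p] →+* A) (N : ℕ) (x : ℕ → A) : A⟦X⟧ :=
  ∏ i ∈ Finset.range N, artinHasseTerm ι i (x i)

lemma map_artinHasseProd (f : A →+* B) (ι : ℤ_[p] →+* A) (N : ℕ) (x : ℕ → A) :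
    PowerSeries.map f (artinHasseProd ι N x) =
      artinHasseProd (f.comp ι) N fun i => f (x i) := by
  simp only [artinHasseProd, map_prod, map_artinHasseTerm]

lemma constantCoeff_artinHasseProd (ι : ℤ_[p] →+* A) (N : ℕ) (x : ℕ → A) :
    constantCoeff (artinHasseProd ι N x) = 1 := by
  rw [artinHasseProd, map_prod]
  exact Finset.prod_eq_one fun i _ => constantCoeff_artinHasseTerm ι i (x i)

lemma artinHasseProd_succ (ι : ℤ_[p] →+* A) (N : ℕ) (x : ℕ → A) :
    artinHasseProd ι (N + 1) x = artinHasseTerm ι 0 (x 0) *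
      expand p hp.out.ne_zero (artinHasseProd ι N fun i => x (i + 1)) := by
  rw [artinHasseProd, Finset.prod_range_succ', mul_comm, artinHasseProd, map_prod]
  simp only [artinHasseTerm_succ]

/-- The logarithmic derivative of `artinHasseProd`. -/
def artinHasseProdLogDeriv (p : ℕ) [hp : Fact p.Prime] (N : ℕ) (x : ℕ → A) : A⟦X⟧ :=
  ∑ i ∈ Finset.range N, (p : A⟦X⟧) ^ i *
    expand (p ^ i) (pow_ne_zero i hp.out.ne_zero) (rescale (x i) (sumPrimePow p A))

lemma artinHasseProd_logDeriv (ι : ℤ_[p] →+* A) (N : ℕ) (x : ℕ → A) :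
    X * d⁄dX A (artinHasseProd ι N x) = artinHasseProd ι N x * artinHasseProdLogDeriv p N x :=
  X_mul_derivative_prod _ _ _ fun i _ => artinHasseTerm_logDeriv ι i (x i)

/-- The terms p^i x_i^(p^(j-i)) with i ≤ j collect in degree p^j, and their sum is the j-th ghost
component. Below degree p^N only j < N occurs, so all the needed factors are present. -/
lemma coeff_logDeriv_artinHasseProd (N : ℕ) (x : WittVector p A) (m : ℕ) (hm : m < p ^ N) :
    coeff m (artinHasseProdLogDeriv p N x.coeff) =
    open Classical in if h : ∃ j, m = p ^ j then WittVector.ghostComponent h.choose x else 0 := by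
  classical
  have hC : ∀ i, (p : A⟦X⟧) ^ i = C ((p : A) ^ i) := fun i => by simp
  simp only [artinHasseProdLogDeriv, map_sum, hC, coeff_C_mul]
  split_ifs with h
  · have hj := h.choose_spec
    set j := h.choose
    have hjN : j < N := (Nat.pow_lt_pow_iff_right hp.out.one_lt).1 (hj ▸ hm)
    rw [ghostComponent_eq_sum, hj]
    simp only [coeff_expand_sumPrimePow_pow]
    rw [← Finset.sum_subset (Finset.range_subset_range.2 hjN)]
    · refine Finset.sum_congr rfl fun i hi => ?_
      rw [if_pos (Nat.lt_succ_iff.1 (Finset.mem_range.1 hi))]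
    · intro i _ hi
      rw [if_neg (fun h => hi (Finset.mem_range.2 (Nat.lt_succ_of_le h))), mul_zero]
  · refine Finset.sum_eq_zero fun i _ => ?_
    rw [coeff_expand_sumPrimePow, dif_neg, mul_zero]
    rintro ⟨j, hj, -⟩
    exact h ⟨j, hj⟩

/-- Ghost components are additive, so the logarithmic derivatives agree below degree p^N, and
without torsion they determine the series. -/
lemma coeff_artinHasseProd_add_of_torsionFree [IsAddTorsionFree A] (ι : ℤ_[p] →+* A) (N : ℕ)
    (x y : WittVector p A) : ∀ m < p ^ N, coeff m (artinHasseProd ι N (x + y).coeff) =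
      coeff m (artinHasseProd ι N x.coeff * artinHasseProd ι N y.coeff) := by
  have H0 : ∀ z : WittVector p A, constantCoeff (artinHasseProdLogDeriv p N z.coeff) = 0 := by
    intro z
    rw [← coeff_zero_eq_constantCoeff_apply,
      coeff_logDeriv_artinHasseProd N z 0 (pow_pos hp.out.pos N), dif_neg]
    rintro ⟨j, hj⟩
    exact pow_ne_zero j hp.out.ne_zero hj.symm
  refine coeff_eq_of_logDeriv_eq (artinHasseProd_logDeriv ι N (x + y).coeff)
    (M := artinHasseProdLogDeriv p N x.coeff + artinHasseProdLogDeriv p N y.coeff) ?_ ?_ (H0 _) ?_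
  · have h1 := artinHasseProd_logDeriv ι N x.coeff
    have h2 := artinHasseProd_logDeriv ι N y.coeff
    rw [Derivation.leibniz, smul_eq_mul, smul_eq_mul]
    linear_combination (artinHasseProd ι N y.coeff) * h1 + (artinHasseProd ι N x.coeff) * h2
  · rw [map_mul, constantCoeff_artinHasseProd, constantCoeff_artinHasseProd,
      constantCoeff_artinHasseProd, one_mul]
  · intro m hm
    rw [map_add, coeff_logDeriv_artinHasseProd N _ m hm, coeff_logDeriv_artinHasseProd N _ m hm,
      coeff_logDeriv_artinHasseProd N _ m hm]
    split_ifs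
    · rw [map_add]
    · rw [add_zero]

lemma coeff_artinHasseProd_add (ι : ℤ_[p] →+* A) (N : ℕ)
    (x y : WittVector p A) : ∀ m < p ^ N, coeff m (artinHasseProd ι N (x + y).coeff) =
      coeff m (artinHasseProd ι N x.coeff * artinHasseProd ι N y.coeff) := by
  -- The identity is lifted to a torsion-free ℤ_p-algebra surjecting onto A and then specialised.
  let f : MvPolynomial A ℤ_[p] →+* A := MvPolynomial.eval₂Hom ι id
  have hf : Function.Surjective f := fun a => ⟨MvPolynomial.X a, by simp [f]⟩
  have hι : f.comp MvPolynomial.C = ι := RingHom.ext fun a => by simp [f]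
  obtain ⟨x, rfl⟩ := WittVector.map_surjective (p := p) f hf x
  obtain ⟨y, rfl⟩ := WittVector.map_surjective (p := p) f hf y
  intro m hm
  have hmap : ∀ z : WittVector p (MvPolynomial A ℤ_[p]),
      artinHasseProd ι N (WittVector.map f z).coeff =
        PowerSeries.map f (artinHasseProd MvPolynomial.C N z.coeff) := by
    intro z
    rw [map_artinHasseProd, hι]
    rfl
  have htf : IsAddTorsionFree (MvPolynomial A ℤ_[p]) := inferInstance
  rw [← map_add, hmap, hmap, hmap, ← map_mul, coeff_map, coeff_map,
    coeff_artinHasseProd_add_of_torsionFree _ N x y m hm]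

lemma coeff_one_artinHasseProd_succ (ι : ℤ_[p] →+* A) (N : ℕ) (x : ℕ → A) :
    coeff 1 (artinHasseProd ι (N + 1) x) = x 0 := by
  rw [artinHasseProd_succ, coeff_mul, Finset.Nat.antidiagonal_succ]
  have h : coeff 1 (expand p hp.out.ne_zero (artinHasseProd ι N fun i => x (i + 1))) = 0 :=
    coeff_expand_of_not_dvd _ _ _ hp.out.not_dvd_one
  simp [h, coeff_one_artinHasseTerm, constantCoeff_artinHasseProd]

lemma coeff_expand_eq_iff (N : ℕ) (f g : A⟦X⟧) :
    (∀ m < p ^ (N + 1), coeff m (expand p hp.out.ne_zero f) =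
      coeff m (expand p hp.out.ne_zero g)) ↔ ∀ m < p ^ N, coeff m f = coeff m g := by
  constructor
  · intro h m hm
    have := h (p * m) (by rw [pow_succ']; exact Nat.mul_lt_mul_of_pos_left hm hp.out.pos)
    rwa [coeff_expand_mul, coeff_expand_mul] at this
  · intro h m hm
    rw [coeff_expand, coeff_expand]
    split_ifs with hd
    · obtain ⟨l, rfl⟩ := hd
      rw [Nat.mul_div_cancel_left _ hp.out.pos]
      rw [pow_succ'] at hm
      exact h l (Nat.lt_of_mul_lt_mul_left hm)
    · rfl

/-- The coefficient of X is x_0, since the other factors are series in X^p. Once x_0 = 0, the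
product is a series in X^p and the argument repeats for the shifted sequence. -/
lemma eq_zero_of_coeff_artinHasseProd (ι : ℤ_[p] →+* A) (N : ℕ) (x : ℕ → A)
    (h : ∀ m < p ^ N, coeff m (artinHasseProd ι N x) = coeff m (1 : A⟦X⟧)) :
    ∀ i < N, x i = 0 := by
  induction N generalizing x with
  | zero => simp
  | succ N ih =>
    have h0 : x 0 = 0 := by
      rw [← coeff_one_artinHasseProd_succ ι N x, h 1 (Nat.one_lt_pow N.succ_ne_zero hp.out.one_lt),
        coeff_one, if_neg one_ne_zero]
    rw [artinHasseProd_succ, h0, artinHasseTerm_zero_right, one_mul] at h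
    have h1 := ih (fun i => x (i + 1)) ((coeff_expand_eq_iff N _ _).1 (by simpa using h))
    intro i hi
    cases i with
    | zero => exact h0
    | succ i => exact h1 i (by omega)

lemma artinHasseProd_congr (ι : ℤ_[p] →+* A) (N : ℕ) {x y : ℕ → A} (h : ∀ i < N, x i = y i) :
    artinHasseProd ι N x = artinHasseProd ι N y :=
  Finset.prod_congr rfl fun i hi => by rw [h i (Finset.mem_range.1 hi)]

lemma artinHasseProd_teichmuller (ι : ℤ_[p] →+* A) (N : ℕ) (c : A) :
    artinHasseProd ι (N + 1) (WittVector.teichmuller p c).coeff = artinHasseTerm ι 0 c := by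
  rw [artinHasseProd_succ, WittVector.teichmuller_coeff_zero]
  have : artinHasseProd ι N (fun i => (WittVector.teichmuller p c).coeff (i + 1)) = 1 :=
    Finset.prod_eq_one fun i _ => by
      dsimp only
      rw [WittVector.teichmuller_coeff_pos p c _ i.succ_pos, artinHasseTerm_zero_right]
  rw [this, map_one, mul_one]

end ArtinHasseProd

/-! ### Evaluation of power series at nilpotent elements -/

section NilEval

open PowerSeries

variable {A B : Type*} [CommRing A] [CommRing B]

lemma sum_coeff_mul_pow_of_le (f : A⟦X⟧) {z : A} {N M : ℕ} (hz : z ^ N = 0) (h : N ≤ M) :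
    ∑ i ∈ Finset.range M, coeff i f * z ^ i = ∑ i ∈ Finset.range N, coeff i f * z ^ i := by
  refine (Finset.sum_subset (Finset.range_subset_range.2 h) fun i _ hi => ?_).symm
  rw [pow_eq_zero_of_le (not_lt.1 fun h => hi (Finset.mem_range.2 h)) hz, mul_zero]

lemma eval_trunc (f : A⟦X⟧) (z : A) (N : ℕ) :
    (trunc N f).eval z = ∑ i ∈ Finset.range N, coeff i f * z ^ i := by
  rw [← Polynomial.eval₂_id, eval₂_trunc_eq_sum_range]
  rfl

lemma eval_trunc_coe (P : Polynomial A) {z : A} {N : ℕ} (hz : z ^ N = 0) :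
    (trunc N (P : A⟦X⟧)).eval z = P.eval z := by
  have h1 : P.natDegree < max N (P.natDegree + 1) := lt_max_of_lt_right (Nat.lt_succ_self _)
  rw [eval_trunc, Polynomial.eval_eq_sum_range' h1,
    ← sum_coeff_mul_pow_of_le _ hz (le_max_left N (P.natDegree + 1))]
  simp

/-- Evaluation of a power series at an element `z` with `z ^ N = 0`. -/
def nilEval (z : A) (N : ℕ) (hz : z ^ N = 0) : A⟦X⟧ →+* A where
  toFun f := (trunc N f).eval z
  map_zero' := by simp
  map_one' := by
    rw [← Polynomial.coe_one, eval_trunc_coe _ hz, Polynomial.eval_one]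
  map_add' f g := by simp
  map_mul' f g := by
    rw [← Polynomial.eval_mul, ← eval_trunc_coe (_ * _) hz, Polynomial.coe_mul,
      trunc_trunc_mul_trunc]

lemma nilEval_apply {z : A} {N : ℕ} (hz : z ^ N = 0) (f : A⟦X⟧) :
    nilEval z N hz f = ∑ i ∈ Finset.range N, coeff i f * z ^ i :=
  eval_trunc f z N

lemma map_nilEval (g : A →+* B) {z : A} {N : ℕ} (hz : z ^ N = 0) (hz' : g z ^ N = 0) (f : A⟦X⟧) :
    g (nilEval z N hz f) = nilEval (g z) N hz' (PowerSeries.map g f) := by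
  simp [nilEval_apply]

end NilEval

/-! ### The integral logarithm of Witt vectors -/

section IntegralLog

open WittVector

variable {p : ℕ} [hp : Fact p.Prime] {A B : Type*} [CommRing A] [CommRing B]

lemma coeffEval_map (f : A →+* B) (x : WittVector p A) :
    coeffEval (WittVector.map f x) = f.comp (coeffEval x) :=
  MvPolynomial.ringHom_ext' (Subsingleton.elim _ _) fun i => by simp [coeffEval]

lemma map_map (f : A →+* B) {C : Type*} [CommRing C] (g : B →+* C) (x : WittVector p A) :
    WittVector.map g (WittVector.map f x) = WittVector.map (g.comp f) x := by
  ext n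
  simp [map_coeff]

/-- The congruence x^p ≡ F x modulo p becomes one modulo p^(M+1) after raising to the power p^M. The
quotient is taken once for the generic Witt vector, so that its specialisations are functorial even
where W(A) has p-torsion. -/
lemma exists_universal_logNum (p : ℕ) [hp : Fact p.Prime] (M : ℕ) :
    ∃ D : WittVector p (MvPolynomial ℕ ℤ),
      (p : WittVector p (MvPolynomial ℕ ℤ)) ^ (M + 1) * D =
        (WittVector.mk p MvPolynomial.X ^ p) ^ p ^ M -
          frobenius (WittVector.mk p MvPolynomial.X) ^ p ^ M := by
  obtain ⟨D, hD⟩ := dvd_sub_pow_of_dvd_sub ((dvd_sub_comm).1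
    (dvd_frobenius_sub_pow (WittVector.mk p (MvPolynomial.X (R := ℤ) (σ := ℕ))))) M
  exact ⟨D, hD.symm⟩

/-- The natural operation `(x^(p^(M+1)) - (F x)^(p^M)) / p^(M+1)` on Witt vectors. -/
def logNum (M : ℕ) (x : WittVector p A) : WittVector p A :=
  WittVector.map (coeffEval x) (exists_universal_logNum p M).choose

lemma pow_mul_logNum (M : ℕ) (x : WittVector p A) :
    (p : WittVector p A) ^ (M + 1) * logNum M x = (x ^ p) ^ p ^ M - frobenius x ^ p ^ M := by
  have h := congrArg (WittVector.map (coeffEval x)) (exists_universal_logNum p M).choose_spec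
  rw [map_mul, map_pow, map_natCast, map_sub, map_pow, map_pow, map_pow, ← frobenius_map,
    map_universal] at h
  exact h

lemma map_logNum (f : A →+* B) (M : ℕ) (x : WittVector p A) :
    WittVector.map f (logNum M x) = logNum M (WittVector.map f x) := by
  rw [logNum, logNum, coeffEval_map, map_map]

/-- After multiplication by p^(M+1) this is a formal identity. The factor is cancelled over a
polynomial ring over ℤ, and the result is specialised. -/
lemma logNum_mul (M : ℕ) (x y : WittVector p A) :
    logNum M (x * y) = logNum M x * frobenius y ^ p ^ M + frobenius x ^ p ^ M * logNum M y +
      (p : WittVector p A) ^ (M + 1) * (logNum M x * logNum M y) := by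
  let f : MvPolynomial A ℤ →+* A := MvPolynomial.eval₂Hom (Int.castRingHom A) id
  have hf : Function.Surjective f := fun a => ⟨MvPolynomial.X a, by simp [f]⟩
  obtain ⟨x, rfl⟩ := WittVector.map_surjective (p := p) f hf x
  obtain ⟨y, rfl⟩ := WittVector.map_surjective (p := p) f hf y
  have hA : IsLeftRegular (p : MvPolynomial A ℤ) :=
    IsLeftCancelMulZero.mul_left_cancel_of_ne_zero (Nat.cast_ne_zero.2 hp.out.ne_zero)
  have key : logNum M (x * y) = logNum M x * frobenius y ^ p ^ M +
      frobenius x ^ p ^ M * logNum M y +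
      (p : WittVector p (MvPolynomial A ℤ)) ^ (M + 1) * (logNum M x * logNum M y) := by
    refine (isLeftRegular_wittVector hA).pow (M + 1) ?_
    have h1 := pow_mul_logNum M x
    have h2 := pow_mul_logNum M y
    have h3 := pow_mul_logNum M (x * y)
    rw [map_mul, mul_pow, mul_pow, mul_pow] at h3
    dsimp only
    linear_combination h3 - (y ^ p) ^ p ^ M * h1 -
      ((p : WittVector p (MvPolynomial A ℤ)) ^ (M + 1) * logNum M x + frobenius x ^ p ^ M) * h2
  rw [← map_mul, ← map_logNum, key]
  simp only [map_add, map_mul, map_pow, map_natCast, map_logNum, frobenius_map]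

/-- The Frobenius endomorphism of the units of `W(A)`. -/
def unitsFrobenius : (WittVector p A)ˣ →* (WittVector p A)ˣ :=
  Units.map ((frobenius : WittVector p A →+* WittVector p A) : _ →* _)

lemma coe_unitsFrobenius (u : (WittVector p A)ˣ) :
    (unitsFrobenius u : WittVector p A) = frobenius (u : WittVector p A) := rfl

/-- An approximation, modulo `p^(M+1)`, of `(1/p) log (u^p / F u)` for a unit `u`. -/
def wittLog (M : ℕ) (u : (WittVector p A)ˣ) : WittVector p A :=
  logNum M (u : WittVector p A) *
    (((unitsFrobenius u)⁻¹ ^ p ^ M : (WittVector p A)ˣ) : WittVector p A)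

lemma wittLog_spec (M : ℕ) (u : (WittVector p A)ˣ) :
    wittLog M u * frobenius (u : WittVector p A) ^ p ^ M = logNum M (u : WittVector p A) := by
  rw [wittLog, ← coe_unitsFrobenius, ← Units.val_pow_eq_pow_val, mul_assoc, ← Units.val_mul,
    inv_pow, inv_mul_cancel, Units.val_one, mul_one]

lemma eq_wittLog (M : ℕ) (u : (WittVector p A)ˣ) (x : WittVector p A)
    (h : x * frobenius (u : WittVector p A) ^ p ^ M = logNum M (u : WittVector p A)) :
    x = wittLog M u := by
  have hu : IsUnit (frobenius (u : WittVector p A) ^ p ^ M) := (unitsFrobenius u).isUnit.pow _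
  exact hu.mul_right_cancel (h.trans (wittLog_spec M u).symm)

/-- Morally 1 + p^(M+1) `wittLog M u` is (u^p / F u)^(p^M), which is multiplicative in u. The defect
of additivity is a multiple of p^(M+1), which the nilpotent pairing kills for large M. -/
lemma wittLog_mul (M : ℕ) (u v : (WittVector p A)ˣ) :
    wittLog M (u * v) = wittLog M u + wittLog M v +
      (p : WittVector p A) ^ (M + 1) * (wittLog M u * wittLog M v) := by
  refine (eq_wittLog M _ _ ?_).symm
  rw [Units.val_mul, logNum_mul, ← wittLog_spec M u, ← wittLog_spec M v, map_mul]
  ring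

lemma map_wittLog (f : A →+* B) (M : ℕ) (u : (WittVector p A)ˣ) :
    WittVector.map f (wittLog M u) = wittLog M
      (Units.map ((WittVector.map f : WittVector p A →+* WittVector p B) : _ →* _) u) := by
  refine eq_wittLog M _ _ ?_
  rw [Units.coe_map]
  change _ * frobenius (WittVector.map f (u : WittVector p A)) ^ p ^ M =
    logNum M (WittVector.map f (u : WittVector p A))
  rw [← map_logNum, ← wittLog_spec, frobenius_map, map_mul, map_pow]

end IntegralLog

/-! ### Characters of W^× attached to nilpotent elements -/

section NilPairing

open PowerSeries

variable {p : ℕ} [hp : Fact p.Prime] {A B : Type*} [CommRing A] [CommRing B]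

/-- The power w^(p^a) is 1 modulo p, and k further p-th powers improve this to a congruence modulo
p^(k+1) = 0. -/
lemma pow_eq_one_of_sub_one_pow_eq_zero {w : A} {a k : ℕ} (hk : (p : A) ^ k = 0)
    (hw : (w - 1) ^ p ^ a = 0) : w ^ p ^ (a + k) = 1 := by
  have h1 : (p : A) ∣ w ^ p ^ a - 1 ^ p ^ a := by
    obtain ⟨r, h⟩ := exists_add_pow_prime_pow_eq hp.out (w - 1) 1 a
    rw [sub_add_cancel, hw, zero_add] at h
    exact ⟨(w - 1) * r, by rw [h]; ring⟩
  have h2 := dvd_sub_pow_of_dvd_sub h1 k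
  rw [pow_succ, hk, zero_mul, zero_dvd_iff, sub_eq_zero, ← pow_mul, ← pow_add] at h2
  simpa using h2

variable (ι : ℤ_[p] →+* A) {z : A} {a : ℕ} (hz : z ^ p ^ a = 0)

/-- The value `∏ E(x_i z^(p^i))` of the Artin–Hasse pairing at a nilpotent element `z`. -/
def nilPairing (x : WittVector p A) : A := nilEval z (p ^ a) hz (artinHasseProd ι a x.coeff)

lemma nilEval_congr {f g : A⟦X⟧} {N : ℕ} (hz : z ^ N = 0) (h : ∀ m < N, coeff m f = coeff m g) :
    nilEval z N hz f = nilEval z N hz g := by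
  rw [nilEval_apply, nilEval_apply]
  exact Finset.sum_congr rfl fun i hi => by rw [h i (Finset.mem_range.1 hi)]

lemma nilPairing_add (x y : WittVector p A) :
    nilPairing ι hz (x + y) = nilPairing ι hz x * nilPairing ι hz y := by
  rw [nilPairing, nilEval_congr hz (coeff_artinHasseProd_add ι a x y), map_mul]
  rfl

lemma nilPairing_zero : nilPairing ι hz 0 = 1 := by
  rw [nilPairing, artinHasseProd, Finset.prod_eq_one, map_one]
  intro i _
  rw [WittVector.zero_coeff, artinHasseTerm_zero_right]

lemma nilPairing_nsmul (m : ℕ) (x : WittVector p A) :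
    nilPairing ι hz (m • x) = nilPairing ι hz x ^ m := by
  induction m with
  | zero => rw [zero_smul, pow_zero, nilPairing_zero]
  | succ m ih => rw [succ_nsmul, nilPairing_add, ih, pow_succ]

/-- The pairing is 1 plus a multiple of z, so its values have order dividing p^(a+k). This lets the
logarithm be used through a p-adic approximation. -/
lemma nilPairing_pow_mul {k M : ℕ} (hk : (p : A) ^ k = 0) (hM : a + k ≤ M) (x : WittVector p A) :
    nilPairing ι hz ((p : WittVector p A) ^ M * x) = 1 := by
  have h0 : (nilPairing ι hz x - 1) ^ p ^ a = 0 := by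
    obtain ⟨g, hg⟩ := X_dvd_iff.2 (show constantCoeff (artinHasseProd ι a x.coeff - 1) = 0 by
      rw [map_sub, constantCoeff_artinHasseProd, map_one, sub_self])
    have h1 : nilPairing ι hz x - 1 = nilEval z (p ^ a) hz X * nilEval z (p ^ a) hz g := by
      rw [← map_mul, ← hg, map_sub, map_one]
      rfl
    have h2 : nilEval z (p ^ a) hz X ^ p ^ a = 0 := by
      rw [← map_pow, nilEval_apply]
      refine Finset.sum_eq_zero fun i hi => ?_
      rw [coeff_X_pow, if_neg (Finset.mem_range.1 hi).ne, zero_mul]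
    rw [h1, mul_pow, h2, zero_mul]
  have h1 := pow_eq_one_of_sub_one_pow_eq_zero hk h0
  rw [← Nat.cast_pow, ← nsmul_eq_mul, nilPairing_nsmul, ← Nat.add_sub_cancel' hM,
    pow_add, pow_mul, h1, one_pow]

lemma map_nilPairing (f : A →+* B) (hz' : f z ^ p ^ a = 0) (x : WittVector p A) :
    f (nilPairing ι hz x) = nilPairing (f.comp ι) hz' (WittVector.map f x) := by
  rw [nilPairing, map_nilEval f hz hz', map_artinHasseProd]
  rfl

variable {k : ℕ} (hk : (p : A) ^ k = 0)

/-- The character of `W^×` attached to a nilpotent element `z`. -/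
def nilChar : (WittVector p A)ˣ →* Aˣ := MonoidHom.toHomUnits
  { toFun := fun u => nilPairing ι hz (wittLog (a + k) u)
    map_one' := by
      -- Approximate additivity at u = v = 1 reads L = 2L + p^(a+k+1) L², where L is the logarithm
      -- of 1.
      have h : wittLog (a + k) (1 : (WittVector p A)ˣ) = (p : WittVector p A) ^ (a + k) *
          ((p : WittVector p A) * (-(wittLog (a + k) (1 : (WittVector p A)ˣ) * wittLog (a + k) 1))) := by
        have := wittLog_mul (a + k) (1 : (WittVector p A)ˣ) 1
        rw [mul_one] at this
        linear_combination -this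
      rw [h, nilPairing_pow_mul ι hz hk le_rfl]
    map_mul' := fun u v => by
      rw [wittLog_mul, pow_succ, mul_assoc, nilPairing_add, nilPairing_add,
        nilPairing_pow_mul ι hz hk le_rfl, mul_one] }

lemma nilChar_apply (u : (WittVector p A)ˣ) :
    (nilChar ι hz hk u : A) = nilPairing ι hz (wittLog (a + k) u) := rfl

lemma map_nilChar (f : A →+* B) (hz' : f z ^ p ^ a = 0) (hk' : (p : B) ^ k = 0)
    (u : (WittVector p A)ˣ) :
    f (nilChar ι hz hk u) = nilChar (f.comp ι) hz' hk'
      (Units.map ((WittVector.map f : WittVector p A →+* WittVector p B) : _ →* _) u) := by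
  rw [nilChar_apply, nilChar_apply, map_nilPairing ι hz f hz', map_wittLog]

end NilPairing

/-! ### The Artin–Hasse point -/

section ArtinHassePoint

open PowerSeries

variable (p : ℕ) [hp : Fact p.Prime]

lemma isLeftRegular_powerSeries : IsLeftRegular (p : ℤ_[p]⟦X⟧) := by
  refine IsLeftCancelMulZero.mul_left_cancel_of_ne_zero ?_
  rw [← map_natCast (C (R := ℤ_[p])), Ne, map_eq_zero_iff _ C_injective]
  exact Nat.cast_ne_zero.2 hp.out.ne_zero

/-- The ring homomorphism `ℤ_p[[X]] → W(ℤ_p[[X]])` attached to the Frobenius lift `X ↦ X^p`. -/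
def powerSeriesToWitt : ℤ_[p]⟦X⟧ →+* WittVector p ℤ_[p]⟦X⟧ :=
  frobeniusLiftHom (isLeftRegular_powerSeries p)
    (expand p hp.out.ne_zero : ℤ_[p]⟦X⟧ →ₐ[ℤ_[p]] ℤ_[p]⟦X⟧).toRingHom (dvd_expand_sub_pow p)

lemma frobenius_powerSeriesToWitt (f : ℤ_[p]⟦X⟧) :
    WittVector.frobenius (powerSeriesToWitt p f) =
      powerSeriesToWitt p (expand p hp.out.ne_zero f) :=
  frobenius_frobeniusLiftHom _ _ _ f

lemma powerSeriesToWitt_X : powerSeriesToWitt p X = WittVector.teichmuller p X := by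
  refine eq_of_ghostComponent_eq (isLeftRegular_powerSeries p) fun n => ?_
  rw [WittVector.ghostComponent_teichmuller, powerSeriesToWitt, ghostComponent_frobeniusLiftHom]
  induction n with
  | zero => simp
  | succ n ih =>
    rw [pow_succ', RingHom.mul_def, RingHom.comp_apply, ih, map_pow, pow_succ' p, pow_mul]
    congr 1
    exact expand_X p hp.out.ne_zero

/-- The unit `E(X)` of `ℤ_p[[X]]`. -/
def artinHasseUnit : ℤ_[p]⟦X⟧ˣ :=
  (PowerSeries.isUnit_iff_constantCoeff.2 (by
    rw [constantCoeff_artinHasse]; exact isUnit_one) : IsUnit (artinHasse p)).unit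

/-- The unit of `W(ℤ_p[[X]])` with ghost components `E(X^(p^n))`. -/
def artinHassePoint : (WittVector p ℤ_[p]⟦X⟧)ˣ :=
  Units.map (powerSeriesToWitt p : _ →* _) (artinHasseUnit p)

lemma coe_artinHassePoint :
    (artinHassePoint p : WittVector p ℤ_[p]⟦X⟧) = powerSeriesToWitt p (artinHasse p) := rfl

/-- On ℤ_p[[X]], with X ↦ X^p as Frobenius, (1/p) log(E^p / E(X^p)) is X. The finite form of this,
from `exists_artinHasse_pow_eq`, is carried over by `powerSeriesToWitt`. -/
lemma exists_wittLog_artinHassePoint (M : ℕ) : ∃ y, wittLog M (artinHassePoint p) =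
    WittVector.teichmuller p X + (p : WittVector p ℤ_[p]⟦X⟧) ^ M * y := by
  obtain ⟨K, H, h1, h2⟩ := exists_artinHasse_pow_eq p M
  refine ⟨powerSeriesToWitt p H, (eq_wittLog M _ _ ?_).symm⟩
  refine (isLeftRegular_wittVector (isLeftRegular_powerSeries p)).pow (M + 1) ?_
  dsimp only
  rw [pow_mul_logNum, coe_artinHassePoint, frobenius_powerSeriesToWitt, ← powerSeriesToWitt_X]
  simp only [← map_natCast (powerSeriesToWitt p), ← map_pow, ← map_mul, ← map_add, ← map_sub]
  congr 1
  rw [h1, mul_pow, h2, map_pow]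
  ring

end ArtinHassePoint

/-! ### The Frobenius of `W` is a cover -/

section Cover

open MvPolynomial

variable (p : ℕ) [hp : Fact p.Prime] (S : Type*) [CommRing S]

/-- Exponents of monomials in which every variable has exponent less than `p`. -/
abbrev SmallExponent : Type := {e : ℕ →₀ ℕ // ∀ i, e i < p}

/-- The polynomials describing the Witt vector Frobenius, with coefficients in `S`. -/
def frobPoly (i : ℕ) : MvPolynomial ℕ S :=
  MvPolynomial.map (Int.castRingHom S) (WittVector.frobeniusPoly p i)

/-- The endomorphism of the polynomial ring induced by the Witt vector Frobenius. -/
def frobHom : MvPolynomial ℕ S →ₐ[S] MvPolynomial ℕ S := bind₁ (frobPoly p S)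

/-- Division with remainder of exponents. -/
def exponentEquiv : (Σ _ : SmallExponent p, ℕ →₀ ℕ) ≃ (ℕ →₀ ℕ) where
  toFun x := p • x.2 + x.1.1
  invFun a := ⟨⟨a.mapRange (· % p) (Nat.zero_mod p), fun i => Nat.mod_lt _ hp.out.pos⟩,
    a.mapRange (· / p) (Nat.zero_div p)⟩
  left_inv := by
    rintro ⟨⟨e, he⟩, a⟩
    have h1 : (p • a + e).mapRange (· % p) (Nat.zero_mod p) = e := by
      ext i
      simp [Nat.add_mod, Nat.mod_eq_of_lt (he i)]
    have h2 : (p • a + e).mapRange (· / p) (Nat.zero_div p) = a := by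
      ext i
      simp [Nat.mul_add_div hp.out.pos, Nat.div_eq_of_lt (he i)]
    exact Sigma.ext (Subtype.ext h1) (heq_of_eq h2)
  right_inv a := by
    ext i
    simp [Nat.div_add_mod]

/-- The linear map `(a_e) ↦ ∑ F(a_e) X^e`, where `F` is the Witt vector Frobenius. -/
def frobSum : (SmallExponent p →₀ MvPolynomial ℕ S) →ₗ[S] MvPolynomial ℕ S :=
  Finsupp.lsum S fun e => (LinearMap.mulRight S (monomial e.1 (1 : S))) ∘ₗ
    (frobHom p S).toLinearMap

omit hp in
lemma frobSum_apply (a : SmallExponent p →₀ MvPolynomial ℕ S) :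
    frobSum p S a = a.sum fun e c => frobHom p S c * monomial e.1 (1 : S) := rfl

omit hp in
lemma frobSum_smul (h : MvPolynomial ℕ S) (a : SmallExponent p →₀ MvPolynomial ℕ S) :
    frobSum p S (h • a) = frobHom p S h * frobSum p S a := by
  induction a using Finsupp.induction_linear with
  | zero => simp
  | add f g hf hg => rw [smul_add, map_add, hf, hg, map_add, mul_add]
  | single e c =>
    rw [Finsupp.smul_single, frobSum_apply, frobSum_apply, Finsupp.sum_single_index (by simp),
      Finsupp.sum_single_index (by simp), smul_eq_mul, map_mul, mul_assoc]

/-- The linear equivalence `(a_e) ↦ ∑ a_e(X^p) X^e`. -/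
def expandSum : (SmallExponent p →₀ MvPolynomial ℕ S) ≃ₗ[S] MvPolynomial ℕ S :=
  (Finsupp.basis fun _ : SmallExponent p => basisMonomials ℕ S).equiv (basisMonomials ℕ S)
    (exponentEquiv p)

omit hp in
lemma frobHom_sub_expand_mem (f : MvPolynomial ℕ S) :
    (p : MvPolynomial ℕ S) ∣ frobHom p S f - expand p f := by
  rw [← Ideal.mem_span_singleton, ← Ideal.Quotient.eq]
  have h : (Ideal.Quotient.mkₐ S (Ideal.span {(p : MvPolynomial ℕ S)})).comp (frobHom p S) =
      (Ideal.Quotient.mkₐ S (Ideal.span {(p : MvPolynomial ℕ S)})).comp (expand p) := by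
    apply algHom_ext
    intro i
    simp only [AlgHom.comp_apply, frobHom, bind₁_X_right, expand_X, Ideal.Quotient.mkₐ_eq_mk]
    rw [Ideal.Quotient.eq, Ideal.mem_span_singleton]
    exact ⟨MvPolynomial.map (Int.castRingHom S) (WittVector.frobeniusPolyAux p i), by
      simp [frobPoly, WittVector.frobeniusPoly]⟩
  exact DFunLike.congr_fun h f

/-- Modulo p the Frobenius polynomials are X_i^p, so the two linear maps agree on the basis. -/
lemma frobSum_sub_expandSum (a : SmallExponent p →₀ MvPolynomial ℕ S) :
    (p : MvPolynomial ℕ S) ∣ frobSum p S a - expandSum p S a := by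
  set I := (Ideal.span {(p : MvPolynomial ℕ S)}).restrictScalars S
  have h : I.mkQ ∘ₗ frobSum p S = I.mkQ ∘ₗ (expandSum p S).toLinearMap := by
    apply (Finsupp.basis fun _ : SmallExponent p => basisMonomials ℕ S).ext
    rintro ⟨e, b⟩
    rw [LinearMap.comp_apply, LinearMap.comp_apply, LinearEquiv.coe_coe, expandSum,
      Module.Basis.equiv_apply, Submodule.mkQ_apply, Submodule.mkQ_apply,
      Submodule.Quotient.eq, Submodule.restrictScalars_mem, Ideal.mem_span_singleton]
    have h1 : (Finsupp.basis fun _ : SmallExponent p => basisMonomials ℕ S) ⟨e, b⟩ =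
        Finsupp.single e (monomial b (1 : S)) := by
      simp
    rw [h1, frobSum_apply, Finsupp.sum_single_index (by simp)]
    have h2 : basisMonomials ℕ S (exponentEquiv p ⟨e, b⟩) =
        expand p (monomial b (1 : S)) * monomial e.1 1 := by
      simp [exponentEquiv, expand_monomial, monomial_mul]
    rw [h2, ← sub_mul]
    exact (frobHom_sub_expand_mem p S _).mul_right _
  have := LinearMap.congr_fun h a
  rwa [LinearMap.comp_apply, LinearMap.comp_apply, LinearEquiv.coe_coe, Submodule.mkQ_apply,
    Submodule.mkQ_apply, Submodule.Quotient.eq, Submodule.restrictScalars_mem,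
    Ideal.mem_span_singleton] at this

variable {p S}

/-- Composing with the inverse of `expandSum` gives 1 plus an endomorphism divisible by p, hence
nilpotent. So the polynomial ring is free over itself via F, on the small monomials. -/
lemma frobSum_bijective {k : ℕ} (hk : (p : S) ^ k = 0) : Function.Bijective (frobSum p S) := by
  set D : Module.End S (SmallExponent p →₀ MvPolynomial ℕ S) :=
    (expandSum p S).symm.toLinearMap ∘ₗ (frobSum p S - (expandSum p S).toLinearMap)
  have hD : ∀ a, ∃ b, D a = (p : S) • b := by
    intro a
    obtain ⟨c, hc⟩ := frobSum_sub_expandSum p S a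
    refine ⟨(expandSum p S).symm c, ?_⟩
    rw [← map_smul, LinearMap.comp_apply, LinearMap.sub_apply, LinearEquiv.coe_coe,
      LinearEquiv.coe_coe, hc, Nat.cast_smul_eq_nsmul, nsmul_eq_mul]
  have hDn : ∀ n a, ∃ b, (D ^ n) a = ((p : S) ^ n) • b := by
    intro n
    induction n with
    | zero => exact fun a => ⟨a, by simp⟩
    | succ n ih =>
      intro a
      obtain ⟨b, hb⟩ := ih a
      obtain ⟨c, hc⟩ := hD b
      refine ⟨c, ?_⟩
      rw [pow_succ', Module.End.mul_apply, hb, map_smul, hc, smul_smul, ← pow_succ]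
  have hnil : IsNilpotent D := by
    refine ⟨k, LinearMap.ext fun a => ?_⟩
    obtain ⟨b, hb⟩ := hDn k a
    rw [hb, hk, zero_smul, LinearMap.zero_apply]
  have hu : IsUnit (1 + D) :=
    IsNilpotent.isUnit_one_add (R := Module.End S (SmallExponent p →₀ MvPolynomial ℕ S)) hnil
  have hunit := (Module.End.isUnit_iff (1 + D)).1 hu
  have heq : ⇑(frobSum p S) = expandSum p S ∘ ⇑(1 + D) := by
    funext a
    simp [D]
  rw [heq]
  exact (expandSum p S).bijective.comp hunit

variable (v : WittVector p S)

/-- The ideal of the equations `F(X) = v`. -/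
def frobCoverIdeal : Ideal (MvPolynomial ℕ S) :=
  Ideal.span (Set.range fun i => frobPoly p S i - C (v.coeff i))

/-- The universal `S`-algebra over which the Witt vector `v` has a preimage under Frobenius. -/
abbrev FrobCover : Type _ := MvPolynomial ℕ S ⧸ frobCoverIdeal v

omit hp in
lemma mk_frobHom (a : MvPolynomial ℕ S) :
    Ideal.Quotient.mk (frobCoverIdeal v) (frobHom p S a) =
      algebraMap S (FrobCover v) (aeval v.coeff a) := by
  have h : (Ideal.Quotient.mkₐ S (frobCoverIdeal v)).comp (frobHom p S) =
      (Algebra.ofId S (FrobCover v)).comp (aeval v.coeff) := by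
    apply algHom_ext
    intro i
    simp only [AlgHom.comp_apply, frobHom, bind₁_X_right, aeval_X, Ideal.Quotient.mkₐ_eq_mk]
    exact (Ideal.Quotient.eq (I := frobCoverIdeal v) (y := C (v.coeff i))).2
      (Ideal.subset_span ⟨i, rfl⟩)
  exact DFunLike.congr_fun h a

/-- The coordinates of a polynomial with respect to the small monomials, modulo `F(X) = v`. -/
def frobCoverCoord {k : ℕ} (hk : (p : S) ^ k = 0) :
    MvPolynomial ℕ S →ₗ[S] (SmallExponent p →₀ S) :=
  Finsupp.mapRange.linearMap (aeval v.coeff).toLinearMap ∘ₗ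
    (LinearEquiv.ofBijective (frobSum p S) (frobSum_bijective hk)).symm.toLinearMap

lemma frobCoverCoord_frobSum {k : ℕ} (hk : (p : S) ^ k = 0)
    (a : SmallExponent p →₀ MvPolynomial ℕ S) :
    frobCoverCoord v hk (frobSum p S a) =
      Finsupp.mapRange.linearMap (aeval v.coeff).toLinearMap a := by
  rw [frobCoverCoord, LinearMap.comp_apply]
  congr 1
  exact (LinearEquiv.ofBijective (frobSum p S) (frobSum_bijective hk)).symm_apply_apply a

/-- In the coordinates a_e, multiplication by F(X_i) - v_i is multiplication by X_i - v_i
(`frobSum_smul`), so the ideal consists of the polynomials whose coordinates vanish at v. -/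
lemma ker_frobCoverCoord {k : ℕ} (hk : (p : S) ^ k = 0) :
    LinearMap.ker (frobCoverCoord v hk) = (frobCoverIdeal v).restrictScalars S := by
  ext f
  rw [LinearMap.mem_ker, Submodule.restrictScalars_mem]
  constructor
  · intro h
    obtain ⟨a, rfl⟩ := (frobSum_bijective hk).2 f
    rw [frobCoverCoord_frobSum] at h
    rw [← Ideal.Quotient.eq_zero_iff_mem, frobSum_apply, Finsupp.sum, map_sum]
    refine Finset.sum_eq_zero fun e _ => ?_
    have h1 : aeval v.coeff (a e) = 0 := DFunLike.congr_fun h e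
    rw [map_mul, mk_frobHom, h1, map_zero, zero_mul]
  · intro h
    have key : ∀ g, frobCoverCoord v hk (f * g) = 0 := by
      refine Submodule.span_induction (p := fun f _ => ∀ g, frobCoverCoord v hk (f * g) = 0)
        ?_ ?_ ?_ ?_ h
      · rintro _ ⟨i, rfl⟩ g
        obtain ⟨a, rfl⟩ := (frobSum_bijective hk).2 g
        have h1 : frobPoly p S i - C (v.coeff i) = frobHom p S (X i - C (v.coeff i)) := by
          rw [map_sub, frobHom, bind₁_X_right, bind₁_C_right]
        dsimp only
        rw [h1, ← frobSum_smul, frobCoverCoord_frobSum]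
        ext e
        simp
      · simp
      · intro x y _ _ hx hy g
        rw [add_mul, map_add, hx, hy, add_zero]
      · intro r x _ hx g
        rw [smul_eq_mul, mul_comm r, mul_assoc, hx]
    simpa using key 1

lemma frobCoverCoord_monomial {k : ℕ} (hk : (p : S) ^ k = 0) (e : SmallExponent p) :
    frobCoverCoord v hk (monomial e.1 1) = Finsupp.single e 1 := by
  have h : monomial e.1 (1 : S) = frobSum p S (Finsupp.single e 1) := by
    rw [frobSum_apply, Finsupp.sum_single_index (by simp),
      show frobHom p S 1 = 1 from map_one _, one_mul]
  rw [h, frobCoverCoord_frobSum]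
  simp

/-- The basis of small monomials of `FrobCover v` over `S`. -/
def frobCoverBasis {k : ℕ} (hk : (p : S) ^ k = 0) :
    Module.Basis (SmallExponent p) S (FrobCover v) :=
  .ofRepr <| (Submodule.Quotient.restrictScalarsEquiv S (frobCoverIdeal v)).symm ≪≫ₗ
    Submodule.quotEquivOfEq _ _ (ker_frobCoverCoord v hk).symm ≪≫ₗ
    (frobCoverCoord v hk).quotKerEquivOfSurjective (by
      rw [← LinearMap.range_eq_top, eq_top_iff, ← Finsupp.basisSingleOne.span_eq,
        Submodule.span_le]
      rintro _ ⟨e, rfl⟩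
      exact ⟨monomial e.1 1, by rw [frobCoverCoord_monomial]; simp⟩)

lemma frobCoverBasis_apply {k : ℕ} (hk : (p : S) ^ k = 0) (e : SmallExponent p) :
    frobCoverBasis v hk e = Ideal.Quotient.mk (frobCoverIdeal v) (monomial e.1 1) := by
  apply (frobCoverBasis v hk).repr.injective
  rw [Module.Basis.repr_self]
  exact (frobCoverCoord_monomial v hk e).symm

/-- The tautological preimage of `v` under Frobenius. -/
def frobCoverPoint : WittVector p (FrobCover v) :=
  WittVector.mk p fun i => Ideal.Quotient.mk (frobCoverIdeal v) (X i)

lemma frobenius_frobCoverPoint : WittVector.frobenius (frobCoverPoint v) =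
    WittVector.map (algebraMap S (FrobCover v)) v := by
  ext i
  have h := mk_frobHom v (X i)
  rw [frobHom, bind₁_X_right, aeval_X] at h
  rw [WittVector.map_coeff, ← h, WittVector.coeff_frobenius, frobPoly, aeval_def]
  have h2 : eval₂Hom (algebraMap ℤ (FrobCover v)) (frobCoverPoint v).coeff =
      (Ideal.Quotient.mk (frobCoverIdeal v)).comp (MvPolynomial.map (Int.castRingHom S)) :=
    ringHom_ext' (Subsingleton.elim _ _) fun i => by simp [frobCoverPoint]
  exact RingHom.congr_fun h2 _

lemma exists_frobCover_lift {T : Type*} [CommRing T] (g : S →+* T) (w : WittVector p T)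
    (h : WittVector.frobenius w = WittVector.map g v) : ∃ f : FrobCover v →+* T,
      f.comp (algebraMap S (FrobCover v)) = g ∧ WittVector.map f (frobCoverPoint v) = w := by
  let f0 : MvPolynomial ℕ S →+* T := eval₂Hom g w.coeff
  have hf0 : ∀ a ∈ frobCoverIdeal v, f0 a = 0 := by
    intro a ha
    rw [← RingHom.mem_ker]
    refine (Ideal.span_le.2 ?_ : frobCoverIdeal v ≤ RingHom.ker f0) ha
    rintro _ ⟨i, rfl⟩
    have h1 := congrArg (fun x => x.coeff i) h
    rw [WittVector.coeff_frobenius, WittVector.map_coeff, aeval_def] at h1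
    have h2 : eval₂Hom (algebraMap ℤ T) w.coeff = f0.comp (MvPolynomial.map (Int.castRingHom S)) :=
      ringHom_ext' (Subsingleton.elim _ _) fun i => by simp [f0]
    rw [SetLike.mem_coe, RingHom.mem_ker, map_sub, sub_eq_zero, frobPoly]
    refine (RingHom.congr_fun h2 _).symm.trans (h1.trans ?_)
    simp [f0]
  refine ⟨Ideal.Quotient.lift _ f0 hf0, RingHom.ext fun s => ?_, ?_⟩
  · exact (Ideal.Quotient.lift_mk _ f0 hf0 (a := C s)).trans (by simp [f0])
  · ext i
    simp [frobCoverPoint, f0, WittVector.map_coeff]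

/-- The algebra `FrobCover v` over `S` has a linear retraction onto `S`. -/
lemma exists_frobCover_retraction {k : ℕ} (hk : (p : S) ^ k = 0) :
    ∃ c : FrobCover v →ₗ[S] S, c 1 = 1 := by
  refine ⟨(frobCoverBasis v hk).coord ⟨0, fun _ => hp.out.pos⟩, ?_⟩
  have h : frobCoverBasis v hk ⟨0, fun _ => hp.out.pos⟩ = 1 := by
    rw [frobCoverBasis_apply]
    exact map_one _
  rw [← h, Module.Basis.coord_apply, Module.Basis.repr_self, Finsupp.single_eq_same]

lemma algebraMap_frobCover_injective {k : ℕ} (hk : (p : S) ^ k = 0) :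
    Function.Injective (algebraMap S (FrobCover v)) := by
  obtain ⟨c, hc⟩ := exists_frobCover_retraction v hk
  intro x y hxy
  have := congrArg c hxy
  simpa [Algebra.algebraMap_eq_smul_one, hc] using this

-- With c the retraction, y ⊗ z ↦ c(z) y sends the two sides to y and c(y).
open TensorProduct in
lemma exists_algebraMap_of_tmul_eq {k : ℕ} (hk : (p : S) ^ k = 0) (y : FrobCover v)
    (hy : y ⊗ₜ[S] (1 : FrobCover v) = (1 : FrobCover v) ⊗ₜ[S] y) :
    ∃ s, algebraMap S (FrobCover v) s = y := by
  obtain ⟨c, hc⟩ := exists_frobCover_retraction v hk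
  have h := congrArg (TensorProduct.lift ((LinearMap.lsmul S (FrobCover v)).flip.compr₂
    LinearMap.id |>.compl₂ c)) hy
  refine ⟨c y, ?_⟩
  simpa [hc, Algebra.algebraMap_eq_smul_one] using h.symm

end Cover

/-! ### The divided power algebra in one variable -/

section DividedPowers

open Polynomial Nat

/-- The ring of polynomials `∑ a_i X^i / i!` with integers `a_i`. -/
def dpRing : Subring ℚ[X] where
  carrier := {f | ∀ i, ∃ z : ℤ, (z : ℚ) = i ! * f.coeff i}
  zero_mem' i := ⟨0, by simp⟩
  one_mem' i := ⟨if i = 0 then 1 else 0, by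
    rw [coeff_one]
    split_ifs with h <;> simp [h]⟩
  add_mem' {f g} hf hg i := by
    obtain ⟨a, ha⟩ := hf i
    obtain ⟨b, hb⟩ := hg i
    exact ⟨a + b, by rw [Int.cast_add, ha, hb, coeff_add, mul_add]⟩
  neg_mem' {f} hf i := by
    obtain ⟨a, ha⟩ := hf i
    exact ⟨-a, by rw [Int.cast_neg, ha, coeff_neg, mul_neg]⟩
  mul_mem' {f g} hf hg i := by
    choose a ha using hf
    choose b hb using hg
    refine ⟨∑ x ∈ Finset.HasAntidiagonal.antidiagonal i, (i.choose x.1 : ℤ) * (a x.1 * b x.2), ?_⟩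
    rw [coeff_mul, Int.cast_sum, Finset.mul_sum]
    refine Finset.sum_congr rfl fun x hx => ?_
    rw [Finset.HasAntidiagonal.mem_antidiagonal] at hx
    rw [← hx, Int.cast_mul, Int.cast_mul, ha, hb, ← Nat.add_choose_mul_factorial_mul_factorial, Nat.choose_symm_add]
    push_cast
    ring

/-- The coefficients of an element of `dpRing` with respect to the divided powers of `X`. -/
def dpCoord : dpRing →ₗ[ℤ] (ℕ →₀ ℤ) where
  toFun f := Finsupp.onFinset f.1.support (fun i => (f.2 i).choose) fun i hi => by
    rw [mem_support_iff]
    intro h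
    have := (f.2 i).choose_spec
    exact hi (Int.cast_eq_zero.1 (this.trans (by rw [h, mul_zero])))
  map_add' f g := by
    ext i
    have h1 := ((f + g).2 i).choose_spec
    have h2 := (f.2 i).choose_spec
    have h3 := (g.2 i).choose_spec
    have : (((f + g).2 i).choose : ℚ) = ((f.2 i).choose + (g.2 i).choose : ℤ) := by
      rw [Int.cast_add, h1, h2, h3, ← mul_add, ← coeff_add]
      rfl
    exact_mod_cast this
  map_smul' z f := by
    ext i
    have h1 := ((z • f).2 i).choose_spec
    have h2 := (f.2 i).choose_spec
    have : (((z • f).2 i).choose : ℚ) = (z * (f.2 i).choose : ℤ) := by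
      rw [Int.cast_mul, h1, h2, show ((z • f : dpRing) : ℚ[X]) = z • (f : ℚ[X]) from rfl,
        coeff_smul, zsmul_eq_mul]
      ring
    exact_mod_cast this

lemma dpCoord_spec (f : dpRing) (i : ℕ) : (dpCoord f i : ℚ) = i ! * (f : ℚ[X]).coeff i :=
  (f.2 i).choose_spec

/-- The divided powers of `X`. -/
def dpGamma (i : ℕ) : dpRing := ⟨monomial i (i ! : ℚ)⁻¹, fun j => ⟨if i = j then 1 else 0, by
  rw [coeff_monomial]
  split_ifs with h
  · rw [h, mul_inv_cancel₀ (Nat.cast_ne_zero.2 (factorial_ne_zero j)), Int.cast_one]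
  · simp⟩⟩

lemma dpCoord_gamma (i : ℕ) : dpCoord (dpGamma i) = Finsupp.single i 1 := by
  ext j
  have h := dpCoord_spec (dpGamma i) j
  rw [show (dpGamma i : ℚ[X]).coeff j = if i = j then (i ! : ℚ)⁻¹ else 0 from coeff_monomial] at h
  rw [Finsupp.single_apply]
  split_ifs at h ⊢ with hij
  · rw [← hij, mul_inv_cancel₀ (Nat.cast_ne_zero.2 (factorial_ne_zero i))] at h
    rw [← hij]
    exact_mod_cast h
  · rw [mul_zero] at h
    exact_mod_cast h

/-- The basis of divided powers. -/
def dpBasis : Module.Basis ℕ ℤ dpRing := .ofRepr <| LinearEquiv.ofBijective dpCoord <| by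
  constructor
  · intro f g h
    apply Subtype.ext
    ext i
    have h1 := dpCoord_spec f i
    rw [h, dpCoord_spec g i] at h1
    exact (mul_left_cancel₀ (Nat.cast_ne_zero.2 (factorial_ne_zero i)) h1).symm
  · rw [← LinearMap.range_eq_top, eq_top_iff, ← Finsupp.basisSingleOne.span_eq,
      Submodule.span_le]
    rintro _ ⟨i, rfl⟩
    exact ⟨dpGamma i, by rw [dpCoord_gamma]; simp⟩

lemma dpBasis_repr (f : dpRing) : dpBasis.repr f = dpCoord f := rfl

lemma dpBasis_apply (i : ℕ) : dpBasis i = dpGamma i := by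
  apply dpBasis.repr.injective
  rw [Module.Basis.repr_self, dpBasis_repr, dpCoord_gamma]

/-- The augmentation `X ↦ 0` of `dpRing`. -/
def dpAug : dpRing →+* ℤ where
  toFun f := dpCoord f 0
  map_zero' := by simp
  map_one' := by
    have := dpCoord_spec 1 0
    simp at this
    exact_mod_cast this
  map_add' f g := by simp
  map_mul' f g := by
    have h := dpCoord_spec (f * g) 0
    rw [show ((f * g : dpRing) : ℚ[X]) = (f : ℚ[X]) * (g : ℚ[X]) from rfl, mul_coeff_zero] at h
    have : (dpCoord (f * g) 0 : ℚ) = (dpCoord f 0 * dpCoord g 0 : ℤ) := by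
      rw [h, Int.cast_mul, dpCoord_spec, dpCoord_spec]
      simp
    exact_mod_cast this

lemma dpAug_apply (f : dpRing) : dpAug f = dpCoord f 0 := rfl

/-- The derivation `(1 + X) d/dX` of `dpRing`. -/
def dpDeriv : dpRing →ₗ[ℤ] dpRing where
  toFun f := ⟨(1 + X) * derivative (f : ℚ[X]), by
    have h : derivative (f : ℚ[X]) ∈ dpRing := fun i => by
      refine ⟨dpCoord f (i + 1), ?_⟩
      rw [dpCoord_spec, coeff_derivative, factorial_succ]
      push_cast
      ring
    refine dpRing.mul_mem (dpRing.add_mem dpRing.one_mem ?_) h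
    simpa [dpGamma, monomial_one_one_eq_X] using (dpGamma 1).2⟩
  map_add' f g := Subtype.ext (by simp [mul_add])
  map_smul' z f := Subtype.ext (by
    change (1 + X) * derivative (z • (f : ℚ[X])) = z • ((1 + X) * derivative (f : ℚ[X]))
    rw [map_zsmul, mul_smul_comm])

lemma coe_dpDeriv (f : dpRing) : (dpDeriv f : ℚ[X]) = (1 + X) * derivative (f : ℚ[X]) := rfl

lemma dpDeriv_mul (f g : dpRing) : dpDeriv (f * g) = dpDeriv f * g + f * dpDeriv g := by
  apply Subtype.ext
  change (1 + X) * derivative ((f : ℚ[X]) * (g : ℚ[X])) =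
    (1 + X) * derivative (f : ℚ[X]) * (g : ℚ[X]) + (f : ℚ[X]) * ((1 + X) * derivative (g : ℚ[X]))
  rw [derivative_mul]
  ring

/-- The operator d/dX lowers divided powers by one and X d/dX multiplies the i-th by i. For an
eigenvector this becomes a two-term recursion on coordinates. -/
lemma dpCoord_dpDeriv (f : dpRing) (i : ℕ) :
    dpCoord (dpDeriv f) i = dpCoord f (i + 1) + i * dpCoord f i := by
  have h : (dpCoord (dpDeriv f) i : ℚ) = (dpCoord f (i + 1) + i * dpCoord f i : ℤ) := by
    rw [dpCoord_spec, coe_dpDeriv, add_mul, one_mul, coeff_add, coeff_derivative]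
    push_cast
    rw [dpCoord_spec, dpCoord_spec, factorial_succ]
    cases i with
    | zero => simp
    | succ i =>
      rw [coeff_X_mul, coeff_derivative]
      push_cast
      ring
  exact_mod_cast h

lemma dpAug_one_add : dpAug (1 + dpGamma 1) = 1 := by
  rw [map_add, map_one, dpAug_apply, dpCoord_gamma]
  simp

/-- The endomorphism `X ↦ 0` of `dpRing`. -/
def dpFrob : dpRing →+* dpRing := (Int.castRingHom dpRing).comp dpAug

lemma dpFrob_one_add : dpFrob (1 + dpGamma 1) = 1 := by
  rw [dpFrob, RingHom.comp_apply, dpAug_one_add, map_one]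

end DividedPowers

/-! ### The Frobenius lift X ↦ 0 on divided powers -/

section DividedPowerFrobenius

open Polynomial Nat

variable (p : ℕ) [hp : Fact p.Prime]

omit hp in
lemma dpGamma_pow {i : ℕ} (hi : i ≠ 0) :
    dpGamma i ^ p = ((p ! * p.uniformBell i : ℕ) : dpRing) * dpGamma (p * i) := by
  apply Subtype.ext
  have h := Nat.uniformBell_mul_eq p hi
  have h1 : ((i ! : ℚ)⁻¹) ^ p = (p ! * p.uniformBell i : ℕ) * ((p * i)! : ℚ)⁻¹ := by
    rw [← h]
    have h2 : (i ! : ℚ) ≠ 0 := Nat.cast_ne_zero.2 (factorial_ne_zero i)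
    have h3 : (p ! : ℚ) ≠ 0 := Nat.cast_ne_zero.2 (factorial_ne_zero p)
    have h4 : (p.uniformBell i : ℚ) ≠ 0 := by
      intro h4
      rw [Nat.cast_eq_zero] at h4
      rw [h4, zero_mul, zero_mul] at h
      exact factorial_ne_zero _ h.symm
    push_cast
    rw [inv_pow]
    field_simp
  change (monomial i (i ! : ℚ)⁻¹) ^ p = ((p ! * p.uniformBell i : ℕ) : ℚ[X]) * monomial (p * i) ((p * i)! : ℚ)⁻¹
  rw [monomial_pow, h1, ← C_eq_natCast, C_mul_monomial, mul_comm i p]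

lemma dvd_int_sub_pow (z : ℤ) : (p : ℤ) ∣ z - z ^ p := by
  rw [← (ZMod.intCast_zmod_eq_zero_iff_dvd (z - z ^ p) p)]
  simp

/-- Raising to the p-th power is additive modulo p, so the divided powers suffice. For i > 0 the
p-th power of `dpGamma i` is divisible by p! by `dpGamma_pow`. -/
lemma dvd_dpFrob_sub_pow (f : dpRing) : (p : dpRing) ∣ dpFrob f - f ^ p := by
  have hf : f ∈ Submodule.span ℤ (Set.range dpBasis) := by
    rw [dpBasis.span_eq]
    trivial
  induction hf using Submodule.span_induction with
  | mem f hf =>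
    obtain ⟨i, rfl⟩ := hf
    rw [dpBasis_apply, dpFrob, RingHom.comp_apply, dpAug_apply, dpCoord_gamma]
    by_cases hi : i = 0
    · subst hi
      have : dpGamma 0 = 1 := Subtype.ext (by simp [dpGamma])
      simp [this]
    · rw [Finsupp.single_apply, if_neg hi, map_zero, zero_sub, dvd_neg, dpGamma_pow p hi]
      exact ((Nat.cast_dvd_cast (dvd_factorial hp.out.pos le_rfl)).trans
        (by push_cast; exact dvd_mul_right _ _)).mul_right _
  | zero => simp [hp.out.ne_zero]
  | add f g _ _ hf hg =>
    obtain ⟨r, hr⟩ := exists_add_pow_prime_eq hp.out f g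
    rw [hr, map_add]
    have : dpFrob f + dpFrob g - (f ^ p + g ^ p + p * f * g * r) =
        (dpFrob f - f ^ p) + (dpFrob g - g ^ p) - p * (f * g * r) := by ring
    rw [this]
    exact ((hf.add hg).sub (dvd_mul_right _ _))
  | smul z f _ hf =>
    rw [zsmul_eq_mul, map_mul, map_intCast, mul_pow]
    have : (z : dpRing) * dpFrob f - (z : dpRing) ^ p * f ^ p =
        z * (dpFrob f - f ^ p) + ((z - z ^ p : ℤ) : dpRing) * f ^ p := by push_cast; ring
    rw [this]
    refine (hf.mul_left _).add (Dvd.dvd.mul_right ?_ _)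
    have := map_dvd (Int.castRingHom dpRing) (dvd_int_sub_pow p z)
    simpa using this

lemma isLeftRegular_dpRing : IsLeftRegular (p : dpRing) :=
  IsLeftCancelMulZero.mul_left_cancel_of_ne_zero (by
    intro h
    have := congrArg Subtype.val h
    push_cast at this
    exact hp.out.ne_zero (Nat.cast_eq_zero.1 this))

/-- The ring homomorphism `dpRing → W(dpRing)` attached to the Frobenius lift `X ↦ 0`. -/
def dpToWitt : dpRing →+* WittVector p dpRing :=
  frobeniusLiftHom (isLeftRegular_dpRing p) dpFrob (dvd_dpFrob_sub_pow p)

/-- The Witt vector with ghost components `(1 + X, 1, 1, …)`. -/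
def dpWitt : WittVector p dpRing := dpToWitt p (1 + dpGamma 1)

lemma frobenius_dpWitt : WittVector.frobenius (dpWitt p) = 1 := by
  rw [dpWitt, dpToWitt, frobenius_frobeniusLiftHom, dpFrob_one_add, map_one]

lemma ghostComponent_dpWitt (n : ℕ) : WittVector.ghostComponent n (dpWitt p) =
    if n = 0 then 1 + dpGamma 1 else 1 := by
  rw [dpWitt, dpToWitt, ghostComponent_frobeniusLiftHom]
  cases n with
  | zero => simp
  | succ n => rw [pow_succ, RingHom.mul_def, RingHom.comp_apply, dpFrob_one_add]; simp

lemma map_dpAug_dpWitt : WittVector.map dpAug (dpWitt p) = 1 := by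
  have hZ : IsLeftRegular (p : ℤ) :=
    IsLeftCancelMulZero.mul_left_cancel_of_ne_zero (Nat.cast_ne_zero.2 hp.out.ne_zero)
  refine eq_of_ghostComponent_eq hZ fun n => ?_
  rw [ghostComponent_map, ghostComponent_dpWitt, map_one]
  split_ifs
  · exact dpAug_one_add
  · exact map_one _

end DividedPowerFrobenius

/-! ### Leading coefficients -/

section Leading

open Polynomial Nat

variable (p : ℕ) [hp : Fact p.Prime]

/-- The ghost component polynomial evaluated at the coefficients of `dpWitt`. -/
lemma sum_dpWitt_coeff (m : ℕ) :
    ∑ i ∈ Finset.range (m + 1), (p : ℚ[X]) ^ i * ((dpWitt p).coeff i : ℚ[X]) ^ p ^ (m - i) =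
      if m = 0 then 1 + X else 1 := by
  have h := congrArg Subtype.val (ghostComponent_dpWitt p m)
  rw [ghostComponent_eq_sum] at h
  push_cast at h
  rw [h]
  split_ifs
  · change 1 + monomial 1 ((1 ! : ℕ) : ℚ)⁻¹ = 1 + X
    simp [monomial_one_one_eq_X]
  · rfl

/-- The ghost equation expresses p^m x_m through the powers x_i^(p^(m-i)) with i < m, each of degree
at most p^m by induction. -/
lemma natDegree_dpWitt_coeff (m : ℕ) : ((dpWitt p).coeff m : ℚ[X]).natDegree ≤ p ^ m := by
  induction m using Nat.strong_induction_on with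
  | _ m ih =>
    have h := sum_dpWitt_coeff p m
    rw [Finset.sum_range_succ, Nat.sub_self, pow_zero, pow_one, ← eq_sub_iff_add_eq'] at h
    have hpm : (p : ℚ) ^ m ≠ 0 := pow_ne_zero _ (Nat.cast_ne_zero.2 hp.out.ne_zero)
    have h1 : (p : ℚ[X]) ^ m * ((dpWitt p).coeff m : ℚ[X]) =
        C ((p : ℚ) ^ m) * ((dpWitt p).coeff m : ℚ[X]) := by simp
    rw [← natDegree_C_mul hpm, ← h1, h]
    refine (natDegree_sub_le _ _).trans (max_le ?_ ?_)
    · have : 1 ≤ p ^ m := Nat.one_le_pow _ _ hp.out.pos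
      split_ifs
      · refine (natDegree_add_le _ _).trans (max_le (by simp) (by simpa using this))
      · simp
    · refine natDegree_sum_le_of_forall_le _ _ fun i hi => ?_
      rw [Finset.mem_range] at hi
      have h2 : (p : ℚ[X]) ^ i * ((dpWitt p).coeff i : ℚ[X]) ^ p ^ (m - i) =
        C ((p : ℚ) ^ i) * ((dpWitt p).coeff i : ℚ[X]) ^ p ^ (m - i) := by simp
      rw [h2]
      refine (natDegree_C_mul_le _ _).trans (natDegree_pow_le_of_le _ (ih i hi) |>.trans ?_)
      rw [← pow_add, Nat.sub_add_cancel hi.le]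

/-- The leading coefficient of the `i`-th coefficient of `dpWitt`. -/
def dpLead (i : ℕ) : ℚ := ((dpWitt p).coeff i : ℚ[X]).coeff (p ^ i)

lemma sum_dpLead (m : ℕ) (hm : m ≠ 0) :
    ∑ i ∈ Finset.range (m + 1), (p : ℚ) ^ i * dpLead p i ^ p ^ (m - i) = 0 := by
  have h := congrArg (fun f => coeff f (p ^ m)) (sum_dpWitt_coeff p m)
  rw [finsetSum_coeff, if_neg hm, coeff_one, if_neg (pow_ne_zero _ hp.out.ne_zero)] at h
  rw [← h]
  refine Finset.sum_congr rfl fun i hi => ?_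
  have h2 : (p : ℚ[X]) ^ i = C ((p : ℚ) ^ i) := by simp
  rw [h2, coeff_C_mul, dpLead, ← coeff_pow_of_natDegree_le (natDegree_dpWitt_coeff p i),
    ← pow_add, Nat.sub_add_cancel (Nat.lt_succ_iff.1 (Finset.mem_range.1 hi))]

lemma dpLead_zero : dpLead p 0 = 1 := by
  have h := sum_dpWitt_coeff p 0
  rw [Finset.sum_range_one, pow_zero, one_mul, Nat.sub_self, pow_zero, pow_one, if_pos rfl] at h
  rw [dpLead, h, pow_zero, coeff_add, coeff_one, coeff_X_one]
  simp

/-- The exponent `1 + p + ⋯ + p^(i-1)`. -/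
def repunit (i : ℕ) : ℕ := ∑ l ∈ Finset.range i, p ^ l

omit hp in
lemma repunit_add (i j : ℕ) : repunit p (i + j) = p ^ j * repunit p i + repunit p j := by
  rw [repunit, add_comm i j, Finset.sum_range_add, add_comm, repunit, repunit, Finset.mul_sum]
  simp only [pow_add]

lemma lt_repunit (j : ℕ) (hj : 2 ≤ j) : j < repunit p j := by
  induction j, hj using Nat.le_induction with
  | base => 
    have := hp.out.two_le
    simp [repunit, Finset.sum_range_succ]
    omega
  | succ j hj ih =>
    have : 1 ≤ p ^ j := Nat.one_le_pow _ _ hp.out.pos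
    rw [repunit, Finset.sum_range_succ]
    rw [repunit] at ih
    omega

/-- After scaling, the recursion for the leading coefficients gives b_(m+1) = -b_m^p modulo p: a
term with d = m + 1 - i ≥ 2 keeps a factor p^(`repunit p d` - d), whose exponent is positive by
`lt_repunit`. -/
lemma exists_dpLead (m : ℕ) : ∃ b : ℤ, (b : ℚ) = p ^ repunit p m * dpLead p m ∧ ¬ (p : ℤ) ∣ b := by
  have hp' : Prime (p : ℤ) := Nat.prime_iff_prime_int.1 hp.out
  induction m using Nat.strong_induction_on with
  | _ m ih =>
    rcases m with _ | m
    · exact ⟨1, by simp [repunit, dpLead_zero], hp'.not_dvd_one⟩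
    choose! b hb hb' using ih
    refine ⟨-(b m ^ p + ∑ i ∈ Finset.range m,
      (p : ℤ) ^ (repunit p (m + 1 - i) - (m + 1 - i)) * b i ^ p ^ (m + 1 - i)), ?_, ?_⟩
    · have h := sum_dpLead p (m + 1) (Nat.succ_ne_zero m)
      rw [Finset.sum_range_succ, Finset.sum_range_succ, Nat.sub_self, pow_zero, pow_one,
        add_eq_zero_iff_eq_neg', show m + 1 - m = 1 by omega, pow_one] at h
      have hpm : (p : ℚ) ^ (m + 1) ≠ 0 := pow_ne_zero _ (Nat.cast_ne_zero.2 hp.out.ne_zero)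
      apply mul_left_cancel₀ hpm
      rw [mul_left_comm, h]
      push_cast
      rw [mul_neg, mul_neg, mul_add, mul_add, add_comm, Finset.mul_sum, Finset.mul_sum,
        hb m (Nat.lt_succ_self m), mul_pow]
      congr 2
      · refine Finset.sum_congr rfl fun i hi => ?_
        rw [Finset.mem_range] at hi
        have h1 : repunit p (m + 1) =
            p ^ (m + 1 - i) * repunit p i + repunit p (m + 1 - i) := by
          rw [← repunit_add, Nat.add_sub_cancel' (by omega)]
        have h2 := lt_repunit p (m + 1 - i) (by omega)
        rw [hb i (by omega), mul_pow, ← pow_mul, ← mul_assoc, ← mul_assoc, ← mul_assoc, ← pow_add, ← pow_add,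
          ← pow_add]
        congr 2
        rw [h1, mul_comm (p ^ (m + 1 - i))]
        omega
      · have h1 := repunit_add p m 1
        rw [pow_one, show repunit p 1 = 1 by simp [repunit]] at h1
        rw [h1, ← pow_mul, ← mul_assoc, ← mul_assoc, ← pow_add, ← pow_add]
        congr 2
        ring
    · rw [dvd_neg, dvd_add_left]
      · exact fun h => hb' m (Nat.lt_succ_self m) (hp'.dvd_of_dvd_pow h)
      · refine Finset.dvd_sum fun i hi => Dvd.dvd.mul_right (dvd_pow_self _ ?_) _
        rw [Finset.mem_range] at hi
        have := lt_repunit p (m + 1 - i) (by omega)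
        omega

/-- The number with digits `e` in base `p`. -/
def digitSum (e : ℕ → ℕ) (N : ℕ) : ℕ := ∑ i ∈ Finset.range N, e i * p ^ i

omit hp in
lemma digitSum_succ (e : ℕ → ℕ) (N : ℕ) :
    digitSum p e (N + 1) = p * digitSum p (fun i => e (i + 1)) N + e 0 := by
  rw [digitSum, Finset.sum_range_succ', digitSum, Finset.mul_sum, pow_zero, mul_one]
  congr 1
  exact Finset.sum_congr rfl fun i _ => by ring

lemma eq_of_digitSum_eq {e e' : ℕ → ℕ} (he : ∀ i, e i < p) (he' : ∀ i, e' i < p) (N : ℕ)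
    (h : digitSum p e N = digitSum p e' N) : ∀ i < N, e i = e' i := by
  induction N generalizing e e' with
  | zero => simp
  | succ N ih =>
    rw [digitSum_succ, digitSum_succ] at h
    have h0 : e 0 = e' 0 := by
      have := congrArg (· % p) h
      simpa [Nat.add_mod, Nat.mod_eq_of_lt (he 0), Nat.mod_eq_of_lt (he' 0)] using this
    rw [h0, Nat.add_right_cancel_iff] at h
    have h1 := ih (fun i => he (i + 1)) (fun i => he' (i + 1))
      (Nat.eq_of_mul_eq_mul_left hp.out.pos h)
    intro i hi
    rcases i with _ | i
    · exact h0
    · exact h1 i (by omega)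

/-- Legendre's formula digit by digit: for r < p, (pm + r)! has valuation m plus that of m!. -/
lemma padicValNat_factorial_digitSum {e : ℕ → ℕ} (he : ∀ i, e i < p) (N : ℕ) :
    padicValNat p (digitSum p e N)! = ∑ i ∈ Finset.range N, e i * repunit p i := by
  induction N generalizing e with
  | zero => simp [digitSum]
  | succ N ih =>
    rw [digitSum_succ, padicValNat_factorial_mul_add _ (he 0), padicValNat_factorial_mul,
      ih fun i => he (i + 1), Finset.sum_range_succ', digitSum, ← Finset.sum_add_distrib]
    simp only [repunit, Finset.sum_range_zero, mul_zero, add_zero, Finset.sum_range_succ, mul_add]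

/-- The denominators of the leading coefficients contribute exactly the valuation of the factorial,
so the powers of p cancel and a p-adic unit remains. -/
lemma not_dvd_factorial_digitSum_mul {e : ℕ → ℕ} (he : ∀ i, e i < p) (N : ℕ) (z : ℤ)
    (hz : (z : ℚ) = (digitSum p e N)! * ∏ i ∈ Finset.range N, dpLead p i ^ e i) :
    ¬ (p : ℤ) ∣ z := by
  have hp' : Prime (p : ℤ) := Nat.prime_iff_prime_int.1 hp.out
  choose b hb hb' using exists_dpLead p
  set s := ∑ i ∈ Finset.range N, e i * repunit p i
  have h1 : (p : ℤ) ^ s * z = (digitSum p e N)! * ∏ i ∈ Finset.range N, b i ^ e i := by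
    have h2 : (p : ℚ) ^ s * z = (digitSum p e N)! * ∏ i ∈ Finset.range N, (b i : ℚ) ^ e i := by
      simp only [hb, mul_pow, Finset.prod_mul_distrib, ← pow_mul]
      rw [Finset.prod_pow_eq_pow_sum, hz]
      simp only [mul_comm (repunit p _), s]
      ring
    exact_mod_cast h2
  intro h
  have h2 : (p : ℤ) ^ (s + 1) ∣ (digitSum p e N)! * ∏ i ∈ Finset.range N, b i ^ e i := by
    rw [← h1, pow_succ]
    exact mul_dvd_mul_left _ h
  have h3 : IsCoprime ((p : ℤ) ^ (s + 1)) (∏ i ∈ Finset.range N, b i ^ e i) :=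
    IsCoprime.pow_left (IsCoprime.prod_right fun i _ =>
      IsCoprime.pow_right ((Prime.coprime_iff_not_dvd hp').2 (hb' i)))
  have h4 : p ^ (s + 1) ∣ (digitSum p e N)! := by exact_mod_cast h3.dvd_of_dvd_mul_right h2
  rw [padicValNat_dvd_iff_le (Nat.factorial_ne_zero _), padicValNat_factorial_digitSum p he] at h4
  exact absurd h4 (by simp [s])

lemma dpCoord_prod_of_lt {e : ℕ → ℕ} (N : ℕ) {j : ℕ} (hj : digitSum p e N < j) :
    dpCoord (∏ i ∈ Finset.range N, (dpWitt p).coeff i ^ e i) j = 0 := by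
  have h := dpCoord_spec (∏ i ∈ Finset.range N, (dpWitt p).coeff i ^ e i) j
  rw [coeff_eq_zero_of_natDegree_lt, mul_zero] at h
  · exact_mod_cast h
  · refine lt_of_le_of_lt ?_ hj
    push_cast
    refine (natDegree_prod_le _ _).trans (Finset.sum_le_sum fun i _ => ?_)
    exact natDegree_pow_le_of_le _ (natDegree_dpWitt_coeff p i)

lemma coeff_prod_dpWitt (e : ℕ → ℕ) (N : ℕ) :
    (∏ i ∈ Finset.range N, ((dpWitt p).coeff i : ℚ[X]) ^ e i).coeff (digitSum p e N) =
      ∏ i ∈ Finset.range N, dpLead p i ^ e i := by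
  induction N with
  | zero => simp [digitSum]
  | succ N ih =>
    rw [Finset.prod_range_succ, digitSum, Finset.sum_range_succ, coeff_mul_add_eq_of_natDegree_le,
      Finset.prod_range_succ, ← ih, coeff_pow_of_natDegree_le (natDegree_dpWitt_coeff p N)]
    · rfl
    · refine (natDegree_prod_le _ _).trans (Finset.sum_le_sum fun i _ => ?_)
      exact natDegree_pow_le_of_le _ (natDegree_dpWitt_coeff p i)
    · exact natDegree_pow_le_of_le _ (natDegree_dpWitt_coeff p N)

lemma not_dvd_dpCoord_prod {e : ℕ → ℕ} (he : ∀ i, e i < p) (N : ℕ) :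
    ¬ (p : ℤ) ∣ dpCoord (∏ i ∈ Finset.range N, (dpWitt p).coeff i ^ e i) (digitSum p e N) := by
  refine not_dvd_factorial_digitSum_mul p he N _ ?_
  rw [dpCoord_spec, ← coeff_prod_dpWitt]
  push_cast
  rfl

end Leading

/-! ### Characters of the Frobenius kernels -/

section RingChar

variable (p : ℕ) [hp : Fact p.Prime] (n : ℕ)

/-- The kernel of `F^n` on the multiplicative monoid of `W(T)`. -/
def frobKer (T : Type*) [CommRing T] : Submonoid (WittVector p T) :=
  MonoidHom.mker ((WittVector.frobenius ^ n : WittVector p T →+* WittVector p T) :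
    WittVector p T →* WittVector p T)

variable {p n} {R S T : Type*} [CommRing R] [CommRing S] [CommRing T]

lemma mem_frobKer {u : WittVector p T} :
    u ∈ frobKer p n T ↔ (WittVector.frobenius ^ n : WittVector p T →+* WittVector p T) u = 1 := Iff.rfl

lemma frobenius_pow_succ_apply (n : ℕ) (u : WittVector p T) :
    (WittVector.frobenius ^ (n + 1) : WittVector p T →+* WittVector p T) u =
      (WittVector.frobenius ^ n : WittVector p T →+* WittVector p T) (WittVector.frobenius u) := by
  rw [pow_succ]
  rfl

lemma frobenius_pow_map (f : S →+* T) (n : ℕ) (u : WittVector p S) :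
    (WittVector.frobenius ^ n : WittVector p T →+* WittVector p T) (WittVector.map f u) =
      WittVector.map f ((WittVector.frobenius ^ n : WittVector p S →+* WittVector p S) u) := by
  induction n generalizing u with
  | zero => rfl
  | succ n ih => rw [frobenius_pow_succ_apply, frobenius_pow_succ_apply, frobenius_map, ih]

lemma map_mem_frobKer (f : S →+* T) {u : WittVector p S} (hu : u ∈ frobKer p n S) :
    WittVector.map f u ∈ frobKer p n T := by
  rw [mem_frobKer] at hu ⊢
  rw [frobenius_pow_map, hu, map_one]

lemma mem_frobKer_succ {u : WittVector p T} :
    u ∈ frobKer p (n + 1) T ↔ WittVector.frobenius u ∈ frobKer p n T := by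
  rw [mem_frobKer, mem_frobKer, frobenius_pow_succ_apply]

lemma mem_frobKer_one {u : WittVector p T} : u ∈ frobKer p 1 T ↔ WittVector.frobenius u = 1 := by
  rw [mem_frobKer, pow_one]

lemma mem_frobKer_succ_of_frobenius_eq_one {u : WittVector p T} (hu : WittVector.frobenius u = 1) :
    u ∈ frobKer p (n + 1) T := by
  rw [mem_frobKer_succ, hu]
  exact one_mem _

lemma isUnit_of_mem_frobKer {k : ℕ} (hk : (p : T) ^ k = 0) {u : WittVector p T}
    (hu : u ∈ frobKer p n T) : IsUnit u := by
  induction n generalizing u with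
  | zero =>
    rw [show u = 1 from hu]
    exact isUnit_one
  | succ n ih => exact isUnit_of_isUnit_frobenius hk (ih (mem_frobKer_succ.1 hu))

omit hp in
lemma natCast_pow_eq_zero_of_ringHom {k : ℕ} (hk : (p : R) ^ k = 0) (f : R →+* T) :
    (p : T) ^ k = 0 := by
  rw [← map_natCast f, ← map_pow, hk, map_zero]

variable (p n) in
/-- A character over `R` of the group scheme `W^×[F^n]`: a natural family of homomorphisms
`W^×[F^n](T) → T`, one for each ring homomorphism `R → T`. -/
structure RingChar (R : Type u) [CommRing R] where
  /-- The homomorphism at an `R`-algebra `T`. -/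
  app : ∀ {T : Type u} [CommRing T], (R →+* T) → (frobKer p n T →* T)
  map_app : ∀ {S T : Type u} [CommRing S] [CommRing T] (f : R →+* S) (g : S →+* T)
    (x : frobKer p n S), g (app f x) = app (g.comp f) ⟨WittVector.map g x, map_mem_frobKer g x.2⟩

namespace RingChar

variable {R S T : Type u} [CommRing R] [CommRing S] [CommRing T]

instance : Mul (RingChar p n R) := ⟨fun a b =>
  { app := fun f => a.app f * b.app f
    map_app := fun f g x => by
      rw [MonoidHom.mul_apply, MonoidHom.mul_apply, map_mul, a.map_app, b.map_app] }⟩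

lemma mul_app (a b : RingChar p n R) (f : R →+* T) (x : frobKer p n T) :
    (a * b).app f x = a.app f x * b.app f x := rfl

lemma app_congr (a : RingChar p n R) {f g : R →+* T} (h : f = g) {x y : frobKer p n T}
    (hxy : (x : WittVector p T) = y) : a.app f x = a.app g y := by
  rw [h, Subtype.ext hxy]

lemma app_eq_one_of_eq_one (a : RingChar p n R) (f : R →+* T) {x : frobKer p n T}
    (hx : (x : WittVector p T) = 1) : a.app f x = 1 := by
  rw [show x = 1 from Subtype.ext hx, map_one]

lemma app_map (a : RingChar p n R) (f : R →+* S) (g : S →+* T) {h : R →+* T} (hgf : g.comp f = h)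
    (x : frobKer p n S) (y : frobKer p n T) (hxy : WittVector.map g x = (y : WittVector p T)) :
    a.app h y = g (a.app f x) := by
  subst hgf
  rw [a.map_app]
  exact a.app_congr rfl hxy.symm

/-- Restriction of characters to the kernel of `F`. -/
def restrictOne (a : RingChar p (n + 1) R) : RingChar p 1 R where
  app f := (a.app f).comp (Submonoid.inclusion fun _ hu =>
    mem_frobKer_succ_of_frobenius_eq_one (mem_frobKer_one.1 hu))
  map_app f g _ := a.map_app f g _

lemma restrictOne_app (a : RingChar p (n + 1) R) (f : R →+* T) (x : frobKer p 1 T) :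
    a.restrictOne.app f x =
      a.app f ⟨x, mem_frobKer_succ_of_frobenius_eq_one (mem_frobKer_one.1 x.2)⟩ := rfl

/-- The Frobenius `W^×[F^(n+1)] → W^×[F^n]`. -/
def frobKerFrobenius (n : ℕ) (T : Type*) [CommRing T] : frobKer p (n + 1) T →* frobKer p n T where
  toFun x := ⟨WittVector.frobenius (x : WittVector p T), mem_frobKer_succ.1 x.2⟩
  map_one' := Subtype.ext (map_one _)
  map_mul' _ _ := Subtype.ext (map_mul _ _ _)

/-- Pullback of characters along `F : W^×[F^(n+1)] → W^×[F^n]`. -/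
def pullback (a : RingChar p n R) : RingChar p (n + 1) R where
  app {T} _ f := (a.app f).comp (frobKerFrobenius n T)
  map_app {S T} _ _ f g x := by
    rw [MonoidHom.comp_apply, MonoidHom.comp_apply, a.map_app]
    exact a.app_congr rfl (frobenius_map g (x : WittVector p S)).symm

lemma pullback_app (a : RingChar p n R) (f : R →+* T) (x : frobKer p (n + 1) T) :
    a.pullback.app f x = a.app f (frobKerFrobenius n T x) := rfl

/-! #### Descent along the Frobenius -/

/-- The quotient x / y lies in W^×[F], where the character is trivial. -/
lemma app_eq_of_frobenius_eq (a : RingChar p (n + 1) R) {k : ℕ} (hk : (p : R) ^ k = 0)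
    (ha : ∀ (T : Type u) [CommRing T] (f : R →+* T) (x : frobKer p 1 T),
      a.restrictOne.app f x = 1) (f : R →+* T) (x y : frobKer p (n + 1) T)
    (h : WittVector.frobenius (x : WittVector p T) = WittVector.frobenius (y : WittVector p T)) :
    a.app f x = a.app f y := by
  obtain ⟨y', hy'⟩ := (isUnit_of_mem_frobKer (natCast_pow_eq_zero_of_ringHom hk f) y.2).exists_right_inv
  have hw : WittVector.frobenius ((x : WittVector p T) * y') = 1 := by
    rw [map_mul, h, ← map_mul, hy', map_one]
  have hx : x = ⟨(x : WittVector p T) * y', mem_frobKer_succ_of_frobenius_eq_one hw⟩ * y := by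
    apply Subtype.ext
    change (x : WittVector p T) = x * y' * y
    rw [mul_assoc, mul_comm y', hy', mul_one]
  have h1 := ha T f ⟨(x : WittVector p T) * y', mem_frobKer_one.2 hw⟩
  rw [restrictOne_app] at h1
  rw [hx, map_mul, h1, one_mul]

lemma frobCoverPoint_mem {v : WittVector p T} (hv : v ∈ frobKer p n T) :
    frobCoverPoint v ∈ frobKer p (n + 1) (FrobCover v) := by
  rw [mem_frobKer_succ, frobenius_frobCoverPoint]
  exact map_mem_frobKer _ hv

lemma map_app_frobCoverPoint_eq (a : RingChar p (n + 1) R) {k : ℕ} (hk : (p : R) ^ k = 0)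
    (ha : ∀ (T : Type u) [CommRing T] (f : R →+* T) (x : frobKer p 1 T),
      a.restrictOne.app f x = 1) (f : R →+* T) (v : frobKer p n T) {B : Type u} [CommRing B]
    (i j : FrobCover (v : WittVector p T) →+* B)
    (hij : i.comp (algebraMap T _) = j.comp (algebraMap T _)) :
    i (a.app ((algebraMap T _).comp f) ⟨_, frobCoverPoint_mem v.2⟩) =
      j (a.app ((algebraMap T _).comp f) ⟨_, frobCoverPoint_mem v.2⟩) := by
  rw [a.map_app, a.map_app, a.app_congr (show i.comp ((algebraMap T _).comp f) =
    j.comp ((algebraMap T _).comp f) by rw [← RingHom.comp_assoc, hij, RingHom.comp_assoc]) rfl]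
  refine a.app_eq_of_frobenius_eq hk ha _ _ _ ?_
  rw [frobenius_map, frobenius_map, frobenius_frobCoverPoint, map_map, map_map, hij]

-- The value at the tautological preimage of v has equal images under the two maps to the tensor
-- square of the cover, because the two preimages there have the same Frobenius. So it comes from an
-- element s of T, and universality of the cover makes s serve every other preimage.
open TensorProduct in
lemma exists_descent (a : RingChar p (n + 1) R) {k : ℕ} (hk : (p : R) ^ k = 0)
    (ha : ∀ (T : Type u) [CommRing T] (f : R →+* T) (x : frobKer p 1 T),
      a.restrictOne.app f x = 1) (f : R →+* T) (v : frobKer p n T) :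
    ∃ s : T, ∀ (T' : Type u) [CommRing T'] (g : T →+* T') (u : frobKer p (n + 1) T'),
      WittVector.frobenius (u : WittVector p T') = WittVector.map g v → a.app (g.comp f) u = g s := by
  have hkT := natCast_pow_eq_zero_of_ringHom hk f
  set P : frobKer p (n + 1) (FrobCover (v : WittVector p T)) := ⟨_, frobCoverPoint_mem v.2⟩ with hP
  set y := a.app ((algebraMap T (FrobCover (v : WittVector p T))).comp f) P with hy
  let i : FrobCover (v : WittVector p T) →ₐ[T]
    FrobCover (v : WittVector p T) ⊗[T] FrobCover (v : WittVector p T) :=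
    Algebra.TensorProduct.includeLeft
  let j : FrobCover (v : WittVector p T) →ₐ[T]
    FrobCover (v : WittVector p T) ⊗[T] FrobCover (v : WittVector p T) :=
    Algebra.TensorProduct.includeRight
  have hij := a.map_app_frobCoverPoint_eq hk ha f v
    (B := FrobCover (v : WittVector p T) ⊗[T] FrobCover (v : WittVector p T))
    i.toRingHom j.toRingHom
    (RingHom.ext fun t => (i.commutes t).trans (j.commutes t).symm)
  obtain ⟨s, hs⟩ := exists_algebraMap_of_tmul_eq (v : WittVector p T) hkT y hij
  refine ⟨s, fun T' _ g u hu => ?_⟩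
  obtain ⟨h, rfl, h2⟩ := exists_frobCover_lift (v : WittVector p T) g (u : WittVector p T') hu
  rw [a.app_map ((algebraMap T (FrobCover (v : WittVector p T))).comp f) h (RingHom.comp_assoc _ _ _).symm P u h2,
    ← hy, ← hs]
  rfl

/-- A character of `W^×[F^(n+1)]` which is trivial on `W^×[F]` comes from `W^×[F^n]`. -/
lemma exists_pullback_eq (a : RingChar p (n + 1) R) {k : ℕ} (hk : (p : R) ^ k = 0)
    (ha : ∀ (T : Type u) [CommRing T] (f : R →+* T) (x : frobKer p 1 T),
      a.restrictOne.app f x = 1) :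
    ∃ b : RingChar p n R, ∀ (T : Type u) [CommRing T] (f : R →+* T) (x : frobKer p (n + 1) T),
      a.app f x = b.pullback.app f x := by
  choose s hs using fun (T : Type u) [CommRing T] (f : R →+* T) (v : frobKer p n T) =>
    a.exists_descent hk ha f v
  refine ⟨{
    app := fun {T} _ f =>
      { toFun := s T f
        map_one' := ?_
        map_mul' := fun v w => ?_ }
    map_app := fun {S T} _ _ f g x => ?_ }, fun T _ f x => ?_⟩
  · have := hs T f 1 T (RingHom.id T) 1 (by simp)
    rw [map_one] at this
    exact this.symm
  · have hkT := natCast_pow_eq_zero_of_ringHom hk f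
    -- Multiplicativity is checked after adjoining preimages of v and then of w, which is an
    -- injective base change.
    let A := FrobCover (v : WittVector p T)
    let w' : frobKer p n A := ⟨WittVector.map (algebraMap T A) w, map_mem_frobKer _ w.2⟩
    let B := FrobCover (w' : WittVector p A)
    let i : T →+* A := algebraMap T A
    let j : A →+* B := algebraMap A B
    let P : frobKer p (n + 1) B := ⟨WittVector.map j (frobCoverPoint (v : WittVector p T)),
      map_mem_frobKer _ (frobCoverPoint_mem v.2)⟩
    let Q : frobKer p (n + 1) B := ⟨frobCoverPoint (w' : WittVector p A), frobCoverPoint_mem w'.2⟩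
    have hPv : WittVector.frobenius (P : WittVector p B) = WittVector.map (j.comp i) v := by
      change WittVector.frobenius (WittVector.map j _) = _
      rw [frobenius_map, frobenius_frobCoverPoint, map_map]
    have hQw : WittVector.frobenius (Q : WittVector p B) = WittVector.map (j.comp i) w := by
      rw [← map_map]
      exact frobenius_frobCoverPoint _
    have h1 := hs T f v B (j.comp i) P hPv
    have h2 := hs T f w B (j.comp i) Q hQw
    have h3 := hs T f (v * w) B (j.comp i) (P * Q) (by
      rw [Submonoid.coe_mul, Submonoid.coe_mul, map_mul, map_mul, hPv, hQw])
    have hinj : Function.Injective (j.comp i) :=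
      (algebraMap_frobCover_injective (w' : WittVector p A)
        (natCast_pow_eq_zero_of_ringHom hkT i)).comp
        (algebraMap_frobCover_injective (v : WittVector p T) hkT)
    apply hinj
    rw [map_mul, ← h1, ← h2, ← h3, map_mul]
  · have hkT := natCast_pow_eq_zero_of_ringHom hk (g.comp f)
    let y : frobKer p n T := ⟨WittVector.map g x, map_mem_frobKer g x.2⟩
    apply algebraMap_frobCover_injective (y : WittVector p T) hkT
    have h1 := hs T (g.comp f) y _ (algebraMap T (FrobCover (y : WittVector p T)))
      ⟨_, frobCoverPoint_mem y.2⟩ (frobenius_frobCoverPoint _)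
    have h2 := hs S f x _ ((algebraMap T (FrobCover (y : WittVector p T))).comp g)
      ⟨_, frobCoverPoint_mem y.2⟩ ((frobenius_frobCoverPoint _).trans (map_map _ _ _))
    exact h2.symm.trans h1
  · exact hs T f ⟨WittVector.frobenius (x : WittVector p T), mem_frobKer_succ.1 x.2⟩ T (RingHom.id T) x (by
      ext i
      simp)

end RingChar

end RingChar

/-! ### Dual numbers -/

section Dual

open TrivSqZeroExt

variable {A B : Type*} [CommRing A] [CommRing B]

/-- The ring homomorphism `a ↦ i(a) + D(a) ε` attached to a derivation. -/
def leibnizHom (i : A →+* B) (D : A → B) (hadd : ∀ a b, D (a + b) = D a + D b)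
    (hD : ∀ a b, D (a * b) = D a * i b + i a * D b) :
    A →+* DualNumber B where
  toFun a := inl (i a) + inr (D a)
  map_zero' := by
    have h := hadd 0 0
    rw [add_zero, left_eq_add] at h
    simp [h]
  map_one' := by
    have h := hD 1 1
    rw [mul_one, map_one, mul_one, one_mul, left_eq_add] at h
    simp [h]
  map_add' a b := by
    ext <;> simp [hadd]
  map_mul' a b := by
    ext
    · simp
    · simp [hD, mul_comm, add_comm]

variable (i : A →+* B) (D : A → B) (hadd : ∀ a b, D (a + b) = D a + D b)
  (hD : ∀ a b, D (a * b) = D a * i b + i a * D b)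

@[simp] lemma fst_leibnizHom (a : A) : (leibnizHom i D hadd hD a).fst = i a := by
  simp [leibnizHom]

@[simp] lemma snd_leibnizHom (a : A) : (leibnizHom i D hadd hD a).snd = D a := by
  simp [leibnizHom]

/-- The ring homomorphism `a + b ε ↦ g(a) + g(b) ε`. -/
def dualMap (g : A →+* B) : DualNumber A →+* DualNumber B where
  toFun x := inl (g x.fst) + inr (g x.snd)
  map_zero' := by simp
  map_one' := by simp
  map_add' a b := by
    ext <;> simp
  map_mul' a b := by
    ext <;> simp

@[simp] lemma fst_dualMap (g : A →+* B) (x : DualNumber A) : (dualMap g x).fst = g x.fst := by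
  simp [dualMap]

@[simp] lemma snd_dualMap (g : A →+* B) (x : DualNumber A) : (dualMap g x).snd = g x.snd := by
  simp [dualMap]

/-- The reduction `a + b ε ↦ a`. -/
def dualFst (A : Type*) [CommRing A] : DualNumber A →+* A where
  toFun := fst
  map_zero' := rfl
  map_one' := rfl
  map_add' _ _ := rfl
  map_mul' _ _ := rfl

lemma dualFst_apply (x : DualNumber A) : dualFst A x = x.fst := rfl

/-- The inclusion `A → A[ε]`. -/
def dualInl (A : Type*) [CommRing A] : A →+* DualNumber A := inlHom A A

@[simp] lemma fst_dualInl (a : A) : (dualInl A a).fst = a := rfl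

@[simp] lemma snd_dualInl (a : A) : (dualInl A a).snd = 0 := rfl

end Dual

/-! ### The tangent direction of W^×[F] at the identity -/

section Tangent

open TrivSqZeroExt

variable (p : ℕ) [hp : Fact p.Prime]

/-- The homomorphism from `dpRing` to dual numbers given by `X ↦ ε`. -/
def dpDual (A : Type*) [CommRing A] : dpRing →+* DualNumber A :=
  leibnizHom ((Int.castRingHom A).comp dpAug) (fun f => (dpCoord f 1 : A))
    (fun a b => by rw [map_add, Finsupp.add_apply, Int.cast_add]) fun a b => by
    -- The coordinate of index 1 is the augmentation of `dpDeriv`, so it inherits the Leibniz rule.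
    have h1 := dpCoord_dpDeriv (a * b) 0
    have h2 := dpCoord_dpDeriv a 0
    have h3 := dpCoord_dpDeriv b 0
    rw [Nat.cast_zero, zero_mul, add_zero, zero_add] at h1 h2 h3
    have h : dpCoord (a * b) 1 = dpCoord a 1 * dpAug b + dpAug a * dpCoord b 1 := by
      rw [← h1, ← h2, ← h3, dpDeriv_mul, ← dpAug_apply, map_add, map_mul, map_mul]
      rfl
    rw [h]
    push_cast
    rfl

lemma fst_dpDual (A : Type*) [CommRing A] (f : dpRing) : (dpDual A f).fst = (dpCoord f 0 : A) :=
  fst_leibnizHom _ _ _ _ _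

lemma snd_dpDual (A : Type*) [CommRing A] (f : dpRing) : (dpDual A f).snd = (dpCoord f 1 : A) :=
  snd_leibnizHom _ _ _ _ _

/-- The point of `W^×[F]` over the dual numbers with ghost components `(1 + ε, 1, 1, …)`. -/
def tangentPoint (A : Type*) [CommRing A] : frobKer p 1 (DualNumber A) :=
  ⟨WittVector.map (dpDual A) (dpWitt p), by
    rw [mem_frobKer_one, frobenius_map, frobenius_dpWitt, map_one]⟩

lemma coe_tangentPoint (A : Type*) [CommRing A] :
    (tangentPoint p A : WittVector p (DualNumber A)) = WittVector.map (dpDual A) (dpWitt p) := rfl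

lemma map_dualMap_tangentPoint {A B : Type*} [CommRing A] [CommRing B] (g : A →+* B) :
    WittVector.map (dualMap g) (tangentPoint p A) =
      (tangentPoint p B : WittVector p (DualNumber B)) := by
  rw [coe_tangentPoint, map_map, coe_tangentPoint]
  congr 2
  refine RingHom.ext fun f => ?_
  rw [RingHom.comp_apply]
  ext <;> simp [fst_dpDual, snd_dpDual]

lemma map_dualFst_tangentPoint (A : Type*) [CommRing A] :
    WittVector.map (dualFst A) (tangentPoint p A : WittVector p (DualNumber A)) = 1 := by
  have h : (dualFst A).comp (dpDual A) = (Int.castRingHom A).comp dpAug := RingHom.ext fun f => by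
    rw [RingHom.comp_apply, dualFst_apply, fst_dpDual]
    rfl
  rw [coe_tangentPoint, map_map, h, ← map_map, map_dpAug_dpWitt, map_one]

end Tangent

/-! ### The divided power algebra over a general base -/

section BaseChange

open TensorProduct TrivSqZeroExt

variable (p : ℕ) [hp : Fact p.Prime] (R : Type*) [CommRing R]

/-- The divided power algebra in one variable over `R`. -/
abbrev DPAlg : Type _ := R ⊗[ℤ] dpRing

/-- The inclusion of `dpRing`. -/
def dpIncl : dpRing →+* DPAlg R := (Algebra.TensorProduct.includeRight (R := ℤ)).toRingHom

lemma dpIncl_apply (f : dpRing) : dpIncl R f = 1 ⊗ₜ f := rfl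

/-- The basis of divided powers. -/
def dpAlgBasis : Module.Basis ℕ R (DPAlg R) := Algebra.TensorProduct.basis R dpBasis

lemma dpAlgBasis_repr_tmul (r : R) (f : dpRing) (i : ℕ) :
    (dpAlgBasis R).repr (r ⊗ₜ f) i = r * (dpCoord f i : R) := by
  rw [dpAlgBasis, Algebra.TensorProduct.basis_repr_tmul]
  simp [dpBasis_repr]

/-- The derivation `(1 + X) d/dX` of the divided power algebra. -/
def dpAlgDeriv : DPAlg R →ₗ[R] DPAlg R := dpDeriv.baseChange R

lemma dpAlgDeriv_mul (a b : DPAlg R) :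
    dpAlgDeriv R (a * b) = dpAlgDeriv R a * b + a * dpAlgDeriv R b := by
  induction a using TensorProduct.induction_on with
  | zero => simp
  | add a a' ha ha' => rw [add_mul, map_add, ha, ha', map_add]; ring
  | tmul r f =>
    induction b using TensorProduct.induction_on with
    | zero => simp
    | add b b' hb hb' => rw [mul_add, map_add, hb, hb', map_add]; ring
    | tmul s g => simp [dpAlgDeriv, dpDeriv_mul, TensorProduct.tmul_add]

lemma dpAlgBasis_repr_deriv (a : DPAlg R) (i : ℕ) : (dpAlgBasis R).repr (dpAlgDeriv R a) i =
    (dpAlgBasis R).repr a (i + 1) + i * (dpAlgBasis R).repr a i := by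
  induction a using TensorProduct.induction_on with
  | zero => simp
  | add a a' ha ha' =>
    rw [map_add, map_add, Finsupp.add_apply, ha, ha',
      map_add (dpAlgBasis R).repr, Finsupp.add_apply, Finsupp.add_apply]
    ring
  | tmul r f =>
    rw [dpAlgDeriv, LinearMap.baseChange_tmul, dpAlgBasis_repr_tmul, dpAlgBasis_repr_tmul,
      dpAlgBasis_repr_tmul, dpCoord_dpDeriv]
    push_cast
    ring

/-- The homomorphism `a ↦ a + (1 + X) a' ε`. -/
def dpShift : DPAlg R →+* DualNumber (DPAlg R) :=
  leibnizHom (RingHom.id _) (dpAlgDeriv R) (map_add _) (dpAlgDeriv_mul R)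

lemma dpShift_comp_algebraMap : (dpShift R).comp (algebraMap R (DPAlg R)) =
    (dualInl (DPAlg R)).comp (algebraMap R (DPAlg R)) := by
  refine RingHom.ext fun r => ?_
  rw [RingHom.comp_apply, RingHom.comp_apply]
  have h : dpDeriv 1 = 0 := by
    have := dpDeriv_mul 1 1
    rwa [mul_one, mul_one, one_mul, left_eq_add] at this
  refine TrivSqZeroExt.ext ?_ ?_
  · simp [dpShift]
  · rw [dpShift, snd_leibnizHom, snd_dualInl, Algebra.TensorProduct.algebraMap_apply]
    change dpAlgDeriv R _ = _
    rw [dpAlgDeriv, LinearMap.baseChange_tmul, h, tmul_zero]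

/-- The tautological point of `W^×[F]` over the divided power algebra. -/
def dpPoint : frobKer p 1 (DPAlg R) :=
  ⟨WittVector.map (dpIncl R) (dpWitt p), by
    rw [mem_frobKer_one, frobenius_map, frobenius_dpWitt, map_one]⟩

lemma coe_dpPoint :
    (dpPoint p R : WittVector p (DPAlg R)) = WittVector.map (dpIncl R) (dpWitt p) := rfl

/-- The homomorphism `f ↦ f + (1 + X) f' ε` on `dpRing`. -/
def dpRingShift : dpRing →+* DualNumber dpRing :=
  leibnizHom (RingHom.id _) dpDeriv (map_add _) dpDeriv_mul

lemma isLeftRegular_dual {A : Type*} [CommRing A] {a : A} (ha : IsLeftRegular a) :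
    IsLeftRegular (dualInl A a) := by
  intro x y hxy
  ext
  · exact ha (by simpa using congrArg fst hxy)
  · exact ha (by simpa using congrArg snd hxy)

/-- The shift multiplies 1 + X by 1 + ε, and both sides have ghost components ((1 + X)(1 + ε), 1, 1,
…). -/
lemma map_dpRingShift_dpWitt : WittVector.map dpRingShift (dpWitt p) =
    WittVector.map (dualInl dpRing) (dpWitt p) * WittVector.map (dpDual dpRing) (dpWitt p) := by
  have hreg : IsLeftRegular (p : DualNumber dpRing) := by
    rw [← map_natCast (dualInl dpRing)]
    exact isLeftRegular_dual (isLeftRegular_dpRing p)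
  refine eq_of_ghostComponent_eq hreg fun n => ?_
  rw [map_mul, ghostComponent_map, ghostComponent_map, ghostComponent_map, ghostComponent_dpWitt]
  split_ifs with h
  · have h1 : dpCoord (1 + dpGamma 1) 0 = 1 := dpAug_one_add
    have h2 : dpCoord (1 + dpGamma 1) 1 = 1 := by
      have h3 : dpCoord (1 : dpRing) 1 = 0 := by
        have := dpCoord_spec 1 1
        simp [Polynomial.coeff_one] at this
        exact_mod_cast this
      rw [map_add, Finsupp.add_apply, h3, dpCoord_gamma]
      simp
    have h4 : dpDeriv (1 + dpGamma 1) = 1 + dpGamma 1 := by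
      apply Subtype.ext
      rw [coe_dpDeriv]
      simp [dpGamma, Polynomial.monomial_one_one_eq_X]
    refine TrivSqZeroExt.ext ?_ ?_
    · rw [fst_mul, dpRingShift, fst_leibnizHom, fst_dualInl, fst_dpDual, h1]
      simp
    · rw [snd_mul, dpRingShift, snd_leibnizHom]
      change _ = (dualInl dpRing _).fst • _ + _
      rw [fst_dualInl, snd_dualInl, snd_dpDual, h2]
      rw [h4]
      simp
  · simp

lemma map_dpShift_dpPoint : WittVector.map (dpShift R) (dpPoint p R) =
    WittVector.map (dualInl (DPAlg R)) (dpPoint p R) *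
      (tangentPoint p (DPAlg R) : WittVector p (DualNumber (DPAlg R))) := by
  have h := congrArg
    (WittVector.map (S := DualNumber (DPAlg R)) (dualMap (dpIncl R))) (map_dpRingShift_dpWitt p)
  rw [map_mul, map_map, map_map, map_map] at h
  rw [coe_dpPoint, map_map, map_map, coe_tangentPoint]
  convert h using 3
  · refine RingHom.ext fun f => ?_
    rw [RingHom.comp_apply, RingHom.comp_apply]
    refine TrivSqZeroExt.ext ?_ ?_
    · simp [dpShift, dpRingShift]
    · rw [dpShift, snd_leibnizHom, snd_dualMap, dpRingShift, snd_leibnizHom, dpIncl_apply]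
      change dpAlgDeriv R _ = _
      rw [dpAlgDeriv, LinearMap.baseChange_tmul]
      rfl
  · refine congrArg WittVector.map (RingHom.ext fun f => ?_)
    rw [RingHom.comp_apply, RingHom.comp_apply]
    refine TrivSqZeroExt.ext ?_ ?_ <;> simp
  · refine congrArg WittVector.map (RingHom.ext fun f => ?_)
    rw [RingHom.comp_apply]
    refine TrivSqZeroExt.ext ?_ ?_ <;> simp [fst_dpDual, snd_dpDual]

/-- The augmentation of the divided power algebra. -/
def dpAlgAug : DPAlg R →+* R :=
  (Algebra.TensorProduct.lift (AlgHom.id ℤ R) (Algebra.ofId ℤ R |>.comp dpAug.toIntAlgHom)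
    fun _ _ => Commute.all _ _).toRingHom

lemma dpAlgAug_tmul (r : R) (f : dpRing) : dpAlgAug R (r ⊗ₜ f) = r * (dpCoord f 0 : R) := by
  simp [dpAlgAug, dpAug_apply]

lemma dpAlgBasis_repr_zero (a : DPAlg R) : (dpAlgBasis R).repr a 0 = dpAlgAug R a := by
  induction a using TensorProduct.induction_on with
  | zero => simp
  | add a b ha hb => rw [map_add, Finsupp.add_apply, ha, hb, map_add]
  | tmul r f => rw [dpAlgBasis_repr_tmul, dpAlgAug_tmul]

lemma map_dpAlgAug_dpPoint : WittVector.map (dpAlgAug R) (dpPoint p R : WittVector p (DPAlg R)) = 1 := by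
  have h : (dpAlgAug R).comp (dpIncl R) = (Int.castRingHom R).comp dpAug :=
    RingHom.ext fun f => by
      rw [RingHom.comp_apply, dpIncl_apply, dpAlgAug_tmul, one_mul]
      rfl
  rw [coe_dpPoint, map_map, h, ← map_map, map_dpAug_dpWitt, map_one]

end BaseChange

/-! ### Characters of `W^×[F]` -/

section CoverEmbedding

open TensorProduct

variable (p : ℕ) [hp : Fact p.Prime]

omit hp in
lemma digitSum_eq_finsupp_sum (e : ℕ →₀ ℕ) {N : ℕ} (hN : e.support ⊆ Finset.range N) :
    digitSum p e N = e.sum fun i m => m * p ^ i :=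
  (Finsupp.sum_of_support_subset e hN (fun i m => m * p ^ i) fun _ _ => zero_mul _).symm

lemma exists_support_subset_range (e : ℕ →₀ ℕ) : ∃ N, ∀ M, N ≤ M → e.support ⊆ Finset.range M :=
  ⟨e.support.sup id + 1, fun _ hM _ hi => Finset.mem_range.2
    ((Nat.lt_succ_of_le (Finset.le_sup (f := id) hi)).trans_le hM)⟩

lemma smallExponent_sum_injective :
    Function.Injective fun e : SmallExponent p => e.1.sum fun i m => m * p ^ i := by
  intro e e' h
  obtain ⟨N, hN⟩ := exists_support_subset_range e.1
  obtain ⟨N', hN'⟩ := exists_support_subset_range e'.1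
  have h1 := hN _ (le_max_left N N')
  have h2 := hN' _ (le_max_right N N')
  dsimp only at h
  rw [← digitSum_eq_finsupp_sum p e.1 h1, ← digitSum_eq_finsupp_sum p e'.1 h2] at h
  apply Subtype.ext
  ext i
  by_cases hi : i < max N N'
  · exact eq_of_digitSum_eq p e.2 e'.2 _ h i hi
  · rw [Finsupp.notMem_support_iff.1 fun h => hi (Finset.mem_range.1 (h1 h)),
      Finsupp.notMem_support_iff.1 fun h => hi (Finset.mem_range.1 (h2 h))]

variable {R : Type*} [CommRing R] {k : ℕ}

omit hp in
lemma isUnit_intCast_of_not_dvd (hk : (p : R) ^ k = 0) (hp' : Prime (p : ℤ)) {z : ℤ}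
    (hz : ¬ (p : ℤ) ∣ z) : IsUnit (z : R) := by
  obtain ⟨a, b, hab⟩ := ((Prime.coprime_iff_not_dvd hp').2 hz).pow_left (m := k)
  have h := congrArg (Int.cast (R := R)) hab
  push_cast at h
  rw [hk, mul_zero, zero_add] at h
  exact IsUnit.of_mul_eq_one_right _ h

/-- The universal cover of the trivial Witt vector embeds into the divided power algebra. -/
lemma exists_frobCover_one_embedding (hk : (p : R) ^ k = 0) :
    ∃ f : FrobCover (1 : WittVector p R) →+* DPAlg R, Function.Injective f ∧
      f.comp (algebraMap R _) = algebraMap R (DPAlg R) ∧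
      WittVector.map f (frobCoverPoint 1) = (dpPoint p R : WittVector p (DPAlg R)) := by
  obtain ⟨f, hf1, hf2⟩ := exists_frobCover_lift (1 : WittVector p R) (algebraMap R (DPAlg R))
    (dpPoint p R : WittVector p (DPAlg R)) (by
      rw [map_one]
      exact mem_frobKer_one.1 (dpPoint p R).2)
  refine ⟨f, ?_, hf1, hf2⟩
  set b := frobCoverBasis (1 : WittVector p R) hk
  have hX : ∀ i, f (Ideal.Quotient.mk _ (MvPolynomial.X i)) = dpIncl R ((dpWitt p).coeff i) := by
    intro i
    have := congrArg (fun w => w.coeff i) hf2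
    rw [coe_dpPoint] at this
    simpa [WittVector.map_coeff, frobCoverPoint] using this
  have hb : ∀ (e : SmallExponent p) (N : ℕ), e.1.support ⊆ Finset.range N →
      f (b e) = dpIncl R (∏ i ∈ Finset.range N, (dpWitt p).coeff i ^ e.1 i) := by
    intro e N hN
    rw [frobCoverBasis_apply, MvPolynomial.monomial_eq, map_one, one_mul,
      Finsupp.prod_of_support_subset e.1 hN _ fun i _ => pow_zero _, map_prod, map_prod, map_prod]
    refine Finset.prod_congr rfl fun i _ => ?_
    rw [map_pow, map_pow, hX, map_pow]
  have hsmul : ∀ (r : R) (a : FrobCover (1 : WittVector p R)), f (r • a) = r • f a := by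
    intro r a
    rw [show r • a = algebraMap R (FrobCover (1 : WittVector p R)) r * a from
      Algebra.smul_def r a, show r • f a = algebraMap R (DPAlg R) r * f a from
      Algebra.smul_def r (f a), map_mul, ← hf1]
    rfl
  let D : SmallExponent p → ℕ := fun e => e.1.sum fun i m => m * p ^ i
  have hrepr : ∀ (e : SmallExponent p) (j N : ℕ), e.1.support ⊆ Finset.range N →
      (dpAlgBasis R).repr (f (b e)) j =
        ((dpCoord (∏ i ∈ Finset.range N, (dpWitt p).coeff i ^ e.1 i) j : ℤ) : R) := by
    intro e j N hN
    rw [hb e N hN, dpIncl_apply, dpAlgBasis_repr_tmul, one_mul]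
  have hlt : ∀ (e : SmallExponent p) (j : ℕ), D e < j →
      (dpAlgBasis R).repr (f (b e)) j = 0 := by
    intro e j hj
    obtain ⟨N, hN⟩ := exists_support_subset_range e.1
    have hN := hN N le_rfl
    rw [hrepr e j N hN, dpCoord_prod_of_lt p N (by rwa [digitSum_eq_finsupp_sum p e.1 hN]),
      Int.cast_zero]
  have hunit : ∀ e : SmallExponent p, IsUnit ((dpAlgBasis R).repr (f (b e)) (D e)) := by
    intro e
    obtain ⟨N, hN⟩ := exists_support_subset_range e.1
    have hN := hN N le_rfl
    rw [hrepr e _ N hN]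
    have := not_dvd_dpCoord_prod p e.2 N
    rw [digitSum_eq_finsupp_sum p e.1 hN] at this
    exact isUnit_intCast_of_not_dvd p hk (Nat.prime_iff_prime_int.1 hp.out) this
  rw [injective_iff_map_eq_zero]
  intro y hy
  by_contra hne
  have hsupp : (b.repr y).support.Nonempty := by
    rw [Finsupp.support_nonempty_iff]
    exact fun h => hne (b.repr.map_eq_zero_iff.1 h)
  -- Basis vectors have distinct top degrees D by uniqueness of base p digits, with unit
  -- coefficients there, so the term of largest D cannot be cancelled.
  obtain ⟨e, he, hmax⟩ := Finset.exists_max_image _ D hsupp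
  have h1 : (dpAlgBasis R).repr (f y) (D e) = b.repr y e * (dpAlgBasis R).repr (f (b e)) (D e) := by
    conv_lhs => rw [← b.linearCombination_repr y, Finsupp.linearCombination_apply, Finsupp.sum,
      map_sum, map_sum, Finsupp.finsetSum_apply]
    rw [Finset.sum_eq_single e]
    · rw [hsmul, map_smul, Finsupp.smul_apply, smul_eq_mul]
    · intro e' he' hne'
      have : D e' < D e := lt_of_le_of_ne (hmax e' he') fun h =>
        hne' (smallExponent_sum_injective p h)
      rw [hsmul, map_smul, Finsupp.smul_apply, hlt e' _ this, smul_zero]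
    · exact fun h => absurd he h
  rw [hy, map_zero, Finsupp.zero_apply] at h1
  exact Finsupp.mem_support_iff.1 he ((hunit e).mul_left_eq_zero.1 h1.symm)

end CoverEmbedding

/-! ### The differential equation of a character of W^×[F] -/

section OneCharacters

variable {p : ℕ} [hp : Fact p.Prime] {R : Type u} [CommRing R] {k : ℕ}

-- Modulo each prime ideal x becomes one of the integers j, and integers satisfy j^p = j in
-- characteristic p.
omit hp in
lemma isNilpotent_of_prod_sub_eq_zero (hp : p.Prime) (hk : (p : R) ^ k = 0) {x : R} {N : ℕ}
    (h : ∏ j ∈ Finset.range N, (x - (j : R)) = 0) : IsNilpotent (x ^ p - x) := by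
  rw [← mem_nilradical, nilradical_eq_sInf, Ideal.mem_sInf]
  intro P hP
  have hP' : P.IsPrime := hP
  have hpP : (p : R) ∈ P := hP'.mem_of_pow_mem k (hk ▸ P.zero_mem)
  obtain ⟨j, -, hj⟩ := (hP'.prod_mem_iff).1 (h ▸ P.zero_mem)
  have h1 : Ideal.Quotient.mk P x = (j : R ⧸ P) := by
    rw [← map_natCast (Ideal.Quotient.mk P)]
    exact Ideal.Quotient.eq.2 hj
  have h2 : ((j : ℤ) - (j : ℤ) ^ p : ℤ) = (p : ℤ) * ((j - (j : ℤ) ^ p) / p) := by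
    have : Fact p.Prime := ⟨hp⟩
    exact (Int.mul_ediv_cancel' (dvd_int_sub_pow p j)).symm
  have h3 : ((p : ℕ) : R ⧸ P) = 0 := by
    rw [← map_natCast (Ideal.Quotient.mk P)]
    exact Ideal.Quotient.eq_zero_iff_mem.2 hpP
  have h4 := congrArg (Int.cast (R := R ⧸ P)) h2
  push_cast at h4
  rw [h3, zero_mul, sub_eq_zero] at h4
  rw [← Ideal.Quotient.eq_zero_iff_mem, map_sub, map_pow, h1, sub_eq_zero]
  exact h4.symm

namespace RingChar

/-- The tangent vector of a character of `W^×[F]`. -/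
def tangent (a : RingChar p 1 R) : R := (a.app (dualInl R) (tangentPoint p R)).snd

lemma app_tangentPoint (a : RingChar p 1 R) : a.app (dualInl R) (tangentPoint p R) =
    1 + TrivSqZeroExt.inr a.tangent := by
  have h := a.app_map (dualInl R) (dualFst R) rfl (tangentPoint p R) 1
    (map_dualFst_tangentPoint p R)
  rw [map_one, dualFst_apply] at h
  refine TrivSqZeroExt.ext ?_ ?_
  · simp [← h]
  · simp [tangent]

/-- The character is applied to the translate of P by the tangent point, where it takes the value
a(P)(1 + tε); comparing ε-parts gives the equation. -/
lemma snd_shift_app (a : RingChar p 1 R) {B : Type u} [CommRing B] (i : R →+* B)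
    (s : B →+* DualNumber B) (hs : s.comp i = (dualInl B).comp i) (P : frobKer p 1 B)
    (hP : WittVector.map s (P : WittVector p B) = WittVector.map (dualInl B) (P : WittVector p B) *
      (tangentPoint p B : WittVector p (DualNumber B))) :
    (s (a.app i P)).snd = i a.tangent * a.app i P := by
  let Q : frobKer p 1 (DualNumber B) :=
    ⟨WittVector.map (dualInl B) (P : WittVector p B), map_mem_frobKer _ P.2⟩
  have h1 := a.app_map i s hs P (Q * tangentPoint p B) hP
  have h2 := a.app_map i (dualInl B) rfl P Q rfl
  have h3 := a.app_map (dualInl R) (dualMap i) (h := (dualInl B).comp i)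
    (RingHom.ext fun r => TrivSqZeroExt.ext (by simp) (by simp)) (tangentPoint p R)
    (tangentPoint p B) (map_dualMap_tangentPoint p _)
  rw [map_mul, h2, h3, app_tangentPoint] at h1
  rw [← h1]
  simp [mul_comm]

lemma dpAlgDeriv_app_dpPoint (a : RingChar p 1 R) :
    dpAlgDeriv R (a.app (algebraMap R (DPAlg R)) (dpPoint p R)) =
      a.tangent • a.app (algebraMap R (DPAlg R)) (dpPoint p R) := by
  have h := a.snd_shift_app (algebraMap R (DPAlg R)) (dpShift R) (dpShift_comp_algebraMap R)
    (dpPoint p R) (map_dpShift_dpPoint p R)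
  rw [dpShift, snd_leibnizHom] at h
  exact h.trans (Algebra.smul_def a.tangent (a.app (algebraMap R (DPAlg R)) (dpPoint p R))).symm

/-- The eigenvector equation gives c_(i+1) = (t - i) c_i, and c_0 = 1 because the point specialises
to the identity. -/
lemma repr_app_dpPoint (a : RingChar p 1 R) (i : ℕ) :
    (dpAlgBasis R).repr (a.app (algebraMap R (DPAlg R)) (dpPoint p R)) i =
      ∏ j ∈ Finset.range i, (a.tangent - (j : R)) := by
  induction i with
  | zero =>
    rw [dpAlgBasis_repr_zero, Finset.prod_range_zero]
    have h := a.app_map (algebraMap R (DPAlg R)) (dpAlgAug R) (h := RingHom.id R)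
      (RingHom.ext fun r => by simp [dpAlgAug]) (dpPoint p R) 1 (map_dpAlgAug_dpPoint p R)
    rw [← h, map_one]
  | succ i ih =>
    have h := dpAlgBasis_repr_deriv R (a.app (algebraMap R (DPAlg R)) (dpPoint p R)) i
    rw [dpAlgDeriv_app_dpPoint, map_smul, Finsupp.smul_apply, smul_eq_mul] at h
    rw [Finset.prod_range_succ, ← ih]
    linear_combination -h

/-- An element of the divided power algebra has finitely many nonzero coordinates, so some product
∏_{j<N} (t - j) vanishes. -/
lemma isNilpotent_tangent (a : RingChar p 1 R) (hk : (p : R) ^ k = 0) :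
    IsNilpotent (a.tangent ^ p - a.tangent) := by
  set c := (dpAlgBasis R).repr (a.app (algebraMap R (DPAlg R)) (dpPoint p R))
  obtain ⟨N, hN⟩ := c.support.exists_notMem
  refine isNilpotent_of_prod_sub_eq_zero hp.out hk (N := N) ?_
  rw [← repr_app_dpPoint]
  exact Finsupp.notMem_support_iff.1 hN

/-- A character of `W^×[F]` with trivial tangent vector is trivial. -/
lemma app_eq_one_of_tangent_eq_zero (a : RingChar p 1 R) (hk : (p : R) ^ k = 0)
    (ha : a.tangent = 0) {T : Type u} [CommRing T] (f : R →+* T) (x : frobKer p 1 T) :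
    a.app f x = 1 := by
  have h1 : a.app (algebraMap R (DPAlg R)) (dpPoint p R) = 1 := by
    apply (dpAlgBasis R).repr.injective
    ext i
    rw [repr_app_dpPoint, ha, Algebra.TensorProduct.one_def, dpAlgBasis_repr_tmul, one_mul]
    have h1 := dpCoord_spec 1 i
    rcases i with _ | i
    · have : dpCoord 1 0 = 1 := map_one dpAug
      simp [this]
    · have : dpCoord 1 (i + 1) = 0 := by
        simp [Polynomial.coeff_one] at h1
        exact_mod_cast h1
      rw [this, Finset.prod_range_succ']
      simp
  obtain ⟨g, hinj, hg1, hg2⟩ := exists_frobCover_one_embedding p hk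
  have hmem : frobCoverPoint (1 : WittVector p R) ∈ frobKer p 1 (FrobCover (1 : WittVector p R)) := by
    rw [mem_frobKer_one, frobenius_frobCoverPoint, map_one]
  have h2 : a.app (algebraMap R _) ⟨frobCoverPoint (1 : WittVector p R), hmem⟩ = 1 := by
    apply hinj
    rw [map_one, ← h1]
    exact (a.app_map _ g hg1 _ (dpPoint p R) hg2).symm
  obtain ⟨h, hf1, hf2⟩ := exists_frobCover_lift (1 : WittVector p R) f (x : WittVector p T)
    (by rw [map_one]; exact mem_frobKer_one.1 x.2)
  rw [a.app_map _ h hf1 ⟨_, hmem⟩ x hf2, h2, map_one]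

end RingChar

end OneCharacters

/-! ### The value of a character at the Artin–Hasse point -/

section Value

open PowerSeries

variable {p : ℕ} [hp : Fact p.Prime]

/-- Truncated power series. -/
abbrev TruncPS (R : Type*) [CommRing R] (N : ℕ) : Type _ := R⟦X⟧ ⧸ Ideal.span {(X : R⟦X⟧) ^ N}

/-- The truncation map. -/
abbrev mkPS {R : Type*} [CommRing R] (N : ℕ) : R⟦X⟧ →+* TruncPS R N := Ideal.Quotient.mk _

lemma mkPS_eq_iff {R : Type*} [CommRing R] {N : ℕ} {f g : R⟦X⟧} :
    mkPS N f = mkPS N g ↔ ∀ m < N, coeff m f = coeff m g := by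
  rw [Ideal.Quotient.eq, Ideal.mem_span_singleton, X_pow_dvd_iff]
  simp only [map_sub, sub_eq_zero]

section Point

variable {R : Type*} [CommRing R] (ι : ℤ_[p] →+* R)

/-- The coefficient map from `ℤ_p[[X]]` to truncated power series over `R`. -/
def ahMap (N : ℕ) : ℤ_[p]⟦X⟧ →+* TruncPS R N := (mkPS N).comp (PowerSeries.map ι)

lemma ahMap_apply (N : ℕ) (f : ℤ_[p]⟦X⟧) : ahMap ι N f = mkPS N (PowerSeries.map ι f) := rfl

lemma ahMap_X_pow (N : ℕ) : ahMap ι N (X ^ N) = 0 := by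
  rw [ahMap_apply, map_pow, map_X]
  exact Ideal.Quotient.eq_zero_iff_mem.2 (Ideal.mem_span_singleton_self _)

lemma frobenius_pow_powerSeriesToWitt (n : ℕ) (f : ℤ_[p]⟦X⟧) :
    (WittVector.frobenius ^ n : WittVector p ℤ_[p]⟦X⟧ →+* WittVector p ℤ_[p]⟦X⟧)
      (powerSeriesToWitt p f) =
      powerSeriesToWitt p (expand (p ^ n) (pow_ne_zero n hp.out.ne_zero) f) := by
  induction n generalizing f with
  | zero => simp
  | succ n ih =>
    rw [frobenius_pow_succ_apply, frobenius_powerSeriesToWitt, ih, ← expand_mul]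
    congr 2

/-- Here F^n turns E(X) into E(X^(p^n)), which is 1 plus a multiple of X^(p^n). In Witt vectors this
is 1 plus a multiple of the Teichmüller lift of X^(p^n), which vanishes after truncation. -/
lemma map_ahMap_mem (n : ℕ) : WittVector.map (ahMap ι (p ^ n))
    (artinHassePoint p : WittVector p ℤ_[p]⟦X⟧) ∈ frobKer p n (TruncPS R (p ^ n)) := by
  obtain ⟨g, hg⟩ := X_dvd_iff.2 (show constantCoeff (artinHasse p - 1) = 0 by
    rw [map_sub, constantCoeff_artinHasse, map_one, sub_self])
  rw [sub_eq_iff_eq_add] at hg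
  rw [mem_frobKer, frobenius_pow_map, coe_artinHassePoint, frobenius_pow_powerSeriesToWitt, hg,
    map_add, map_one, map_mul, expand_X, map_add, map_one, map_mul, map_pow, powerSeriesToWitt_X,
    ← map_pow, map_add, map_one, map_mul, WittVector.map_teichmuller, ahMap_X_pow,
    WittVector.teichmuller_zero, zero_mul, zero_add]

/-- The Artin–Hasse point of `W^×[F^n]` over `R[X]/X^(p^n)`. -/
def ahPoint (n : ℕ) : frobKer p n (TruncPS R (p ^ n)) := ⟨_, map_ahMap_mem ι n⟩

lemma coe_ahPoint (n : ℕ) : (ahPoint ι n : WittVector p (TruncPS R (p ^ n))) =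
    WittVector.map (ahMap ι (p ^ n)) (artinHassePoint p : WittVector p ℤ_[p]⟦X⟧) := rfl

lemma ahPoint_coeff_zero (n : ℕ) : (ahPoint ι n : WittVector p (TruncPS R (p ^ n))).coeff 0 =
    mkPS (p ^ n) (PowerSeries.map ι (artinHasse p)) := by
  rw [coe_ahPoint, WittVector.map_coeff, ← ghostComponent_zero_eq, coe_artinHassePoint,
    powerSeriesToWitt, ghostComponent_frobeniusLiftHom]
  rfl

/-- The map on truncated power series induced by `X ↦ X^p`. -/
def expandPS (p : ℕ) [hp : Fact p.Prime] (R : Type*) [CommRing R] (n : ℕ) :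
    TruncPS R (p ^ n) →+* TruncPS R (p ^ (n + 1)) :=
  Ideal.Quotient.lift _ ((mkPS (p ^ (n + 1))).comp (expand p hp.out.ne_zero).toRingHom) (by
    intro a ha
    obtain ⟨b, rfl⟩ := Ideal.mem_span_singleton.1 ha
    refine Ideal.Quotient.eq_zero_iff_mem.2 (Ideal.mem_span_singleton.2 ?_)
    refine ⟨expand p hp.out.ne_zero b, ?_⟩
    change expand p hp.out.ne_zero (X ^ p ^ n * b) = _
    rw [map_mul, map_pow, expand_X, ← pow_mul, ← pow_succ'])

lemma expandPS_mkPS (n : ℕ) (f : R⟦X⟧) : expandPS p R n (mkPS (p ^ n) f) =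
    mkPS (p ^ (n + 1)) (expand p hp.out.ne_zero f) := rfl

lemma expandPS_injective (n : ℕ) : Function.Injective (expandPS p R n) := by
  intro a b h
  obtain ⟨f, rfl⟩ := Ideal.Quotient.mk_surjective a
  obtain ⟨g, rfl⟩ := Ideal.Quotient.mk_surjective b
  rw [expandPS_mkPS, expandPS_mkPS, mkPS_eq_iff, coeff_expand_eq_iff] at h
  exact mkPS_eq_iff.2 h

/-- On ℤ_p[[X]] both substituting X^p and applying F turn the ghost components E(X^(p^m)) into
E(X^(p^(m+1))). -/
lemma map_expandPS_ahPoint (n : ℕ) :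
    WittVector.map (expandPS p R n) (ahPoint ι n : WittVector p (TruncPS R (p ^ n))) =
      WittVector.frobenius (ahPoint ι (n + 1) : WittVector p (TruncPS R (p ^ (n + 1)))) := by
  have h : WittVector.map ((expand p hp.out.ne_zero : ℤ_[p]⟦X⟧ →ₐ[ℤ_[p]] ℤ_[p]⟦X⟧).toRingHom)
      (artinHassePoint p : WittVector p ℤ_[p]⟦X⟧) =
      WittVector.frobenius (artinHassePoint p : WittVector p ℤ_[p]⟦X⟧) := by
    refine eq_of_ghostComponent_eq (isLeftRegular_powerSeries p) fun m => ?_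
    rw [ghostComponent_map, coe_artinHassePoint, WittVector.ghostComponent_frobenius,
      powerSeriesToWitt, ghostComponent_frobeniusLiftHom, ghostComponent_frobeniusLiftHom, pow_succ']
    rfl
  rw [coe_ahPoint, coe_ahPoint, frobenius_map, ← h, map_map, map_map]
  congr 2
  refine RingHom.ext fun f => ?_
  rw [RingHom.comp_apply, RingHom.comp_apply, ahMap_apply, ahMap_apply, expandPS_mkPS]
  congr 1
  exact (map_expand _ _ _ _).symm

/-- The map from power series to dual numbers given by `X ↦ ε`. -/
def psDual (A : Type*) [CommRing A] : A⟦X⟧ →+* DualNumber A :=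
  leibnizHom constantCoeff (fun f => coeff 1 f) (map_add _) fun f g => by
    rw [coeff_mul, Finset.Nat.antidiagonal_succ]
    simp [add_comm]

/-- The map from truncated power series to dual numbers given by `X ↦ ε`. -/
def truncDual (p : ℕ) [hp : Fact p.Prime] (R : Type*) [CommRing R] (n : ℕ) :
    TruncPS R (p ^ (n + 1)) →+* DualNumber R :=
  Ideal.Quotient.lift _ (psDual R) (by
    intro a ha
    have h2 : 1 < p ^ (n + 1) := Nat.one_lt_pow n.succ_ne_zero hp.out.one_lt
    have h := X_pow_dvd_iff.1 (Ideal.mem_span_singleton.1 ha)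
    refine TrivSqZeroExt.ext ?_ ?_
    · rw [psDual, fst_leibnizHom, ← coeff_zero_eq_constantCoeff_apply, h 0 (by omega)]
      rfl
    · rw [psDual, snd_leibnizHom, h 1 h2]
      rfl)

lemma truncDual_mkPS (n : ℕ) (f : R⟦X⟧) :
    truncDual p R n (mkPS (p ^ (n + 1)) f) = psDual R f := rfl

/-- Both sides have ghost components (1 + ε, 1, 1, …): E starts with 1 + X, while E(X^(p^m)) has no
linear term for m > 0. -/
lemma map_psDual_artinHassePoint :
    WittVector.map (psDual ℤ_[p]) (artinHassePoint p : WittVector p ℤ_[p]⟦X⟧) =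
      WittVector.map (dpDual ℤ_[p]) (dpWitt p) := by
  have hreg : IsLeftRegular (p : DualNumber ℤ_[p]) := by
    rw [← map_natCast (dualInl ℤ_[p])]
    exact isLeftRegular_dual (IsLeftCancelMulZero.mul_left_cancel_of_ne_zero
      (Nat.cast_ne_zero.2 hp.out.ne_zero))
  refine eq_of_ghostComponent_eq hreg fun m => ?_
  rw [ghostComponent_map, ghostComponent_map, coe_artinHassePoint, powerSeriesToWitt,
    ghostComponent_frobeniusLiftHom, ghostComponent_dpWitt]
  have hc : ∀ m, constantCoeff
      (((expand p hp.out.ne_zero : ℤ_[p]⟦X⟧ →ₐ[ℤ_[p]] ℤ_[p]⟦X⟧).toRingHom ^ m) (artinHasse p)) =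
        1 := by
    intro m
    induction m with
    | zero => exact constantCoeff_artinHasse p
    | succ m ih =>
      rw [pow_succ', ← ih]
      exact constantCoeff_expand p hp.out.ne_zero _
  split_ifs with h
  · subst h
    have h3 : dpCoord (1 : dpRing) 1 = 0 := by
      have := dpCoord_spec 1 1
      simp [Polynomial.coeff_one] at this
      exact_mod_cast this
    refine TrivSqZeroExt.ext ?_ ?_
    · rw [psDual, fst_leibnizHom, hc, fst_dpDual, ← dpAug_apply, dpAug_one_add, Int.cast_one]
    · rw [psDual, snd_leibnizHom, snd_dpDual, map_add, Finsupp.add_apply, h3, dpCoord_gamma]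
      simp [coeff_one_artinHasse]
  · obtain ⟨m, rfl⟩ := Nat.exists_eq_succ_of_ne_zero h
    rw [map_one]
    refine TrivSqZeroExt.ext ?_ ?_
    · rw [psDual, fst_leibnizHom, hc]
      rfl
    · rw [psDual, snd_leibnizHom, pow_succ']
      exact coeff_expand_of_not_dvd p hp.out.ne_zero _ hp.out.not_dvd_one

lemma map_truncDual_ahPoint (n : ℕ) :
    WittVector.map (truncDual p R n) (ahPoint ι (n + 1) : WittVector p (TruncPS R (p ^ (n + 1)))) =
      (tangentPoint p R : WittVector p (DualNumber R)) := by
  have h := map_dualMap_tangentPoint p ι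
  rw [coe_tangentPoint, ← map_psDual_artinHassePoint, map_map] at h
  rw [coe_ahPoint, map_map, ← h]
  congr 2
  refine RingHom.ext fun f => ?_
  rw [RingHom.comp_apply, RingHom.comp_apply, ahMap_apply, truncDual_mkPS]
  refine TrivSqZeroExt.ext ?_ ?_
  · rw [fst_dualMap, psDual, fst_leibnizHom, psDual, fst_leibnizHom,
      ← coeff_zero_eq_constantCoeff_apply, ← coeff_zero_eq_constantCoeff_apply, coeff_map]
  · simp [psDual, coeff_map]

end Point

namespace RingChar

variable {n : ℕ} {R : Type u} [CommRing R] (ι : ℤ_[p] →+* R)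

/-- The value of a character at the Artin–Hasse point. -/
def value (a : RingChar p n R) : TruncPS R (p ^ n) := a.app ((mkPS (p ^ n)).comp C) (ahPoint ι n)

lemma value_mul (a b : RingChar p n R) : (a * b).value ι = a.value ι * b.value ι := rfl

lemma value_congr {a b : RingChar p n R} (h : ∀ (T : Type u) [CommRing T] (f : R →+* T)
    (x : frobKer p n T), a.app f x = b.app f x) : a.value ι = b.value ι := h _ _ _

lemma value_pullback (a : RingChar p n R) :
    a.pullback.value ι = expandPS p R n (a.value ι) := by
  rw [value, pullback_app, value]
  refine a.app_map _ (expandPS p R n) (RingHom.ext fun r => ?_) _ _ (map_expandPS_ahPoint ι n)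
  rw [RingHom.comp_apply, RingHom.comp_apply, expandPS_mkPS, expand_C]
  rfl

/-- At X = ε the Artin–Hasse point becomes the tangent point, so the tangent vector is the linear
coefficient of the value. -/
lemma restrictOne_tangent (a : RingChar p (n + 1) R) {f : R⟦X⟧}
    (hf : a.value ι = mkPS (p ^ (n + 1)) f) : a.restrictOne.tangent = coeff 1 f := by
  have h := a.app_map ((mkPS (p ^ (n + 1))).comp C) (truncDual p R n) (h := dualInl R)
    (RingHom.ext fun r => by
      rw [RingHom.comp_apply, RingHom.comp_apply, truncDual_mkPS]
      refine TrivSqZeroExt.ext ?_ ?_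
      · simp [psDual]
      · simp [psDual]) (ahPoint ι (n + 1))
    ⟨tangentPoint p R, mem_frobKer_succ_of_frobenius_eq_one
      (mem_frobKer_one.1 (tangentPoint p R).2)⟩ (map_truncDual_ahPoint ι n)
  have h2 : (a.app ((mkPS (p ^ (n + 1))).comp C)) (ahPoint ι (n + 1)) = mkPS (p ^ (n + 1)) f := hf
  rw [tangent, restrictOne_app, h, h2, truncDual_mkPS, psDual, snd_leibnizHom]

lemma tangent_mul (a b : RingChar p 1 R) : (a * b).tangent = a.tangent + b.tangent := by
  have h := (a * b).app_tangentPoint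
  rw [mul_app, app_tangentPoint, app_tangentPoint] at h
  have := congrArg TrivSqZeroExt.snd h
  simpa [add_comm] using this.symm

lemma restrictOne_mul (a b : RingChar p (n + 1) R) :
    (a * b).restrictOne = a.restrictOne * b.restrictOne := rfl

end RingChar

end Value

/-! ### Witt vectors fixed by Frobenius up to nilpotents -/

section NilFixed

variable (p : ℕ) [hp : Fact p.Prime] (R : Type*) [CommRing R]

/-- The Witt vectors which are fixed by Frobenius modulo nilpotents. -/
def nilFixed : AddSubgroup (WittVector p R) where
  carrier := {x | WittVector.map (Ideal.Quotient.mk (nilradical R)) (WittVector.frobenius x) =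
    WittVector.map (Ideal.Quotient.mk (nilradical R)) x}
  zero_mem' := by simp
  add_mem' {x y} hx hy := by
    rw [Set.mem_ofPred_eq] at hx hy ⊢
    rw [map_add, map_add, hx, hy, map_add]
  neg_mem' {x} hx := by
    rw [Set.mem_ofPred_eq] at hx ⊢
    rw [map_neg, map_neg, hx, map_neg]

variable {p R}

lemma mem_nilFixed_iff {x : WittVector p R} : x ∈ nilFixed p R ↔
    WittVector.map (Ideal.Quotient.mk (nilradical R)) (WittVector.frobenius x) =
      WittVector.map (Ideal.Quotient.mk (nilradical R)) x := Iff.rfl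

lemma coeff_frobenius_of_natCast_eq_zero {A : Type*} [CommRing A] (hA : (p : A) = 0)
    (x : WittVector p A) (i : ℕ) : (WittVector.frobenius x).coeff i = x.coeff i ^ p := by
  rw [WittVector.coeff_frobenius, WittVector.frobeniusPoly]
  simp [hA]

/-- Since p is nilpotent, F modulo the nilradical is the p-th power on each coefficient. -/
lemma mem_nilFixed {k : ℕ} (hk : (p : R) ^ k = 0) {x : WittVector p R} :
    x ∈ nilFixed p R ↔ ∀ i, IsNilpotent (x.coeff i ^ p - x.coeff i) := by
  have h0 : ((p : ℕ) : R ⧸ nilradical R) = 0 := by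
    rw [← map_natCast (Ideal.Quotient.mk (nilradical R))]
    exact Ideal.Quotient.eq_zero_iff_mem.2 ⟨k, hk⟩
  rw [mem_nilFixed_iff, ← frobenius_map, WittVector.ext_iff]
  refine forall_congr' fun i => ?_
  rw [coeff_frobenius_of_natCast_eq_zero h0, WittVector.map_coeff, ← map_pow, Ideal.Quotient.eq,
    mem_nilradical]

lemma one_mem_nilFixed : (1 : WittVector p R) ∈ nilFixed p R := by
  rw [mem_nilFixed_iff, map_one]

lemma teichmuller_mem_nilFixed {k : ℕ} (hk : (p : R) ^ k = 0) {a : R}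
    (ha : IsNilpotent (a ^ p - a)) : WittVector.teichmuller p a ∈ nilFixed p R := by
  rw [mem_nilFixed hk]
  intro i
  rcases i with _ | i
  · rwa [WittVector.teichmuller_coeff_zero]
  · rw [WittVector.teichmuller_coeff_pos p a _ i.succ_pos, zero_pow hp.out.ne_zero, sub_zero]
    exact IsNilpotent.zero

lemma isNilpotent_pow_sub_self {a : R} (ha : IsNilpotent a) : IsNilpotent (a ^ p - a) :=
  Commute.isNilpotent_sub (Commute.all _ _) (ha.pow_of_pos hp.out.ne_zero) ha

lemma verschiebung_mem_nilFixed {k : ℕ} (hk : (p : R) ^ k = 0) {x : WittVector p R} :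
    WittVector.verschiebung x ∈ nilFixed p R ↔ x ∈ nilFixed p R := by
  rw [mem_nilFixed hk, mem_nilFixed hk]
  constructor
  · intro h i
    simpa using h (i + 1)
  · intro h i
    rcases i with _ | i
    · rw [WittVector.verschiebung_coeff_zero, zero_pow hp.out.ne_zero, sub_zero]
      exact IsNilpotent.zero
    · simpa using h i

lemma exists_eq_verschiebung {x : WittVector p R} (hx : x.coeff 0 = 0) :
    ∃ y, x = WittVector.verschiebung y :=
  ⟨WittVector.mk p fun i => x.coeff (i + 1), by
    ext i
    rcases i with _ | i
    · simp [hx]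
    · simp⟩

lemma coeff_zero_add (x y : WittVector p R) : (x + y).coeff 0 = x.coeff 0 + y.coeff 0 := by
  rw [← ghostComponent_zero_eq, map_add, ghostComponent_zero_eq, ghostComponent_zero_eq]

lemma coeff_zero_neg (x : WittVector p R) : (-x).coeff 0 = -x.coeff 0 := by
  rw [← ghostComponent_zero_eq, map_neg, ghostComponent_zero_eq]

lemma prod_sub_eq_zero {Q : Type*} [CommRing Q] (c : ZMod p →+* Q) {b : Q} (hb : b ^ p = b) :
    ∏ j, (b - c j) = 0 := by
  have hd : (Polynomial.X ^ p - Polynomial.X : Polynomial (ZMod p)).natDegree = p :=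
    FiniteField.X_pow_card_sub_X_natDegree_eq (ZMod p) hp.out.one_lt
  have hr := FiniteField.roots_X_pow_card_sub_X (ZMod p)
  rw [ZMod.card] at hr
  have hprod := Polynomial.prod_multiset_X_sub_C_of_monic_of_roots_card_eq
    (p := (Polynomial.X ^ p - Polynomial.X : Polynomial (ZMod p)))
    (Polynomial.monic_X_pow_sub (by simpa using hp.out.one_lt))
    (by rw [hr, hd]; simp [ZMod.card])
  rw [hr] at hprod
  have h4 := congrArg (Polynomial.eval₂ c b) hprod
  rw [Polynomial.eval₂_sub, Polynomial.eval₂_pow, Polynomial.eval₂_X, hb, sub_self] at h4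
  rw [← h4, ← Finset.prod_eq_multiset_prod, Polynomial.eval₂_finsetProd]
  simp

/-- An element with `a^p - a` nilpotent is, up to a nilpotent, a sum of idempotents. -/
lemma exists_idempotents {k : ℕ} (hk : (p : R) ^ k = 0) {a : R} (ha : IsNilpotent (a ^ p - a)) :
    ∃ e : ZMod p → R, CompleteOrthogonalIdempotents e ∧
      IsNilpotent (a - ∑ j, e j * (j.val : R)) := by
  rcases subsingleton_or_nontrivial R with hR | hR
  · exact ⟨fun _ => 0, ⟨⟨fun i => Subsingleton.elim _ _, fun i j _ => Subsingleton.elim _ _⟩,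
      Subsingleton.elim _ _⟩, 1, Subsingleton.elim _ _⟩
  let Q := R ⧸ nilradical R
  let q : R →+* Q := Ideal.Quotient.mk (nilradical R)
  have h0 : ((p : ℕ) : Q) = 0 := by
    rw [← map_natCast q]
    exact Ideal.Quotient.eq_zero_iff_mem.2 ⟨k, hk⟩
  have hnil : ∀ x : R, q x = 0 ↔ IsNilpotent x := fun x => Ideal.Quotient.eq_zero_iff_mem
  have hQ : Nontrivial Q := by
    refine ⟨0, 1, fun h => ?_⟩
    have : IsNilpotent (1 : R) := (hnil 1).1 (by rw [map_one, h])
    exact not_isNilpotent_one this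
  have : CharP Q p := (CharP.charP_iff_prime_eq_zero hp.out).2 h0
  let : Algebra (ZMod p) Q := ZMod.algebra Q p
  let c : ZMod p →+* Q := algebraMap (ZMod p) Q
  let b : Q := q a
  have hb : b ^ p = b := by
    rw [← sub_eq_zero, ← map_pow, ← map_sub]
    exact (hnil _).2 ha
  have hbj : ∀ j, (b - c j) ^ p = b - c j := fun j => by
    rw [sub_pow_char, hb, ← map_pow, ZMod.pow_card]
  -- By Fermat's little theorem this is the indicator function of the locus b = j.
  let e : ZMod p → Q := fun j => 1 - (b - c j) ^ (p - 1)
  have hp1 : p - 1 + 1 = p := Nat.sub_add_cancel hp.out.one_le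
  have hz : ∀ j, e j * (b - c j) = 0 := fun j => by
    rw [sub_mul, one_mul, ← pow_succ, hp1, hbj, sub_self]
  have hbe : ∀ j, e j * b = e j * c j := fun j => by
    rw [← sub_eq_zero, ← mul_sub, hz]
  have hpe : ∀ j, (b - c j) ^ (p - 1) * e j = 0 := fun j => by
    have h1 : p - 1 = p - 2 + 1 := by have := hp.out.two_le; omega
    rw [h1, pow_succ, mul_assoc, mul_comm (b - c j), hz, mul_zero]
  have hid : ∀ j, e j * e j = e j := fun j => by
    rw [show e j * e j = e j - (b - c j) ^ (p - 1) * e j by simp only [e]; ring, hpe, sub_zero]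
  have horth : ∀ i j, i ≠ j → e i * e j = 0 := by
    intro i j hij
    have h1 : e i * e j * c (i - j) = 0 := by
      rw [map_sub, mul_sub, mul_right_comm, ← hbe, mul_assoc _ (e j), ← hbe]
      ring
    have h2 : IsUnit (c (i - j)) := (IsUnit.mk0 _ (sub_ne_zero.2 hij)).map c
    exact (h2.mul_left_eq_zero).1 h1
  have hsum : ∑ j, e j = 1 := by
    set s := ∑ j, e j with hs
    have hse : ∀ j, (1 - s) * e j = 0 := fun j => by
      rw [sub_mul, one_mul, hs, Finset.sum_mul, Finset.sum_eq_single j, hid, sub_self]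
      · exact fun i _ hij => horth i j hij
      · simp
    -- On the complement of all these loci each b - j acts invertibly, but the product of the b - j
    -- over 𝔽_p is zero.
    have h1 : ∀ j, (1 - s) * (b - c j) ^ (p - 1) = 1 - s := fun j => by
      have := hse j
      rw [mul_sub, mul_one, sub_eq_zero] at this
      exact this.symm
    have h2 : ∀ t : Finset (ZMod p), (1 - s) * (∏ j ∈ t, (b - c j)) ^ (p - 1) = 1 - s := by
      intro t
      induction t using Finset.induction_on with
      | empty => simp
      | insert j t hj ih => rw [Finset.prod_insert hj, mul_pow, ← mul_assoc, h1, ih]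
    have h3 : ∏ j, (b - c j) = 0 := prod_sub_eq_zero c hb
    have h4 := h2 Finset.univ
    rw [h3, zero_pow (by have := hp.out.two_le; omega), mul_zero] at h4
    exact (sub_eq_zero.1 h4.symm).symm
  obtain ⟨e', he', hee'⟩ := CompleteOrthogonalIdempotents.lift_of_isNilpotent_ker q
    (fun x hx => (hnil x).1 hx)
    (⟨⟨hid, fun i j hij => horth i j hij⟩, hsum⟩ : CompleteOrthogonalIdempotents e)
    (fun i => Ideal.Quotient.mk_surjective _)
  refine ⟨e', he', (hnil _).1 ?_⟩
  have hj : ∀ j : ZMod p, q (j.val : R) = c j := fun j => by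
    rw [map_natCast, ← map_natCast c, ZMod.natCast_zmod_val]
  have he'' : ∀ j, q (e' j) = e j := fun j => congrFun hee' j
  rw [map_sub, map_sum, sub_eq_zero]
  calc b = (∑ j, e j) * b := by rw [hsum, one_mul]
    _ = ∑ j, e j * c j := by
      rw [Finset.sum_mul]
      exact Finset.sum_congr rfl fun j _ => hbe j
    _ = _ := Finset.sum_congr rfl fun j _ => by rw [map_mul, he'', hj]

end NilFixed

/-! ### Existence of characters -/

section Existence

open PowerSeries

variable {p : ℕ} [hp : Fact p.Prime]

lemma coeff_artinHasseTerm_zero {A : Type*} [CommRing A] (ι : ℤ_[p] →+* A) (c : A) (i : ℕ) :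
    coeff i (artinHasseTerm ι 0 c) = c ^ i * ι (coeff i (artinHasse p)) := by
  rw [artinHasseTerm]
  simp only [pow_zero, expand_one_apply]
  rw [coeff_rescale, coeff_map]

lemma mkPS_eq_sum {R : Type*} [CommRing R] (N : ℕ) (f : R⟦X⟧) {M : ℕ}
    (hf : ∀ i, M ≤ i → coeff i f = 0) :
    mkPS N f = ∑ i ∈ Finset.range M, mkPS N (C (coeff i f)) * mkPS N X ^ i := by
  have h : f = ∑ i ∈ Finset.range M, C (coeff i f) * X ^ i := by
    ext m
    rw [map_sum]
    simp only [coeff_C_mul, coeff_X_pow, mul_ite, mul_one, mul_zero]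
    rw [Finset.sum_ite_eq]
    split_ifs with hm
    · rfl
    · exact hf m (not_lt.1 fun h => hm (Finset.mem_range.2 h))
  conv_lhs => rw [h]
  rw [map_sum]
  exact Finset.sum_congr rfl fun i _ => by rw [map_mul, map_pow]

/-- The two products agree modulo the annihilator of e. -/
lemma C_mul_artinHasseProd_congr {A : Type*} [CommRing A] (ι : ℤ_[p] →+* A) (N : ℕ) (e : A)
    {x y : ℕ → A} (h : ∀ i, e * x i = e * y i) :
    C e * artinHasseProd ι N x = C e * artinHasseProd ι N y := by
  let I : Ideal A := LinearMap.ker (LinearMap.mulLeft A e)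
  have hI : ∀ a b, Ideal.Quotient.mk I a = Ideal.Quotient.mk I b ↔ e * a = e * b := by
    intro a b
    rw [Ideal.Quotient.eq, LinearMap.mem_ker, LinearMap.mulLeft_apply, mul_sub, sub_eq_zero]
  have h1 : PowerSeries.map (Ideal.Quotient.mk I) (artinHasseProd ι N x) =
      PowerSeries.map (Ideal.Quotient.mk I) (artinHasseProd ι N y) := by
    rw [map_artinHasseProd, map_artinHasseProd]
    congr 1
    funext i
    exact (hI _ _).2 (h i)
  ext m
  rw [coeff_C_mul, coeff_C_mul]
  have := congrArg (coeff m) h1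
  rw [coeff_map, coeff_map] at this
  exact (hI _ _).1 this

namespace RingChar

variable {n : ℕ} {R : Type u} [CommRing R] {k : ℕ}

lemma sum_mul_sum_orthogonal {A I : Type*} [CommRing A] [Fintype I] {e : I → A}
    (he : CompleteOrthogonalIdempotents e) (a b : I → A) :
    (∑ j, e j * a j) * ∑ j, e j * b j = ∑ j, e j * (a j * b j) := by
  rw [Finset.sum_mul]
  refine Finset.sum_congr rfl fun i _ => ?_
  rw [Finset.mul_sum, Finset.sum_eq_single i]
  · rw [mul_mul_mul_comm, (he.idem i).eq]
  · intro j _ hj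
    rw [mul_mul_mul_comm, he.ortho hj.symm, zero_mul]
  · simp

/-- The character `u ↦ ∑ e_j u_0^j` attached to orthogonal idempotents `e_j`. -/
def ofIdempotents {e : ZMod p → R} (he : CompleteOrthogonalIdempotents e) : RingChar p n R where
  app {T} _ f :=
    { toFun := fun u => ∑ j, f (e j) * (u : WittVector p T).coeff 0 ^ j.val
      map_one' := by
        have h : ∀ j : ZMod p, f (e j) * ((1 : frobKer p n T) : WittVector p T).coeff 0 ^ j.val =
            f (e j) := fun j => by
          rw [Submonoid.coe_one, WittVector.one_coeff_zero, one_pow, mul_one]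
        rw [Finset.sum_congr rfl fun j _ => h j, ← map_sum, he.complete, map_one]
      map_mul' := fun u v => by
        refine Eq.trans ?_ (sum_mul_sum_orthogonal (he.map f) _ _).symm
        refine Finset.sum_congr rfl fun j _ => ?_
        rw [Submonoid.coe_mul, WittVector.mul_coeff_zero, mul_pow]
        rfl }
  map_app f g x := by
    change g (∑ j, _) = ∑ j, _
    rw [map_sum]
    refine Finset.sum_congr rfl fun j _ => ?_
    rw [map_mul, map_pow, WittVector.map_coeff]
    rfl

lemma ofIdempotents_app {e : ZMod p → R} (he : CompleteOrthogonalIdempotents e) {T : Type u}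
    [CommRing T] (f : R →+* T) (u : frobKer p n T) : (ofIdempotents he).app f u =
      ∑ j, f (e j) * (u : WittVector p T).coeff 0 ^ j.val := rfl

lemma mkPS_artinHasseProd_add (ι : ℤ_[p] →+* R) (x y : WittVector p R) :
    mkPS (p ^ n) (artinHasseProd ι n (x + y).coeff) =
      mkPS (p ^ n) (artinHasseProd ι n x.coeff) * mkPS (p ^ n) (artinHasseProd ι n y.coeff) := by
  rw [← map_mul]
  exact mkPS_eq_iff.2 (coeff_artinHasseProd_add ι n x y)

lemma mkPS_artinHasseProd_zero (ι : ℤ_[p] →+* R) :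
    mkPS (p ^ n) (artinHasseProd ι n (0 : WittVector p R).coeff) = 1 := by
  rw [artinHasseProd, Finset.prod_eq_one, map_one]
  intro i _
  rw [WittVector.zero_coeff, artinHasseTerm_zero_right]

lemma mkPS_artinHasseProd_natCast (ι : ℤ_[p] →+* R) (m : ℕ) :
    mkPS (p ^ (n + 1)) (artinHasseProd ι (n + 1) (m : WittVector p R).coeff) =
      mkPS (p ^ (n + 1)) (PowerSeries.map ι (artinHasse p)) ^ m := by
  induction m with
  | zero => rw [Nat.cast_zero, pow_zero, mkPS_artinHasseProd_zero]
  | succ m ih =>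
    rw [Nat.cast_succ, mkPS_artinHasseProd_add, ih, pow_succ (mkPS _ _),
      ← map_one (WittVector.teichmuller p (R := R)), artinHasseProd_teichmuller]
    congr 2
    ext i
    rw [coeff_artinHasseTerm_zero, one_pow, one_mul, coeff_map]

lemma natCast_mem_nilFixed (m : ℕ) : (m : WittVector p R) ∈ nilFixed p R := by
  have := (nilFixed p R).nsmul_mem one_mem_nilFixed m
  rwa [nsmul_one] at this

lemma exists_value_ofIdempotents (ι : ℤ_[p] →+* R) (hk : (p : R) ^ k = 0) {e : ZMod p → R}
    (he : CompleteOrthogonalIdempotents e) : ∃ y ∈ nilFixed p R,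
      y.coeff 0 = ∑ j, e j * (j.val : R) ∧ (ofIdempotents he : RingChar p (n + 1) R).value ι =
        mkPS (p ^ (n + 1)) (artinHasseProd ι (n + 1) y.coeff) := by
  -- On the piece where e_j = 1, the vector y is the integer j, the character is u_0^j, and its
  -- value is E(X)^j, the exponential of j.
  set y : WittVector p R :=
    WittVector.mk p fun i => ∑ j : ZMod p, e j * ((j.val : ℕ) : WittVector p R).coeff i with hy
  have hyc : ∀ i, y.coeff i = ∑ j : ZMod p, e j * ((j.val : ℕ) : WittVector p R).coeff i :=
    fun i => congrFun (WittVector.coeff_mk _ _) i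
  have hej : ∀ j i, e j * y.coeff i = e j * ((j.val : ℕ) : WittVector p R).coeff i := by
    intro j i
    rw [hyc, Finset.mul_sum, Finset.sum_eq_single j]
    · rw [← mul_assoc, (he.idem j).eq]
    · intro l _ hl
      rw [← mul_assoc, he.ortho hl.symm, zero_mul]
    · simp
  refine ⟨y, ?_, ?_, ?_⟩
  · rw [mem_nilFixed hk]
    intro i
    have hpow : ∀ m : ℕ, ∀ a : ZMod p → R, m ≠ 0 →
        (∑ j, e j * a j) ^ m = ∑ j, e j * a j ^ m := by
      intro m a hm
      induction m, Nat.one_le_iff_ne_zero.2 hm using Nat.le_induction with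
      | base => simp
      | succ m h1 ih =>
        rw [pow_succ, ih (by omega), sum_mul_sum_orthogonal he]
        simp only [pow_succ]
    rw [hyc, hpow p _ hp.out.ne_zero, ← Finset.sum_sub_distrib]
    simp only [← mul_sub]
    refine isNilpotent_sum fun j _ => (Commute.all _ _).isNilpotent_mul_left ?_
    exact (mem_nilFixed hk).1 (natCast_mem_nilFixed j.val) i
  · rw [hyc]
    refine Finset.sum_congr rfl fun j _ => ?_
    rw [← ghostComponent_zero_eq, map_natCast]
  · have h1 : artinHasseProd ι (n + 1) y.coeff = ∑ j : ZMod p, C (e j) *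
        artinHasseProd ι (n + 1) ((j.val : ℕ) : WittVector p R).coeff := by
      conv_lhs => rw [← one_mul (artinHasseProd ι (n + 1) y.coeff), ← map_one C, ← he.complete,
        map_sum, Finset.sum_mul]
      exact Finset.sum_congr rfl fun j _ => C_mul_artinHasseProd_congr ι _ _ (hej j)
    rw [h1, map_sum, value, ofIdempotents_app]
    refine Finset.sum_congr rfl fun j _ => ?_
    rw [map_mul, mkPS_artinHasseProd_natCast, ahPoint_coeff_zero]
    rfl

/-- The inclusion of `W^×[F^n]` in the units of `W`. -/
def frobKerUnits (T : Type*) [CommRing T] (hk : (p : T) ^ k = 0) :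
    frobKer p n T →* (WittVector p T)ˣ :=
  IsUnit.liftRight (frobKer p n T).subtype fun u => isUnit_of_mem_frobKer hk u.2

lemma map_pow_eq_zero {A B : Type*} [CommRing A] [CommRing B] (f : A →+* B) {z : A} {m : ℕ}
    (hz : z ^ m = 0) : f z ^ m = 0 := by
  rw [← map_pow, hz, map_zero]

/-- The character attached to a nilpotent element `z`. -/
def ofNilpotent (ι : ℤ_[p] →+* R) (hk : (p : R) ^ k = 0) {z : R} {a : ℕ} (hz : z ^ p ^ a = 0) :
    RingChar p n R where
  app {T} _ f := (Units.coeHom T).comp ((nilChar (f.comp ι) (map_pow_eq_zero f hz)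
    (natCast_pow_eq_zero_of_ringHom hk f)).comp
      (frobKerUnits T (natCast_pow_eq_zero_of_ringHom hk f)))
  map_app {S T} _ _ f g x := by
    refine (map_nilChar (f.comp ι) (map_pow_eq_zero f hz) (natCast_pow_eq_zero_of_ringHom hk f) g
      (map_pow_eq_zero (g.comp f) hz) (natCast_pow_eq_zero_of_ringHom hk (g.comp f)) _).trans ?_
    refine congrArg (fun u => ((nilChar ((g.comp f).comp ι) (map_pow_eq_zero (g.comp f) hz)
      (natCast_pow_eq_zero_of_ringHom hk (g.comp f)) u : Tˣ) : T)) (Units.ext ?_)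
    rfl

lemma ofNilpotent_app (ι : ℤ_[p] →+* R) (hk : (p : R) ^ k = 0) {z : R} {a : ℕ}
    (hz : z ^ p ^ a = 0) {T : Type u} [CommRing T] (f : R →+* T) (u : frobKer p n T) :
    (ofNilpotent ι hk hz).app f u = nilPairing (f.comp ι) (map_pow_eq_zero f hz)
      (wittLog (a + k) (frobKerUnits T (natCast_pow_eq_zero_of_ringHom hk f) u)) := rfl

/-- The logarithm of the Artin–Hasse point is the Teichmüller lift of X up to terms the pairing
kills, so the value is E(Xz), which is symmetric in X and z. The exponent a + 1 guarantees that the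
product defining the pairing has a first factor. -/
lemma value_ofNilpotent (ι : ℤ_[p] →+* R) (hk : (p : R) ^ k = 0) {z : R} {a : ℕ}
    (hz : z ^ p ^ (a + 1) = 0) : (ofNilpotent ι hk hz : RingChar p (n + 1) R).value ι =
      mkPS (p ^ (n + 1)) (artinHasseProd ι (n + 1) (WittVector.teichmuller p z).coeff) := by
  set N := p ^ (n + 1)
  set i : R →+* TruncPS R N := (mkPS N).comp C
  have hkT := natCast_pow_eq_zero_of_ringHom hk i
  have hu : frobKerUnits (TruncPS R N) hkT (ahPoint ι (n + 1)) = Units.map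
      ((WittVector.map (ahMap ι N) : _ →+* WittVector p (TruncPS R N)) : _ →* _)
      (artinHassePoint p) := Units.ext rfl
  obtain ⟨y, hy⟩ := exists_wittLog_artinHassePoint p (a + 1 + k)
  have hX : ahMap ι N X = mkPS N X := by rw [ahMap_apply, map_X]
  rw [value, ofNilpotent_app, hu, ← map_wittLog, hy, map_add, map_mul, map_pow, map_natCast,
    WittVector.map_teichmuller, nilPairing_add, nilPairing_pow_mul _ _ hkT le_rfl, mul_one,
    nilPairing, artinHasseProd_teichmuller, artinHasseProd_teichmuller, nilEval_apply,
    mkPS_eq_sum N (artinHasseTerm ι 0 z) (M := p ^ (a + 1))]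
  · refine Finset.sum_congr rfl fun m _ => ?_
    rw [coeff_artinHasseTerm_zero, coeff_artinHasseTerm_zero, hX, map_mul, map_mul, map_pow,
      map_pow]
    change mkPS N X ^ m * mkPS N (C (ι _)) * mkPS N (C z) ^ m = _
    ring
  · intro m hm
    rw [coeff_artinHasseTerm_zero, pow_eq_zero_of_le hm hz, zero_mul]

/-- Every element with `a^p - a` nilpotent is the tangent vector of a character. -/
lemma exists_value_eq (ι : ℤ_[p] →+* R) (hk : (p : R) ^ k = 0) {a : R}
    (ha : IsNilpotent (a ^ p - a)) (n : ℕ) : ∃ χ : RingChar p (n + 1) R, ∃ y ∈ nilFixed p R,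
      y.coeff 0 = a ∧
        χ.value ι = mkPS (p ^ (n + 1)) (artinHasseProd ι (n + 1) y.coeff) := by
  obtain ⟨e, he, hz⟩ := exists_idempotents hk ha
  obtain ⟨y, hy, hy0, hv⟩ := exists_value_ofIdempotents (n := n) ι hk he
  obtain ⟨m, hm⟩ := hz
  have hm' : (a - ∑ j, e j * (j.val : R)) ^ p ^ (m + 1) = 0 :=
    pow_eq_zero_of_le ((Nat.le_succ m).trans (Nat.lt_pow_self hp.out.one_lt).le) hm
  refine ⟨ofIdempotents he * ofNilpotent ι hk hm', y + WittVector.teichmuller p _,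
    add_mem hy (teichmuller_mem_nilFixed hk (isNilpotent_pow_sub_self ⟨m, hm⟩)), ?_, ?_⟩
  · rw [coeff_zero_add, hy0, WittVector.teichmuller_coeff_zero]
    ring
  · rw [value_mul, hv, value_ofNilpotent, mkPS_artinHasseProd_add]

end RingChar

end Existence

/-! ### Classification of characters -/

namespace RingChar

open PowerSeries

variable {p : ℕ} [hp : Fact p.Prime] {n : ℕ} {R : Type u} [CommRing R] {k : ℕ}

lemma mkPS_artinHasseProd_verschiebung (ι : ℤ_[p] →+* R) (w : WittVector p R) :
    mkPS (p ^ (n + 1)) (artinHasseProd ι (n + 1) (WittVector.verschiebung w).coeff) =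
      expandPS p R n (mkPS (p ^ n) (artinHasseProd ι n w.coeff)) := by
  rw [artinHasseProd_succ, WittVector.verschiebung_coeff_zero, artinHasseTerm_zero_right, one_mul,
    expandPS_mkPS]
  simp only [WittVector.verschiebung_coeff_succ]

lemma exists_pullback_of_tangent_eq_zero (a : RingChar p (n + 1) R) (hk : (p : R) ^ k = 0)
    (ha : a.restrictOne.tangent = 0) : ∃ b : RingChar p n R, ∀ (T : Type u) [CommRing T]
      (f : R →+* T) (x : frobKer p (n + 1) T), a.app f x = b.pullback.app f x :=
  a.exists_pullback_eq hk fun _ _ f x => a.restrictOne.app_eq_one_of_tangent_eq_zero hk ha f x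

/-- A character is determined by its value at the Artin–Hasse point. -/
theorem app_eq_one_of_value_eq_one (ι : ℤ_[p] →+* R) (hk : (p : R) ^ k = 0) (a : RingChar p n R)
    (ha : a.value ι = 1) {T : Type u} [CommRing T] (f : R →+* T) (x : frobKer p n T) :
    a.app f x = 1 := by
  induction n generalizing T with
  | zero => exact a.app_eq_one_of_eq_one f x.2
  | succ n ih =>
    have h0 : a.restrictOne.tangent = 0 := by
      rw [a.restrictOne_tangent ι (f := 1) (ha.trans (map_one _).symm), coeff_one,
        if_neg one_ne_zero]
    obtain ⟨b, hb⟩ := a.exists_pullback_of_tangent_eq_zero hk h0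
    have hv : b.value ι = 1 := by
      apply expandPS_injective n
      rw [← value_pullback, map_one, ← ha]
      exact (value_congr ι hb).symm
    rw [hb, pullback_app]
    exact ih b hv f _

/-- An explicit character accounts for the coefficient x_0. The remaining Witt vector is V w, and
induction realises w by a character whose pullback along F realises V w. -/
lemma exists_value_eq_of_mem_nilFixed (ι : ℤ_[p] →+* R) (hk : (p : R) ^ k = 0) (x : WittVector p R)
    (hx : x ∈ nilFixed p R) :
    ∃ a : RingChar p n R, a.value ι = mkPS (p ^ n) (artinHasseProd ι n x.coeff) := by
  induction n generalizing x with
  | zero =>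
    refine ⟨{ app := fun _ => 1, map_app := fun f g x => map_one g }, ?_⟩
    rw [artinHasseProd, Finset.prod_range_zero, map_one]
    rfl
  | succ n ih =>
    obtain ⟨b, y, hy, hy0, hb⟩ := exists_value_eq ι hk ((mem_nilFixed hk).1 hx 0) n
    obtain ⟨w, hw⟩ := exists_eq_verschiebung (x := x + -y)
      (by rw [coeff_zero_add, coeff_zero_neg, hy0, add_neg_cancel])
    have hwm : w ∈ nilFixed p R := by
      rw [← verschiebung_mem_nilFixed hk, ← hw]
      exact add_mem hx (neg_mem hy)
    obtain ⟨c, hc⟩ := ih w hwm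
    refine ⟨b * c.pullback, ?_⟩
    rw [value_mul, value_pullback, hb, hc, ← mkPS_artinHasseProd_verschiebung,
      ← mkPS_artinHasseProd_add, ← hw]
    congr 3
    abel

/-- Multiplying by an explicit character of opposite tangent vector makes the restriction to W^×[F]
trivial, so the product is a pullback and induction applies to it. -/
lemma exists_mem_nilFixed_of_value (ι : ℤ_[p] →+* R) (hk : (p : R) ^ k = 0) (a : RingChar p n R) :
    ∃ x ∈ nilFixed p R, a.value ι = mkPS (p ^ n) (artinHasseProd ι n x.coeff) := by
  induction n with
  | zero =>
    refine ⟨0, zero_mem _, ?_⟩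
    rw [artinHasseProd, Finset.prod_range_zero, map_one]
    refine a.app_eq_one_of_eq_one _ ?_
    exact (ahPoint ι 0).2
  | succ n ih =>
    have ht := a.restrictOne.isNilpotent_tangent hk
    -- Passing through the Witt vector negative of the Teichmüller lift shows that -t also satisfies
    -- the nilpotency condition, without separating p = 2.
    have ht' := neg_mem (teichmuller_mem_nilFixed hk ht)
    have hneg : (-WittVector.teichmuller p a.restrictOne.tangent).coeff 0 =
        -a.restrictOne.tangent := by
      rw [coeff_zero_neg, WittVector.teichmuller_coeff_zero]
    have ht2 := (mem_nilFixed hk).1 ht' 0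
    rw [hneg] at ht2
    obtain ⟨b, y, hy, hy0, hb⟩ := exists_value_eq ι hk ht2 n
    have h0 : (a * b).restrictOne.tangent = 0 := by
      rw [restrictOne_mul, tangent_mul, b.restrictOne_tangent ι hb, coeff_one_artinHasseProd_succ,
        hy0, add_neg_cancel]
    obtain ⟨c, hc⟩ := (a * b).exists_pullback_of_tangent_eq_zero hk h0
    obtain ⟨w, hw, hcw⟩ := ih c
    have h1 : a.value ι * mkPS (p ^ (n + 1)) (artinHasseProd ι (n + 1) y.coeff) =
        mkPS (p ^ (n + 1)) (artinHasseProd ι (n + 1) (WittVector.verschiebung w).coeff) := by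
      rw [← hb, ← value_mul, mkPS_artinHasseProd_verschiebung, ← hcw, ← value_pullback]
      exact value_congr ι hc
    refine ⟨WittVector.verschiebung w + -y,
      add_mem ((verschiebung_mem_nilFixed hk).2 hw) (neg_mem hy), ?_⟩
    rw [mkPS_artinHasseProd_add, ← h1, mul_assoc, ← mkPS_artinHasseProd_add, add_neg_cancel,
      mkPS_artinHasseProd_zero, mul_one]

end RingChar

/-! ### The Artin–Hasse exponential on truncated Witt vectors -/

section TruncatedWitt

variable {p : ℕ} [hp : Fact p.Prime] {n : ℕ} {R : Type u} [CommRing R]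

lemma truncate_out (x : TruncatedWittVector p n R) : WittVector.truncate n x.out = x :=
  TruncatedWittVector.truncateFun_out x

/-- The homomorphism from truncated Witt vectors to truncated power series given by the
Artin–Hasse exponential. -/
def truncExp (ι : ℤ_[p] →+* R) :
    Multiplicative (TruncatedWittVector p n R) →* TruncPS R (p ^ n) where
  toFun x := mkPS (p ^ n) (artinHasseProd ι n (x.toAdd.out).coeff)
  map_one' := by
    rw [artinHasseProd, Finset.prod_eq_one, map_one]
    intro i hi
    have : ((1 : Multiplicative (TruncatedWittVector p n R)).toAdd.out).coeff i = 0 := by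
      rw [toAdd_one, TruncatedWittVector.coeff_out _ ⟨i, Finset.mem_range.1 hi⟩]
      simp
    rw [this, artinHasseTerm_zero_right]
  map_mul' x y := by
    rw [← RingChar.mkPS_artinHasseProd_add]
    congr 1
    refine artinHasseProd_congr ι n fun i hi => ?_
    rw [toAdd_mul, TruncatedWittVector.coeff_out _ ⟨i, hi⟩,
      ← WittVector.coeff_truncate (x.toAdd.out + y.toAdd.out) ⟨i, hi⟩, map_add, truncate_out,
      truncate_out]

lemma truncExp_truncate (ι : ℤ_[p] →+* R) (x : WittVector p R) :
    truncExp ι (Multiplicative.ofAdd (WittVector.truncate n x)) =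
      mkPS (p ^ n) (artinHasseProd ι n x.coeff) := by
  change mkPS (p ^ n) (artinHasseProd ι n _) = _
  congr 1
  refine artinHasseProd_congr ι n fun i hi => ?_
  rw [toAdd_ofAdd, TruncatedWittVector.coeff_out _ ⟨i, hi⟩, WittVector.coeff_truncate]

lemma truncExp_injective (ι : ℤ_[p] →+* R) :
    Function.Injective (truncExp ι : Multiplicative (TruncatedWittVector p n R) →* _) := by
  rw [injective_iff_map_eq_one]
  intro x hx
  obtain ⟨y, hy⟩ := WittVector.truncate_surjective p n R x.toAdd
  rw [← ofAdd_toAdd x, ← hy, truncExp_truncate, ← map_one (mkPS (p ^ n)), mkPS_eq_iff] at hx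
  have h := eq_zero_of_coeff_artinHasseProd ι n _ hx
  rw [← ofAdd_toAdd x, ← hy, ofAdd_eq_one]
  ext i
  rw [WittVector.coeff_truncate, h i i.2]
  simp

end TruncatedWitt

/-! ### Comparison with the Cartier dual -/

section CompletionPoints

variable {p : ℕ} [hp : Fact p.Prime] {k n : ℕ} {R : Type u} [CommRing R] [Algebra (ZMod (p ^ k)) R]

omit hp in
lemma natCast_pow_eq_zero_of_algebra (p k : ℕ) (R : Type*) [CommRing R] [Algebra (ZMod (p ^ k)) R] :
    (p : R) ^ k = 0 := by
  rw [← map_natCast (algebraMap (ZMod (p ^ k)) R), ← map_pow, ← Nat.cast_pow, ZMod.natCast_self,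
    map_zero]

/-- Modulo a prime ideal, the roots of X^p - X are exactly the elements of 𝔽_p. The nilradical is
the intersection of the primes, so the conditions at all residue domains become nilpotency. -/
lemma inCompletion_iff_isNilpotent (x : TruncatedWittVector p n R) :
    InCompletion p k n x ↔ ∀ i, IsNilpotent (x.coeff i ^ p - x.coeff i) := by
  rw [inCompletion_iff]
  constructor
  · intro h i
    rw [← mem_nilradical, nilradical_eq_sInf, Ideal.mem_sInf]
    intro P hP
    obtain ⟨c, y, hy⟩ := h P hP
    have h1 := congrArg (TruncatedWittVector.coeff i) hy
    rw [coeff_truncMap, coeff_truncMap] at h1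
    rw [← Ideal.Quotient.eq_zero_iff_mem, map_sub, map_pow, h1, ← map_pow, ZMod.pow_card, sub_self]
  · intro h P hP
    obtain ⟨c⟩ := exists_hom_residue p k R P hP
    have hc : ∀ i, ∃ j, Ideal.Quotient.mk P (x.coeff i) = c j := by
      intro i
      have h1 : Ideal.Quotient.mk P (x.coeff i) ^ p = Ideal.Quotient.mk P (x.coeff i) := by
        rw [← sub_eq_zero, ← map_pow, ← map_sub]
        exact ((h i).map (Ideal.Quotient.mk P)).eq_zero
      obtain ⟨j, -, hj⟩ := Finset.prod_eq_zero_iff.1 (prod_sub_eq_zero c h1)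
      exact ⟨j, sub_eq_zero.1 hj⟩
    choose y hy using hc
    refine ⟨c, TruncatedWittVector.mk p y, ?_⟩
    ext i
    rw [coeff_truncMap, coeff_truncMap, TruncatedWittVector.coeff_mk, hy]

lemma inCompletion_truncate {x : WittVector p R} (hx : x ∈ nilFixed p R) :
    InCompletion p k n (WittVector.truncate n x) := by
  rw [inCompletion_iff_isNilpotent]
  intro i
  rw [WittVector.coeff_truncate]
  exact (mem_nilFixed (natCast_pow_eq_zero_of_algebra p k R)).1 hx i

lemma InCompletion.exists_truncate_eq {x : TruncatedWittVector p n R} (hx : InCompletion p k n x) :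
    ∃ y ∈ nilFixed p R, WittVector.truncate n y = x := by
  refine ⟨x.out, (mem_nilFixed (natCast_pow_eq_zero_of_algebra p k R)).2 fun i => ?_,
    truncate_out x⟩
  by_cases hi : i < n
  · rw [TruncatedWittVector.coeff_out x ⟨i, hi⟩]
    exact (inCompletion_iff_isNilpotent x).1 hx _
  -- The lift `out` is padded with zeros from index n on.
  · have : x.out.coeff i = 0 := dif_neg hi
    rw [this, zero_pow hp.out.ne_zero, sub_zero]
    exact IsNilpotent.zero

end CompletionPoints

/-! ### Base change of truncated power series -/

section MapPS

variable {p : ℕ} [hp : Fact p.Prime] {n : ℕ} {R S : Type*} [CommRing R] [CommRing S]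

/-- The homomorphism of truncated power series rings induced by a homomorphism of coefficients. -/
def mapPS (N : ℕ) (f : R →+* S) : TruncPS R N →+* TruncPS S N :=
  Ideal.Quotient.lift _ ((mkPS N).comp (PowerSeries.map f)) (by
    intro a ha
    obtain ⟨b, rfl⟩ := Ideal.mem_span_singleton.1 ha
    refine Ideal.Quotient.eq_zero_iff_mem.2 (Ideal.mem_span_singleton.2 ?_)
    exact ⟨PowerSeries.map f b, by rw [map_mul, map_pow, PowerSeries.map_X]⟩)

lemma mapPS_mkPS (N : ℕ) (f : R →+* S) (g : PowerSeries R) :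
    mapPS N f (mkPS N g) = mkPS N (PowerSeries.map f g) := rfl

lemma map_mapPS_ahPoint (ι : ℤ_[p] →+* R) (f : R →+* S) :
    WittVector.map (mapPS (p ^ n) f) (ahPoint ι n : WittVector p (TruncPS R (p ^ n))) =
      (ahPoint (f.comp ι) n : WittVector p (TruncPS S (p ^ n))) := by
  rw [coe_ahPoint, map_map, coe_ahPoint]
  congr 2

end MapPS

/-! ### Transfer to characters on algebras and naturality -/

section Comparison

variable {p : ℕ} [hp : Fact p.Prime] {k n : ℕ}

lemma mem_ker_unitsFrobeniusPow_iff {S : Type u} [CommRing S] (u : (WittVector p S)ˣ) :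
    u ∈ (unitsFrobeniusPow p n S).ker ↔ (u : WittVector p S) ∈ frobKer p n S := by
  rw [MonoidHom.mem_ker, mem_frobKer, Units.ext_iff]
  rfl

/-- The group `W^×[F^n](S)` is the kernel of `F^n` on the multiplicative monoid of `W(S)`. -/
def frobKerToKer (n : ℕ) (S : Type u) [CommRing S] (hk : (p : S) ^ k = 0) :
    frobKer p n S →* (unitsFrobeniusPow p n S).ker :=
  (RingChar.frobKerUnits S hk).codRestrict _ fun u => (mem_ker_unitsFrobeniusPow_iff _).2 u.2

/-- The inclusion of `W^×[F^n](S)` in the multiplicative monoid of `W(S)`. -/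
def kerToFrobKer (p : ℕ) [hp : Fact p.Prime] (n : ℕ) (S : Type u) [CommRing S] :
    (unitsFrobeniusPow p n S).ker →* frobKer p n S :=
  ((Units.coeHom (WittVector p S)).comp (unitsFrobeniusPow p n S).ker.subtype).codRestrict _
    fun u => (mem_ker_unitsFrobeniusPow_iff _).1 u.2

variable {R : CommAlgCat.{u} (ZMod (p ^ k))}

/-- A ring over `R`, as a `ℤ/p^k`-algebra. -/
abbrev algOver {T : Type u} [CommRing T] (f : R →+* T) : CommAlgCat.{u} (ZMod (p ^ k)) :=
  letI := (f.comp (algebraMap (ZMod (p ^ k)) R)).toAlgebra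
  CommAlgCat.of (ZMod (p ^ k)) T

/-- A ring homomorphism out of `R`, as a morphism of `ℤ/p^k`-algebras. -/
def homOver {T : Type u} [CommRing T] (f : R →+* T) : R ⟶ algOver f :=
  letI := (f.comp (algebraMap (ZMod (p ^ k)) R)).toAlgebra
  CommAlgCat.ofHom (X := R) (Y := T) { toRingHom := f, commutes' := fun _ => rfl }

omit hp in
lemma natCast_pow_eq_zero_over {T : Type u} [CommRing T] (f : R →+* T) : (p : T) ^ k = 0 :=
  natCast_pow_eq_zero_of_ringHom (natCast_pow_eq_zero_of_algebra p k R) f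

/-- The ring homomorphism underlying a morphism of `ℤ/p^k`-algebras. -/
abbrev homRing {R S : CommAlgCat.{u} (ZMod (p ^ k))} (s : R ⟶ S) : R →+* S := (s.hom : R →+* S)

/-- The homomorphism `W^×[F^n](S) → S` given by a character. -/
def Character.coeApp (a : Character (wittUnitsFrobeniusKer.{u} p n (ZMod (p ^ k))) R)
    {S : CommAlgCat.{u} (ZMod (p ^ k))} (s : R ⟶ S) : (unitsFrobeniusPow p n S).ker →* S :=
  (Units.coeHom S).comp (a.app s)

lemma Character.coeApp_over (a : Character (wittUnitsFrobeniusKer.{u} p n (ZMod (p ^ k))) R)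
    {S : CommAlgCat.{u} (ZMod (p ^ k))} (s : R ⟶ S) {T : Type u} [CommRing T] (g : S →+* T)
    (u : (unitsFrobeniusPow p n S).ker) (w : (unitsFrobeniusPow p n T).ker)
    (hw : ((w : (WittVector p T)ˣ) : WittVector p T) =
      WittVector.map g ((u : (WittVector p S)ˣ) : WittVector p S)) :
    a.coeApp (homOver (g.comp (homRing s))) w = g (a.coeApp s u) := by
  let : Algebra (ZMod (p ^ k)) T :=
    ((g.comp (homRing s)).comp (algebraMap (ZMod (p ^ k)) R)).toAlgebra
  let g' : S ⟶ algOver (g.comp (homRing s)) := CommAlgCat.ofHom (X := S) (Y := T)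
    { toRingHom := g
      commutes' := fun r => by
        change g (algebraMap (ZMod (p ^ k)) S r) = g (s.hom (algebraMap (ZMod (p ^ k)) R r))
        rw [AlgHom.commutes] }
  have h := a.naturality s g' u
  have h1 : (wittUnitsFrobeniusKer p n (ZMod (p ^ k))).map g' u = w :=
    Subtype.ext (Units.ext hw.symm)
  rw [h1] at h
  exact congrArg Units.val h

/-- The family of homomorphisms on all ring extensions underlying a character. -/
def Character.toRingChar (a : Character (wittUnitsFrobeniusKer.{u} p n (ZMod (p ^ k))) R) :
    RingChar p n R where
  app {T} _ f := (a.coeApp (homOver f)).comp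
    (frobKerToKer n T (natCast_pow_eq_zero_over f))
  map_app {S T} _ _ f g x :=
    (a.coeApp_over (homOver f) g (frobKerToKer n S (natCast_pow_eq_zero_over f) x)
      (frobKerToKer n T (natCast_pow_eq_zero_over (g.comp f))
        ⟨WittVector.map g x, map_mem_frobKer g x.2⟩) rfl).symm

lemma Character.toRingChar_app (a : Character (wittUnitsFrobeniusKer.{u} p n (ZMod (p ^ k))) R)
    {S : CommAlgCat.{u} (ZMod (p ^ k))} (s : R ⟶ S) (u : (unitsFrobeniusPow p n S).ker) :
    a.toRingChar.app (homRing s) (kerToFrobKer p n S u) = a.coeApp s u :=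
  a.coeApp_over s (RingHom.id S) u
    (frobKerToKer n S (natCast_pow_eq_zero_over (homRing s)) (kerToFrobKer p n S u)) (by
      ext i
      simp only [WittVector.map_coeff, RingHom.id_apply]
      rfl)

/-- The character underlying a natural family of homomorphisms on all ring extensions. -/
def RingChar.toCharacter (a : RingChar p n R) :
    Character (wittUnitsFrobeniusKer.{u} p n (ZMod (p ^ k))) R where
  app {S} s := MonoidHom.toHomUnits ((a.app (homRing s)).comp (kerToFrobKer p n S))
  naturality {S _} s g x := Units.ext (a.map_app (homRing s) (homRing g) (kerToFrobKer p n S x)).symm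

/-- The map from `p`-adic integers to a `ℤ/p^k`-algebra. -/
def padicMap (p k : ℕ) [hp : Fact p.Prime] (R : Type*) [CommRing R] [Algebra (ZMod (p ^ k)) R] :
    ℤ_[p] →+* R := (algebraMap (ZMod (p ^ k)) R).comp (PadicInt.toZModPow k)

/-- The value of a character at the Artin–Hasse point. -/
def characterValue (n : ℕ) (R : CommAlgCat.{u} (ZMod (p ^ k))) :
    Character (wittUnitsFrobeniusKer.{u} p n (ZMod (p ^ k))) R →* TruncPS R (p ^ n) where
  toFun a := a.toRingChar.value (padicMap p k R)
  map_one' := rfl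
  map_mul' _ _ := rfl

lemma characterValue_injective (n : ℕ) (R : CommAlgCat.{u} (ZMod (p ^ k))) :
    Function.Injective (characterValue (p := p) n R) := by
  rw [injective_iff_map_eq_one]
  intro a ha
  refine Character.ext' fun S s => MonoidHom.ext fun u => Units.ext ?_
  exact (a.toRingChar_app s u).symm.trans (RingChar.app_eq_one_of_value_eq_one
    (padicMap p k R) (natCast_pow_eq_zero_of_algebra p k R) a.toRingChar ha _ _)

lemma characterValue_toCharacter {R : CommAlgCat.{u} (ZMod (p ^ k))} (a : RingChar p n R) :
    characterValue n R a.toCharacter = a.value (padicMap p k R) := rfl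

lemma Character.toRingChar_baseChange_app {R S : CommAlgCat.{u} (ZMod (p ^ k))} (s : R ⟶ S)
    (a : Character (wittUnitsFrobeniusKer.{u} p n (ZMod (p ^ k))) R) {T : Type u} [CommRing T]
    (f : S →+* T) (x : frobKer p n T) :
    (a.baseChange s).toRingChar.app f x = a.toRingChar.app (f.comp (homRing s)) x :=
  (a.toRingChar_app (s ≫ homOver f) (frobKerToKer n T (natCast_pow_eq_zero_over f) x)).symm

lemma padicMap_comp {R S : CommAlgCat.{u} (ZMod (p ^ k))} (s : R ⟶ S) :
    (homRing s).comp (padicMap p k R) = padicMap p k S := by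
  refine RingHom.ext fun x => ?_
  exact s.hom.commutes _

lemma characterValue_baseChange {R S : CommAlgCat.{u} (ZMod (p ^ k))} (s : R ⟶ S)
    (a : Character (wittUnitsFrobeniusKer.{u} p n (ZMod (p ^ k))) R) :
    characterValue n S (a.baseChange s) =
      mapPS (p ^ n) (homRing s) (characterValue n R a) := by
  refine (a.toRingChar_baseChange_app s _ _).trans ?_
  refine a.toRingChar.app_map _ (mapPS (p ^ n) (homRing s)) (RingHom.ext fun r => ?_) _ _ ?_
  · rw [RingHom.comp_apply, RingHom.comp_apply, mapPS_mkPS, PowerSeries.map_C]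
    rfl
  · rw [map_mapPS_ahPoint, padicMap_comp]

/-- The Artin–Hasse exponential on the completion. -/
def completionExp (n : ℕ) (R : CommAlgCat.{u} (ZMod (p ^ k))) :
    Multiplicative (completionSubgroup p k n R) →* TruncPS R (p ^ n) :=
  (truncExp (padicMap p k R)).comp (AddMonoidHom.toMultiplicative (completionSubgroup p k n R).subtype)

lemma completionExp_injective (n : ℕ) (R : CommAlgCat.{u} (ZMod (p ^ k))) :
    Function.Injective (completionExp (p := p) n R) :=
  (truncExp_injective (padicMap p k R)).comp
    (Multiplicative.ofAdd.injective.comp (Subtype.val_injective.comp Multiplicative.toAdd.injective))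

/-- The map on points of the completion induced by a morphism of algebras. -/
def completionMap {R S : CommAlgCat.{u} (ZMod (p ^ k))} (s : R ⟶ S) :
    completionSubgroup p k n R →+ completionSubgroup p k n S := ((wittCompletion p k n).map s).hom

lemma coe_completionMap {R S : CommAlgCat.{u} (ZMod (p ^ k))} (s : R ⟶ S)
    (x : completionSubgroup p k n R) : (completionMap s x : TruncatedWittVector p n S) =
      truncMap p n (homRing s) x := rfl

lemma completionExp_map {R S : CommAlgCat.{u} (ZMod (p ^ k))} (s : R ⟶ S)
    (x : completionSubgroup p k n R) :
    completionExp n S (Multiplicative.ofAdd (completionMap s x)) =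
      mapPS (p ^ n) (homRing s) (completionExp n R (Multiplicative.ofAdd x)) := by
  obtain ⟨y, hy⟩ := WittVector.truncate_surjective p n R x.1
  have h : (completionMap s x : TruncatedWittVector p n S) = WittVector.truncate n (WittVector.map (homRing s) y) := by
    rw [coe_completionMap, ← hy]
    ext i
    simp [WittVector.map_coeff]
  change truncExp _ (Multiplicative.ofAdd _) = mapPS _ _ (truncExp _ (Multiplicative.ofAdd x.1))
  refine (congrArg (fun z => truncExp (padicMap p k S) (Multiplicative.ofAdd z)) h).trans ?_
  rw [truncExp_truncate, ← hy, truncExp_truncate, mapPS_mkPS, map_artinHasseProd, padicMap_comp]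
  rfl

lemma exists_completionExp_eq (R : CommAlgCat.{u} (ZMod (p ^ k)))
    (a : Character (wittUnitsFrobeniusKer.{u} p n (ZMod (p ^ k))) R) :
    ∃ x, completionExp n R x = characterValue n R a := by
  obtain ⟨y, hy, h⟩ := RingChar.exists_mem_nilFixed_of_value (padicMap p k R)
    (natCast_pow_eq_zero_of_algebra p k R) a.toRingChar
  exact ⟨Multiplicative.ofAdd ⟨WittVector.truncate n y, inCompletion_truncate hy⟩,
    (truncExp_truncate _ y).trans h.symm⟩

lemma exists_characterValue_eq (R : CommAlgCat.{u} (ZMod (p ^ k)))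
    (x : Multiplicative (completionSubgroup p k n R)) :
    ∃ a, characterValue n R a = completionExp n R x := by
  obtain ⟨y, hy, h⟩ := InCompletion.exists_truncate_eq x.toAdd.2
  obtain ⟨a, ha⟩ := RingChar.exists_value_eq_of_mem_nilFixed (n := n) (padicMap p k R)
    (natCast_pow_eq_zero_of_algebra p k R) y hy
  refine ⟨a.toCharacter, ?_⟩
  rw [characterValue_toCharacter, ha, ← truncExp_truncate, h]
  rfl

/-- The character attached to a point of the completion of `W_n`. -/
def completionToCharacter (n : ℕ) (R : CommAlgCat.{u} (ZMod (p ^ k))) :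
    Multiplicative (completionSubgroup p k n R) →*
      Character (wittUnitsFrobeniusKer.{u} p n (ZMod (p ^ k))) R where
  toFun x := (exists_characterValue_eq R x).choose
  map_one' := characterValue_injective n R (by
    rw [(exists_characterValue_eq R 1).choose_spec, map_one, map_one])
  map_mul' x y := characterValue_injective n R (by
    rw [(exists_characterValue_eq R _).choose_spec, map_mul, map_mul,
      (exists_characterValue_eq R x).choose_spec, (exists_characterValue_eq R y).choose_spec])

lemma characterValue_completionToCharacter (R : CommAlgCat.{u} (ZMod (p ^ k)))
    (x : Multiplicative (completionSubgroup p k n R)) :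
    characterValue n R (completionToCharacter n R x) = completionExp n R x :=
  (exists_characterValue_eq R x).choose_spec

/-- Both groups inject into the truncated power series, by the exponential and by the value, and the
two images coincide. -/
lemma completionToCharacter_bijective (n : ℕ) (R : CommAlgCat.{u} (ZMod (p ^ k))) :
    Function.Bijective (completionToCharacter (p := p) n R) := by
  constructor
  · intro x y h
    apply completionExp_injective n R
    rw [← characterValue_completionToCharacter, h, characterValue_completionToCharacter]
  · intro a
    obtain ⟨x, hx⟩ := exists_completionExp_eq R a
    refine ⟨x, characterValue_injective n R ?_⟩
    rw [characterValue_completionToCharacter, hx]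

lemma completionToCharacter_map {R S : CommAlgCat.{u} (ZMod (p ^ k))} (s : R ⟶ S)
    (x : completionSubgroup p k n R) :
    completionToCharacter n S (Multiplicative.ofAdd (completionMap s x)) =
      (completionToCharacter n R (Multiplicative.ofAdd x)).baseChange s := by
  apply characterValue_injective n S
  rw [characterValue_completionToCharacter, completionExp_map, characterValue_baseChange,
    characterValue_completionToCharacter]

end Comparison

end WittCartier

end

theorem mainTheorem12 (p : ℕ) [Fact p.Prime] (k n : ℕ) :
    Nonempty (WittCartier.cartierDual
        (WittCartier.wittUnitsFrobeniusKer.{u} p n (ZMod (p ^ k))) ≅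
      WittCartier.wittCompletion.{u} p k n ⋙ AddCommGrpCat.toCommGrp ⋙
        CommGrpCat.uliftFunctor.{u + 1, u}) ∧
    Nonempty (TruncatedWittVector p n (ZMod p) ≃+ ZMod (p ^ n)) := by
  -- The isomorphism is built from the completion to the dual and then inverted. The universe lift
  -- is needed because a character is a family over all algebras in universe `u`.
  refine ⟨⟨(NatIso.ofComponents (fun R => MulEquiv.toCommGrpIso (MulEquiv.ulift.trans
    (MulEquiv.ofBijective _ (WittCartier.completionToCharacter_bijective n R)))) ?_).symm⟩,
    ⟨(TruncatedWittVector.zmodEquivTrunc p n).symm.toAddEquiv⟩⟩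
  intro R S s
  apply CommGrpCat.hom_ext
  apply MonoidHom.ext
  rintro ⟨x⟩
  exact WittCartier.completionToCharacter_map s x.toAdd
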